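/- For every integer $n\ge 2$ and every $\alpha\in[0,1)$ there exist a bounded smooth domain $\Omega\subset\mathbb{R}^n$ with connected boundary, a function $f\in C(\partial\Omega)$, and a function $a\in C^{1,\alpha}(\Omega)$ with $\inf_{x\in\Omega}a(x)>0$ such that the weighted least gradient problem \[ \inf_{v\in BV_f(\Omega)}\int_\Omega a\,|Dv| \] has infinitely many minimizers in $BV_f(\Omega)$ (functions that agree almost everywhere being identified). Here $|Dv|$ is the total variation measure of the distributional gradient $Dv$ of $v\in BV(\Omega)$, \[ BV_f(\Omega):=\Big\{v\in BV(\Omega):\ \lim_{r\to0}\ \operatorname*{ess\,sup}_{y\in\Omega,\ |x-y|<r}|f(x)-v(y)|=0\ \text{ for all } x\in\partial\Omega\Big\}, \] and $a\in C^{1,\alpha}(\Omega)$ means that $a\in C^1(\Omega)$, that $a$ and $\nabla a$ are bounded in $\Omega$, and that $|\nabla a(x)-\nabla a(y)|\le C|x-y|^\alpha$ for some constant $C$ and all $x,y\in\Omega$ (for $\alpha=0$ this last condition only says that $\nabla a$ has bounded oscillation). -/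

import Mathlib

open MeasureTheory Set Filter Topology
open scoped NNReal ContDiff

namespace LeastGradient

/-- `Ω ⊆ ℝⁿ` is a bounded smooth domain: it is nonempty, connected, open and bounded, and near each
of its boundary points it is the sublevel set `{ρ < 0}` of a smooth function `ρ` whose differential
does not vanish at that point. -/
structure IsBoundedSmoothDomain {n : ℕ} (Ω : Set (EuclideanSpace ℝ (Fin n))) : Prop where
  isOpen : IsOpen Ω
  isConnected : IsConnected Ω
  isBounded : Bornology.IsBounded Ω
  smooth_boundary : ∀ x ∈ frontier Ω, ∃ (U : Set (EuclideanSpace ℝ (Fin n)))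
    (ρ : EuclideanSpace ℝ (Fin n) → ℝ),
      IsOpen U ∧ x ∈ U ∧ ContDiffOn ℝ ∞ ρ U ∧ fderiv ℝ ρ x ≠ 0 ∧ Ω ∩ U = {y ∈ U | ρ y < 0}

/-- `a ∈ C^{1,α}(Ω)`, with finite norm: `a` is continuously differentiable in the open set `Ω`,
`a` and its derivative are bounded in `Ω`, and the derivative is Hölder continuous in `Ω` with
exponent `α`. -/
structure IsC1Holder {n : ℕ} (α : ℝ≥0) (Ω : Set (EuclideanSpace ℝ (Fin n)))
    (a : EuclideanSpace ℝ (Fin n) → ℝ) : Prop where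
  contDiffOn : ContDiffOn ℝ 1 a Ω
  bounded : ∃ C : ℝ, ∀ x ∈ Ω, |a x| ≤ C ∧ ‖fderiv ℝ a x‖ ≤ C
  holder : ∃ C : ℝ≥0, HolderOnWith C α (fderiv ℝ a) Ω

/-- The vector measure `D` is the distributional gradient `Du` of `u` in the open set `Ω`, and it has
finite total variation: `D` is carried by `Ω`, and `∫_Ω u ∇φ dx = - ∫ φ dD` for every real test
function `φ ∈ C_c^∞(Ω)`. Here `D.variation` is the total variation measure `|Du|` with respect to
the Euclidean norm. For given `u` there is at most one such `D`. -/
structure IsGradientMeasure {n : ℕ} (Ω : Set (EuclideanSpace ℝ (Fin n)))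
    (u : EuclideanSpace ℝ (Fin n) → ℝ)
    (D : VectorMeasure (EuclideanSpace ℝ (Fin n)) (EuclideanSpace ℝ (Fin n))) : Prop where
  variation_lt_top : D.variation univ < ⊤
  variation_compl : D.variation Ωᶜ = 0
  integral_gradient : ∀ φ : EuclideanSpace ℝ (Fin n) → ℝ,
    ContDiff ℝ ∞ φ → HasCompactSupport φ → tsupport φ ⊆ Ω →
      ∫ x in Ω, u x • gradient φ x = - ∫ᵛ x, φ x ∂•D

/-- `BV(Ω)`: the classes `u ∈ L¹(Ω)` whose distributional gradient is a vector measure of finite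
total variation. -/
def BV {n : ℕ} (Ω : Set (EuclideanSpace ℝ (Fin n))) : Set (Lp ℝ 1 (volume.restrict Ω)) :=
  {u | ∃ D, IsGradientMeasure Ω u D}

/-- The weighted total variation `∫_Ω a |Du|`, that is, the integral of `a` against the total
variation measure of the distributional gradient `Du`. The infimum only serves to select this
measure: it is over a set with one element for `u ∈ BV(Ω)`, and the value is `∞` for other `u`. -/
noncomputable def weightedTV {n : ℕ} (Ω : Set (EuclideanSpace ℝ (Fin n)))
    (a : EuclideanSpace ℝ (Fin n) → ℝ) (u : Lp ℝ 1 (volume.restrict Ω)) : ENNReal :=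
  ⨅ (D : VectorMeasure (EuclideanSpace ℝ (Fin n)) (EuclideanSpace ℝ (Fin n)))
    (_ : IsGradientMeasure Ω u D), ∫⁻ x in Ω, ENNReal.ofReal (a x) ∂D.variation

/-- `BV_f(Ω)`: the functions `v ∈ BV(Ω)` with boundary values `f`, in the sense that for every
`x ∈ ∂Ω` the essential supremum of `|f(x) - v(y)|` over the `y ∈ Ω` with `|x - y| < r` tends to
`0` as `r → 0`. -/
def BVf {n : ℕ} (Ω : Set (EuclideanSpace ℝ (Fin n))) (f : C(frontier Ω, ℝ)) :
    Set (Lp ℝ 1 (volume.restrict Ω)) :=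
  {v | v ∈ BV Ω ∧ ∀ x : frontier Ω,
    Tendsto (fun r : ℝ => essSup (fun y => ENNReal.ofReal |f x - v y|)
      (volume.restrict (Ω ∩ Metric.ball (x : EuclideanSpace ℝ (Fin n)) r))) (𝓝[>] 0) (𝓝 0)}

/-- The minimizers of the weighted least gradient problem `inf {∫_Ω a |Dv| : v ∈ BV_f(Ω)}`, as
classes modulo equality almost everywhere. -/
def minimizers {n : ℕ} (Ω : Set (EuclideanSpace ℝ (Fin n)))
    (a : EuclideanSpace ℝ (Fin n) → ℝ) (f : C(frontier Ω, ℝ)) :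
    Set (Lp ℝ 1 (volume.restrict Ω)) :=
  {u | u ∈ BVf Ω f ∧ ∀ v ∈ BVf Ω f, weightedTV Ω a u ≤ weightedTV Ω a v}

end LeastGradient

/-! ### Integration against vector measures -/

namespace LeastGradient

/-! Write x = (y, x') with y = `x 0` and s = |x'|² - 1, and let Ω be the ball of radius 5/4 in
dimension N + 1. It contains the sphere Σ = {s = y = 0}, which has codimension two. Uniqueness fails
because of a family of hypersurfaces near {y = 0}, minimal for the weight, that all pass through Σ:
the small level sets of `wedge`, y s^(-k) exp(k(s - 2y²)) with k even. They fill a wedge |y| <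
ε|s|^k that is pinched along Σ. A competitor is a function of `wedge` that rises from 0 to 1 inside
this wedge. Because of the pinching, the rise can be chosen independently for s < 0 and s > 0. The
parameter c is the value on the open disc {y = 0, s < 0}; changing it alters the function only in a
lens that stays away from ∂Ω, so all c in [0, 1] give the same boundary values.

All competitors minimize by one calibration: if X is bounded and divergence free with |X| = a and X
· ∇u = |X||∇u|, then ∫ a|Du| = ∫ X · ∇u ≤ ∫ a|Dv| for every v with the same boundary values
(`mem_minimizers_of_calibration`). The weight is defined as |X|, so X has to be designed such that
|X| is C^{1,α} and bounded below. For every K the field (N K + x'·∇K) e₀ - ∂_y K x' is divergence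
free, and X is the one with K = ϱ^(N/2). Its flow lines are the level sets of (1 + s)ϱ, which is
prescribed as 1 + s√(1 + (1 - s²) s^(2k-2) M(y/s^k)). The choice M(θ) = 4kθ² near 0 makes the flow
orthogonal to the level sets of `wedge` (`IsBump.axial_eq`, `IsBump.calibration_eq`), while M = 0
for |θ| > 1 leaves X = N e₀ outside |y| ≤ |s|^k.

The weight is then a smooth function of expressions s^(2k-2) Q(s, y/s^k). Their gradients have size
|s|^(k-2) and vary on the length scale |s|^k, so they are Hölder continuous with exponent (k-2)/k
(`holderC1_scaled`), which exceeds any given α < 1 for large k.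

Two singularities need care. The density ϱ is smooth only off s = 0, so X is reached as a limit of
bounded smooth divergence free fields, cut off near s = 0, where ϱ - 1 = O(s). The competitors are
singular on Σ, but their gradients are at most C|s|^(-k) in |y| ≤ |s|^k, hence integrable, and Σ is
removable (`isGradientMeasure_of_hasFDerivAt`). -/

/-- An additive functional on integrable functions that is bounded by the `L¹` norm and vanishes on
indicators of measurable sets vanishes identically. -/
theorem eq_zero_of_indicator {X E G : Type*} [MeasurableSpace X] [NormedAddCommGroup E]
    [NormedAddCommGroup G] {ν : Measure X} [IsFiniteMeasure ν] {Δ : (X → E) → G} {C : ℝ}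
    (hadd : ∀ f g, Integrable f ν → Integrable g ν → Δ (f + g) = Δ f + Δ g)
    (hbd : ∀ f, Integrable f ν → ‖Δ f‖ ≤ C * ∫ x, ‖f x‖ ∂ν)
    (hind : ∀ (c : E) (s : Set X), MeasurableSet s → Δ (s.indicator fun _ => c) = 0)
    {f : X → E} (hf : Integrable f ν) : Δ f = 0 := by
  have hsub : ∀ f g, Integrable f ν → Integrable g ν → ‖Δ f - Δ g‖ ≤ C * ∫ x, ‖f x - g x‖ ∂ν := by
    intro f g hf hg
    have h := hadd (f - g) g (hf.sub hg) hg
    rw [sub_add_cancel] at h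
    rw [h, add_sub_cancel_right]
    exact hbd _ (hf.sub hg)
  refine Integrable.induction (fun f => Δ f = 0) ?_ ?_ ?_ ?_ hf
  · intro c s hs _
    exact hind c s hs
  · intro f g _ hf hg hf0 hg0
    rw [hadd f g hf hg, hf0, hg0, add_zero]
  · have hc : Continuous fun f : X →₁[ν] E => Δ f := by
      have : LipschitzWith (Real.toNNReal C) fun f : X →₁[ν] E => Δ f := by
        refine LipschitzWith.of_dist_le_mul fun f g => ?_
        rw [dist_eq_norm, L1.dist_eq_integral_dist]
        refine (hsub f g (L1.integrable_coeFn f) (L1.integrable_coeFn g)).trans ?_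
        simp only [dist_eq_norm]
        gcongr
        exact Real.le_coe_toNNReal C
      exact this.continuous
    exact isClosed_eq hc continuous_const
  · intro f g hfg hf hf0
    have h := hsub g f (hf.congr hfg) hf
    have : ∫ x, ‖g x - f x‖ ∂ν = 0 := by
      rw [← integral_zero X ℝ (μ := ν)]
      refine integral_congr_ae ?_
      filter_upwards [hfg] with x hx
      simp [hx]
    rw [this, mul_zero, hf0, sub_zero] at h
    exact norm_le_zero_iff.1 h

variable {X : Type*} [MeasurableSpace X]

theorem vectorMeasure_integral_indicator_const {E F G : Type*} [NormedAddCommGroup E]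
    [NormedSpace ℝ E] [NormedAddCommGroup F] [NormedSpace ℝ F] [NormedAddCommGroup G]
    [NormedSpace ℝ G] [CompleteSpace G] (D : VectorMeasure X F) [IsFiniteMeasure D.variation]
    (B : E →L[ℝ] F →L[ℝ] G) (c : E) {s : Set X} (hs : MeasurableSet s) :
    VectorMeasure.integral D (s.indicator fun _ => c) B = B c (D s) := by
  rw [VectorMeasure.integral_eq_setToFun, setToFun_indicator_const _ hs (measure_ne_top _ _)]
  rfl

/-- The pairing of a vector field with a vector measure is the sum of the pairings of the
coordinates. -/
theorem integral_inner_eq_sum {n : ℕ} (D : VectorMeasure X (EuclideanSpace ℝ (Fin n)))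
    [IsFiniteMeasure D.variation] {Y : X → EuclideanSpace ℝ (Fin n)} (hY : D.Integrable Y) :
    VectorMeasure.integral D Y (innerSL ℝ) = ∑ i, (∫ᵛ x, Y x i ∂•D) i := by
  rw [← sub_eq_zero]
  have hcoord : ∀ Z : X → EuclideanSpace ℝ (Fin n), D.Integrable Z → ∀ i,
      D.Integrable fun x => Z x i := fun Z hZ i =>
    (EuclideanSpace.proj i : EuclideanSpace ℝ (Fin n) →L[ℝ] ℝ).integrable_comp hZ
  refine eq_zero_of_indicator (ν := D.variation)
    (Δ := fun Y => VectorMeasure.integral D Y (innerSL ℝ) - ∑ i, (∫ᵛ x, Y x i ∂•D) i)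
    -- One unit bounds the pairing itself, and each of the `n` coordinate integrals contributes
    -- another.
    (C := 1 + n) ?_ ?_ ?_ hY
  · intro f g hf hg
    simp only [Pi.add_apply, PiLp.add_apply]
    rw [VectorMeasure.integral_add hf hg]
    have : ∀ i, (∫ᵛ x, (f x i + g x i) ∂•D) i = (∫ᵛ x, f x i ∂•D) i + (∫ᵛ x, g x i ∂•D) i := by
      intro i
      rw [VectorMeasure.integral_fun_add (hcoord f hf i) (hcoord g hg i)]
      rfl
    simp only [this, Finset.sum_add_distrib]
    abel
  · intro f hf
    refine (norm_sub_le _ _).trans ?_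
    rw [add_mul]
    gcongr
    · refine VectorMeasure.norm_integral_le_integral_norm.trans ?_
      gcongr
      exact norm_innerSL_le ℝ
    · refine (norm_sum_le _ _).trans ?_
      have : ∀ i ∈ Finset.univ, ‖(∫ᵛ x, f x i ∂•D) i‖ ≤ ∫ x, ‖f x‖ ∂D.variation := by
        intro i _
        refine (PiLp.norm_apply_le _ i).trans (VectorMeasure.norm_integral_le_integral_norm.trans ?_)
        refine (mul_le_of_le_one_left (by positivity) ContinuousLinearMap.opNorm_lsmul_le).trans ?_
        refine integral_mono (hcoord f hf i).norm hf.norm fun x => ?_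
        exact PiLp.norm_apply_le _ i
      refine (Finset.sum_le_card_nsmul _ _ _ this).trans ?_
      simp
  · intro c s hs
    have : ∀ i, (∫ᵛ x, (s.indicator (fun _ => c) x) i ∂•D) i = c i * D s i := by
      intro i
      have h : (fun x => (s.indicator (fun _ => c) x) i) = s.indicator fun _ => c i := by
        ext x
        by_cases hx : x ∈ s <;> simp [hx]
      rw [h, vectorMeasure_integral_indicator_const D _ _ hs]
      rfl
    simp only [this]
    rw [vectorMeasure_integral_indicator_const D _ _ hs, sub_eq_zero, innerSL_apply_apply,
      PiLp.inner_apply]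
    refine Finset.sum_congr rfl fun i _ => ?_
    simp [mul_comm]

/-- The pairing of a vector field with a vector measure is bounded by the integral of its norm
against the total variation. -/
theorem abs_integral_inner_le {n : ℕ} (D : VectorMeasure X (EuclideanSpace ℝ (Fin n)))
    (Y : X → EuclideanSpace ℝ (Fin n)) :
    |VectorMeasure.integral D Y (innerSL ℝ)| ≤ ∫ x, ‖Y x‖ ∂D.variation := by
  rw [← Real.norm_eq_abs]
  refine VectorMeasure.norm_integral_le_integral_norm.trans ?_
  exact mul_le_of_le_one_left (by positivity) (norm_innerSL_le ℝ)

/-- Integration of a scalar function against a vector measure with density. -/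
theorem integral_withDensityᵥ {F : Type*} [NormedAddCommGroup F] [NormedSpace ℝ F]
    [CompleteSpace F] {μ : Measure X} {g : X → F} (hg : Integrable g μ) {φ : X → ℝ}
    (hφm : AEStronglyMeasurable φ μ) (C : ℝ) (hφ : ∀ x, |φ x| ≤ C) :
    ∫ᵛ x, φ x ∂•(μ.withDensityᵥ g) = ∫ x, φ x • g x ∂μ := by
  have hvar := Measure.variation_withDensityᵥ hg
  have : IsFiniteMeasure (μ.withDensityᵥ g).variation := by
    rw [hvar]
    exact isFiniteMeasure_withDensity (by simpa using! hg.2.ne)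
  have hac : (μ.withDensityᵥ g).variation ≪ μ := by
    rw [hvar]; exact withDensity_absolutelyContinuous _ _
  have hiff : ∀ f : X → ℝ, Integrable f (μ.withDensityᵥ g).variation ↔
      Integrable (fun x => ‖g x‖ * f x) μ := by
    intro f
    rw [hvar, integrable_withDensity_iff_integrable_smul₀' hg.aestronglyMeasurable.enorm
      (by simp)]
    simp
  have hint : ∀ f : X → ℝ, ∫ x, f x ∂(μ.withDensityᵥ g).variation = ∫ x, ‖g x‖ * f x ∂μ := by
    intro f
    rw [hvar, integral_withDensity_eq_integral_toReal_smul₀ hg.aestronglyMeasurable.enorm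
      (by simp)]
    simp
  have hI : Integrable φ (μ.withDensityᵥ g).variation :=
    Integrable.of_bound (hφm.mono_ac hac) C (Eventually.of_forall hφ)
  have hsm : ∀ f : X → ℝ, Integrable f (μ.withDensityᵥ g).variation →
      Integrable (fun x => f x • g x) μ := by
    intro f hf
    -- The variation does not see the set where `g` vanishes, so `f` is measurable only off that
    -- set; the product with `g` is not affected.
    obtain ⟨f', hf'm, hff'⟩ := hf.aestronglyMeasurable
    rw [hvar] at hff'
    have h1 := (ae_withDensity_iff' hg.aestronglyMeasurable.enorm).1 hff'
    have h2 : (fun x => f x • g x) =ᵐ[μ] fun x => f' x • g x := by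
      filter_upwards [h1] with x hx
      by_cases h0 : g x = 0
      · simp [h0]
      · rw [hx (by simpa using h0)]
    have h3 : AEStronglyMeasurable (fun x => f x • g x) μ :=
      (hf'm.aestronglyMeasurable.smul hg.aestronglyMeasurable).congr h2.symm
    refine ((hiff f).1 hf).mono h3 (Eventually.of_forall fun x => ?_)
    simp [norm_smul, mul_comm]
  rw [← sub_eq_zero]
  refine eq_zero_of_indicator (ν := (μ.withDensityᵥ g).variation)
    (Δ := fun φ => ∫ᵛ x, φ x ∂•(μ.withDensityᵥ g) - ∫ x, φ x • g x ∂μ)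
    (C := 2) ?_ ?_ ?_ hI
  · intro f h hf hh
    simp only [Pi.add_apply, add_smul]
    rw [VectorMeasure.integral_fun_add hf hh, integral_add (hsm f hf) (hsm h hh)]
    abel
  · intro f hf
    refine (norm_sub_le _ _).trans ?_
    rw [two_mul]
    gcongr
    · refine VectorMeasure.norm_integral_le_integral_norm.trans ?_
      exact mul_le_of_le_one_left (by positivity) ContinuousLinearMap.opNorm_lsmul_le
    · refine (norm_integral_le_integral_norm _).trans ?_
      rw [hint]
      simp [norm_smul, mul_comm]
  · intro c s hs
    have h : ∀ x, (s.indicator (fun _ => c) x) • g x = s.indicator (fun x => c • g x) x := by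
      intro x
      by_cases hx : x ∈ s <;> simp [hx]
    simp only [h]
    have h2 : ∫ᵛ x, s.indicator (fun _ => c) x ∂•(μ.withDensityᵥ g) =
      c • (μ.withDensityᵥ g) s := vectorMeasure_integral_indicator_const _ _ _ hs
    rw [h2, withDensityᵥ_apply hg hs, integral_indicator hs, integral_smul, sub_self]

end LeastGradient

/-! ### Divergence free fields and the calibration inequality -/

namespace LeastGradient

variable {n : ℕ}

/-- The divergence of a vector field. -/
noncomputable def divergence (Y : EuclideanSpace ℝ (Fin n) → EuclideanSpace ℝ (Fin n))
    (x : EuclideanSpace ℝ (Fin n)) : ℝ :=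
  ∑ i, fderiv ℝ Y x (EuclideanSpace.single i 1) i

theorem gradient_apply_coord (φ : EuclideanSpace ℝ (Fin n) → ℝ) (x : EuclideanSpace ℝ (Fin n))
    (i : Fin n) : gradient φ x i = fderiv ℝ φ x (EuclideanSpace.single i 1) := by
  have h : inner ℝ (gradient φ x) (EuclideanSpace.single i (1 : ℝ)) =
      fderiv ℝ φ x (EuclideanSpace.single i 1) := by
    rw [gradient, InnerProductSpace.toDual_symm_apply]
  rw [← h, real_inner_comm, EuclideanSpace.inner_single_left]
  simp

theorem fderiv_coord {Y : EuclideanSpace ℝ (Fin n) → EuclideanSpace ℝ (Fin n)}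
    {x : EuclideanSpace ℝ (Fin n)} (hY : DifferentiableAt ℝ Y x) (i : Fin n)
    (w : EuclideanSpace ℝ (Fin n)) :
    fderiv ℝ (fun z => Y z i) x w = fderiv ℝ Y x w i := by
  have h := (EuclideanSpace.proj i : EuclideanSpace ℝ (Fin n) →L[ℝ] ℝ).hasFDerivAt.comp x
    hY.hasFDerivAt
  have h2 : fderiv ℝ (fun z => Y z i) x = _ := h.fderiv
  rw [h2]
  rfl

/-- The defining identity of the gradient measure for vector valued test fields. -/
theorem IsGradientMeasure.integral_divergence {Ω : Set (EuclideanSpace ℝ (Fin n))}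
    {v : EuclideanSpace ℝ (Fin n) → ℝ}
    {D : VectorMeasure (EuclideanSpace ℝ (Fin n)) (EuclideanSpace ℝ (Fin n))}
    (hD : IsGradientMeasure Ω v D) (hv : IntegrableOn v Ω)
    {Y : EuclideanSpace ℝ (Fin n) → EuclideanSpace ℝ (Fin n)} (hY : ContDiff ℝ ∞ Y)
    (hYc : HasCompactSupport Y) (hYs : tsupport Y ⊆ Ω) :
    ∫ x in Ω, v x * divergence Y x = - VectorMeasure.integral D Y (innerSL ℝ) := by
  have : IsFiniteMeasure D.variation := ⟨hD.variation_lt_top⟩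
  have hYi : D.Integrable Y := hY.continuous.integrable_of_hasCompactSupport hYc
  have hdiff : Differentiable ℝ Y := hY.differentiable (by simp)
  rw [integral_inner_eq_sum D hYi, ← Finset.sum_neg_distrib]
  have hvi : ∀ i, ContDiff ℝ ∞ fun x => Y x i := fun i =>
    (EuclideanSpace.proj i : EuclideanSpace ℝ (Fin n) →L[ℝ] ℝ).contDiff.comp hY
  have hci : ∀ i, HasCompactSupport fun x => Y x i := fun i =>
    hYc.comp_left (g := fun z : EuclideanSpace ℝ (Fin n) => z i) rfl
  have hsi : ∀ i, tsupport (fun x => Y x i) ⊆ Ω := fun i =>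
    (closure_mono (Function.support_comp_subset (g := fun z : EuclideanSpace ℝ (Fin n) => z i) rfl
      Y)).trans hYs
  have hgc : ∀ i, Continuous (gradient fun x => Y x i) := fun i =>
    (InnerProductSpace.toDual ℝ (EuclideanSpace ℝ (Fin n))).symm.continuous.comp
      ((hvi i).continuous_fderiv (by simp))
  have hgs : ∀ i, HasCompactSupport (gradient fun x => Y x i) := fun i =>
    ((hci i).fderiv ℝ).comp_left
      (g := (InnerProductSpace.toDual ℝ (EuclideanSpace ℝ (Fin n))).symm) (by simp)
  have hint : ∀ i, IntegrableOn (fun x => v x • gradient (fun x => Y x i) x) Ω := by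
    intro i
    obtain ⟨C, hC⟩ := (hgs i).exists_bound_of_continuous (hgc i)
    exact Integrable.smul_of_top_left hv (memLp_top_of_bound
      (hgc i).aestronglyMeasurable C (Eventually.of_forall hC))
  have hcoord : ∀ i, ∫ x in Ω, v x * fderiv ℝ Y x (EuclideanSpace.single i 1) i =
      - (∫ᵛ x, Y x i ∂•D) i := by
    intro i
    have h := congrArg (fun z : EuclideanSpace ℝ (Fin n) => z i)
      (hD.integral_gradient _ (hvi i) (hci i) (hsi i))
    simp only [PiLp.neg_apply] at h
    rw [← h]
    have h2 := (EuclideanSpace.proj i : EuclideanSpace ℝ (Fin n) →L[ℝ] ℝ).integral_comp_comm (hint i)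
    have h3 : (∫ x in Ω, v x • gradient (fun x => Y x i) x) i =
      (EuclideanSpace.proj i : EuclideanSpace ℝ (Fin n) →L[ℝ] ℝ)
        (∫ x in Ω, v x • gradient (fun x => Y x i) x) := rfl
    rw [h3, ← h2]
    refine integral_congr_ae (Eventually.of_forall fun x => ?_)
    simp [gradient_apply_coord, fderiv_coord (hdiff x)]
  have hint2 : ∀ i, IntegrableOn (fun x => v x * fderiv ℝ Y x (EuclideanSpace.single i 1) i) Ω := by
    intro i
    have h2 := (EuclideanSpace.proj i : EuclideanSpace ℝ (Fin n) →L[ℝ] ℝ).integrable_comp (hint i)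
    refine h2.congr (Eventually.of_forall fun x => ?_)
    simp [gradient_apply_coord, fderiv_coord (hdiff x)]
  simp only [divergence, Finset.mul_sum]
  rw [integral_finsetSum _ fun i _ => hint2 i]
  exact Finset.sum_congr rfl fun i _ => hcoord i

theorem divergence_smul {η : EuclideanSpace ℝ (Fin n) → ℝ}
    {Y : EuclideanSpace ℝ (Fin n) → EuclideanSpace ℝ (Fin n)} {x : EuclideanSpace ℝ (Fin n)}
    (hη : DifferentiableAt ℝ η x) (hY : DifferentiableAt ℝ Y x) :
    divergence (fun z => η z • Y z) x = fderiv ℝ η x (Y x) + η x * divergence Y x := by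
  have h := (hη.hasFDerivAt.smul hY.hasFDerivAt).fderiv
  have h' : fderiv ℝ (fun z => η z • Y z) x = _ := h
  unfold divergence
  rw [h']
  simp only [add_apply, smul_apply,
    ContinuousLinearMap.smulRight_apply, PiLp.add_apply, PiLp.smul_apply, smul_eq_mul]
  rw [Finset.sum_add_distrib, ← Finset.mul_sum, add_comm]
  congr 1
  conv_rhs => rw [show Y x = ∑ i, Y x i • EuclideanSpace.single i (1 : ℝ) by
    ext j; simp [Finset.sum_apply, Pi.single_apply]]
  rw [map_sum]
  refine Finset.sum_congr rfl fun i _ => ?_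
  rw [map_smul, smul_eq_mul, mul_comm]

theorem contDiff_smul_of_tsupport_subset {Ω : Set (EuclideanSpace ℝ (Fin n))} (hΩ : IsOpen Ω)
    {η : EuclideanSpace ℝ (Fin n) → ℝ} (hη : ContDiff ℝ ∞ η) (hs : tsupport η ⊆ Ω)
    {Y : EuclideanSpace ℝ (Fin n) → EuclideanSpace ℝ (Fin n)} (hY : ContDiffOn ℝ ∞ Y Ω) :
    ContDiff ℝ ∞ fun x => η x • Y x := by
  refine contDiff_iff_contDiffAt.2 fun x => ?_
  by_cases hx : x ∈ tsupport η
  · exact hη.contDiffAt.smul (hY.contDiffAt (hΩ.mem_nhds (hs hx)))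
  · have : (fun x => η x • Y x) =ᶠ[𝓝 x] fun _ => 0 := by
      filter_upwards [(isClosed_tsupport η).isOpen_compl.mem_nhds hx] with z hz
      rw [image_eq_zero_of_notMem_tsupport hz, zero_smul]
    exact contDiffAt_const.congr_of_eventuallyEq this

/-- Two functions pair in the same way with a divergence free field, up to a term that lives where
the cutoff varies. -/
theorem integral_inner_sub_of_divergence_eq_zero {Ω : Set (EuclideanSpace ℝ (Fin n))}
    (hΩ : IsOpen Ω) {u v : EuclideanSpace ℝ (Fin n) → ℝ}
    {Du Dv : VectorMeasure (EuclideanSpace ℝ (Fin n)) (EuclideanSpace ℝ (Fin n))}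
    (hDu : IsGradientMeasure Ω u Du) (hDv : IsGradientMeasure Ω v Dv)
    (hu : IntegrableOn u Ω) (hv : IntegrableOn v Ω)
    {Y : EuclideanSpace ℝ (Fin n) → EuclideanSpace ℝ (Fin n)} (hY : ContDiffOn ℝ ∞ Y Ω)
    (hdiv : ∀ x ∈ Ω, divergence Y x = 0)
    {η : EuclideanSpace ℝ (Fin n) → ℝ} (hη : ContDiff ℝ ∞ η) (hηc : HasCompactSupport η)
    (hηs : tsupport η ⊆ Ω) :
    VectorMeasure.integral Du (fun x => η x • Y x) (innerSL ℝ) -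
      VectorMeasure.integral Dv (fun x => η x • Y x) (innerSL ℝ) =
      ∫ x in Ω, (v x - u x) * fderiv ℝ η x (Y x) := by
  have hZ := contDiff_smul_of_tsupport_subset hΩ hη hηs hY
  have hZc : HasCompactSupport fun x => η x • Y x := hηc.smul_right
  have hZs : tsupport (fun x => η x • Y x) ⊆ Ω := (tsupport_smul_subset_left η Y).trans hηs
  have h1 := hDu.integral_divergence hu hZ hZc hZs
  have h2 := hDv.integral_divergence hv hZ hZc hZs
  have hdivZ : ∀ x ∈ Ω, divergence (fun x => η x • Y x) x = fderiv ℝ η x (Y x) := by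
    intro x hx
    rw [divergence_smul (hη.differentiable (by simp) x)
      ((hY.contDiffAt (hΩ.mem_nhds hx)).differentiableAt (by simp)), hdiv x hx, mul_zero, add_zero]
  have hcont : Continuous (divergence fun x => η x • Y x) := by
    unfold divergence
    refine continuous_finsetSum _ fun i _ => ?_
    have h : Continuous fun x => fderiv ℝ (fun x => η x • Y x) x (EuclideanSpace.single i 1) :=
      (hZ.continuous_fderiv (by simp)).clm_apply continuous_const
    exact (EuclideanSpace.proj i : EuclideanSpace ℝ (Fin n) →L[ℝ] ℝ).continuous.comp h
  have hcs : HasCompactSupport (divergence fun x => η x • Y x) :=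
    (hZc.fderiv ℝ).comp_left (g := fun L : EuclideanSpace ℝ (Fin n) →L[ℝ] EuclideanSpace ℝ (Fin n)
      => ∑ i, L (EuclideanSpace.single i 1) i) (by simp)
  obtain ⟨C, hC⟩ := hcs.exists_bound_of_continuous hcont
  have hi : ∀ w : EuclideanSpace ℝ (Fin n) → ℝ, IntegrableOn w Ω →
      IntegrableOn (fun x => w x * divergence (fun x => η x • Y x) x) Ω := fun w hw =>
    Integrable.mul_bdd hw hcont.aestronglyMeasurable (Eventually.of_forall hC)
  have h3 : ∫ x in Ω, (v x - u x) * fderiv ℝ η x (Y x) =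
      ∫ x in Ω, (v x * divergence (fun x => η x • Y x) x -
        u x * divergence (fun x => η x • Y x) x) := by
    refine setIntegral_congr_fun hΩ.measurableSet fun x hx => ?_
    simp only [hdivZ x hx]
    ring
  rw [h3, integral_sub (hi v hv) (hi u hu), h1, h2]
  ring

/-- The pairing of a bounded field with a gradient measure that has a density. -/
theorem integral_inner_withDensityᵥ {μ : Measure (EuclideanSpace ℝ (Fin n))}
    {g : EuclideanSpace ℝ (Fin n) → EuclideanSpace ℝ (Fin n)} (hg : Integrable g μ)
    {Z : EuclideanSpace ℝ (Fin n) → EuclideanSpace ℝ (Fin n)} (hZ : Continuous Z)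
    (hZc : HasCompactSupport Z) :
    VectorMeasure.integral (μ.withDensityᵥ g) Z (innerSL ℝ) = ∫ x, inner ℝ (Z x) (g x) ∂μ := by
  have : IsFiniteMeasure (μ.withDensityᵥ g).variation := by
    rw [Measure.variation_withDensityᵥ hg]
    exact isFiniteMeasure_withDensity (by simpa using! hg.2.ne)
  obtain ⟨C, hC⟩ := hZc.exists_bound_of_continuous hZ
  have hZi : ∀ i, Continuous fun x => Z x i := fun i =>
    (EuclideanSpace.proj i : EuclideanSpace ℝ (Fin n) →L[ℝ] ℝ).continuous.comp hZ
  have hb : ∀ i x, |Z x i| ≤ C := fun i x => (PiLp.norm_apply_le (Z x) i).trans (hC x)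
  have hsm : ∀ i, Integrable (fun x => Z x i • g x) μ := fun i =>
    Integrable.smul_of_top_right hg (memLp_top_of_bound (hZi i).aestronglyMeasurable C
      (Eventually.of_forall (hb i)))
  rw [integral_inner_eq_sum _ (hZ.integrable_of_hasCompactSupport hZc)]
  have h1 : ∀ i, (∫ᵛ x, Z x i ∂•(μ.withDensityᵥ g)) i = ∫ x, Z x i * g x i ∂μ := by
    intro i
    rw [integral_withDensityᵥ hg (hZi i).aestronglyMeasurable C (hb i)]
    exact ((EuclideanSpace.proj i : EuclideanSpace ℝ (Fin n) →L[ℝ] ℝ).integral_comp_comm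
      (hsm i)).symm
  have h2 : ∀ i, Integrable (fun x => Z x i * g x i) μ := fun i =>
    (EuclideanSpace.proj i : EuclideanSpace ℝ (Fin n) →L[ℝ] ℝ).integrable_comp (hsm i)
  simp only [h1]
  rw [← integral_finsetSum _ fun i _ => h2 i]
  refine integral_congr_ae (Eventually.of_forall fun x => ?_)
  simp [PiLp.inner_apply, mul_comm]

/-- **Calibration.** If a bounded field `X` is the limit of divergence free fields, then its pairing
with a gradient depends only on the boundary values, so that `∫ X · ∇u ≤ ∫ ‖X‖ d|Dv|`. -/
theorem integral_inner_le_of_tendsto {Ω : Set (EuclideanSpace ℝ (Fin n))}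
    (hΩ : IsOpen Ω) {u v : EuclideanSpace ℝ (Fin n) → ℝ}
    {g : EuclideanSpace ℝ (Fin n) → EuclideanSpace ℝ (Fin n)} (hg : IntegrableOn g Ω)
    {Dv : VectorMeasure (EuclideanSpace ℝ (Fin n)) (EuclideanSpace ℝ (Fin n))}
    (hDu : IsGradientMeasure Ω u ((volume.restrict Ω).withDensityᵥ g))
    (hDv : IsGradientMeasure Ω v Dv)
    (hu : IntegrableOn u Ω) (hv : IntegrableOn v Ω)
    {X : EuclideanSpace ℝ (Fin n) → EuclideanSpace ℝ (Fin n)}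
    {Y : ℕ → EuclideanSpace ℝ (Fin n) → EuclideanSpace ℝ (Fin n)}
    (hY : ∀ j, ContDiffOn ℝ ∞ (Y j) Ω) (hdiv : ∀ j, ∀ x ∈ Ω, divergence (Y j) x = 0)
    {C : ℝ} (hYC : ∀ j, ∀ x ∈ Ω, ‖Y j x‖ ≤ C)
    (hYX : ∀ x ∈ Ω, Tendsto (fun j => Y j x) atTop (𝓝 (X x)))
    {η : ℕ → EuclideanSpace ℝ (Fin n) → ℝ} (hη : ∀ m, ContDiff ℝ ∞ (η m))
    (hηc : ∀ m, HasCompactSupport (η m)) (hηs : ∀ m, tsupport (η m) ⊆ Ω)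
    (hη01 : ∀ m x, η m x ∈ Icc (0 : ℝ) 1)
    (hη1 : ∀ x ∈ Ω, Tendsto (fun m => η m x) atTop (𝓝 1))
    (herr : Tendsto (fun m => ∫ x in Ω, |v x - u x| * ‖fderiv ℝ (η m) x‖) atTop (𝓝 0)) :
    ∫ x in Ω, inner ℝ (X x) (g x) ≤ ∫ x in Ω, ‖X x‖ ∂Dv.variation := by
  have : IsFiniteMeasure Dv.variation := ⟨hDv.variation_lt_top⟩
  have hXC : ∀ x ∈ Ω, ‖X x‖ ≤ C := fun x hx =>
    le_of_tendsto (hYX x hx).norm (Eventually.of_forall fun j => hYC j x hx)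
  have hYm : ∀ (μ : Measure (EuclideanSpace ℝ (Fin n))) j,
      AEStronglyMeasurable (Y j) (μ.restrict Ω) := fun μ j =>
    (hY j).continuousOn.aestronglyMeasurable hΩ.measurableSet
  have hXm : ∀ (μ : Measure (EuclideanSpace ℝ (Fin n))),
      AEStronglyMeasurable X (μ.restrict Ω) := fun μ =>
    aestronglyMeasurable_of_tendsto_ae atTop (hYm μ)
      ((ae_restrict_iff' hΩ.measurableSet).2 (Eventually.of_forall hYX))
  have hae : ∀ (μ : Measure (EuclideanSpace ℝ (Fin n))) (P : EuclideanSpace ℝ (Fin n) → Prop),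
      (∀ x ∈ Ω, P x) → ∀ᵐ x ∂(μ.restrict Ω), P x := fun μ P h =>
    (ae_restrict_iff' hΩ.measurableSet).2 (Eventually.of_forall h)
  have hA : ∀ m j, ∫ x in Ω, η m x * inner ℝ (Y j x) (g x) ≤
      ∫ x in Ω, ‖Y j x‖ ∂Dv.variation + C * ∫ x in Ω, |v x - u x| * ‖fderiv ℝ (η m) x‖ := by
    intro m j
    have hZ := contDiff_smul_of_tsupport_subset hΩ (hη m) (hηs m) (hY j)
    have hZc : HasCompactSupport fun x => η m x • Y j x := (hηc m).smul_right
    have h1 := integral_inner_sub_of_divergence_eq_zero hΩ hDu hDv hu hv (hY j) (hdiv j)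
      (hη m) (hηc m) (hηs m)
    rw [integral_inner_withDensityᵥ hg hZ.continuous hZc] at h1
    have h2 : VectorMeasure.integral Dv (fun x => η m x • Y j x) (innerSL ℝ) ≤
        ∫ x in Ω, ‖Y j x‖ ∂Dv.variation := by
      refine (le_abs_self _).trans ((abs_integral_inner_le Dv _).trans ?_)
      -- The cutoff is supported in `Ω` and at most 1, so it can be dropped after restricting to
      -- `Ω`.
      rw [← setIntegral_eq_integral_of_forall_compl_eq_zero (s := Ω)]
      · refine integral_mono_ae (hZ.continuous.integrable_of_hasCompactSupport hZc).norm.integrableOn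
          ?_ ?_
        · exact (Integrable.of_bound (hYm _ j) C (hae _ _ (hYC j))).norm
        · refine Eventually.of_forall fun x => ?_
          simp only [norm_smul, Real.norm_eq_abs, abs_of_nonneg (hη01 m x).1]
          exact mul_le_of_le_one_left (norm_nonneg _) (hη01 m x).2
      · intro x hx
        rw [image_eq_zero_of_notMem_tsupport fun h => hx (hηs m h), zero_smul, norm_zero]
    have h3 : ∫ x in Ω, (v x - u x) * fderiv ℝ (η m) x (Y j x) ≤
        C * ∫ x in Ω, |v x - u x| * ‖fderiv ℝ (η m) x‖ := by
      rw [← integral_const_mul]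
      refine (le_abs_self _).trans ((abs_integral_le_integral_abs).trans ?_)
      obtain ⟨C', hC'⟩ := ((hηc m).fderiv ℝ).exists_bound_of_continuous
        ((hη m).continuous_fderiv (by simp))
      refine integral_mono_of_nonneg (Eventually.of_forall fun x => abs_nonneg _) ?_
        (hae _ _ fun x hx => ?_)
      · exact (Integrable.mul_bdd (hv.sub hu).abs
          ((hη m).continuous_fderiv (by simp)).norm.aestronglyMeasurable
          (Eventually.of_forall fun x => by simpa using hC' x)).const_mul C
      · simp only [abs_mul]
        rw [mul_left_comm]
        refine mul_le_mul_of_nonneg_left ?_ (abs_nonneg _)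
        rw [mul_comm]
        refine (ContinuousLinearMap.le_opNorm (fderiv ℝ (η m) x) (Y j x)).trans ?_
        gcongr
        exact hYC j x hx
    simp only [inner_smul_left] at h1
    have h4 : ∫ x in Ω, η m x * inner ℝ (Y j x) (g x) =
        ∫ x in Ω, (starRingEnd ℝ) (η m x) * inner ℝ (Y j x) (g x) := rfl
    linarith
  -- The limit in `j` is taken with the cutoff fixed; the boundary error is already independent of
  -- `j`, thanks to the uniform bound `C` on the fields. Only afterwards does the cutoff exhaust
  -- `Ω`.
  have hB : ∀ m, ∫ x in Ω, η m x * inner ℝ (X x) (g x) ≤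
      ∫ x in Ω, ‖X x‖ ∂Dv.variation + C * ∫ x in Ω, |v x - u x| * ‖fderiv ℝ (η m) x‖ := by
    intro m
    refine le_of_tendsto_of_tendsto' (b := (atTop : Filter ℕ)) ?_ (Tendsto.add_const _ ?_) (hA m)
    · refine tendsto_integral_of_dominated_convergence (fun x => C * ‖g x‖) ?_
        (hg.norm.const_mul C) ?_ ?_
      · exact fun j => (hη m).continuous.aestronglyMeasurable.mul ((hYm _ j).inner hg.1)
      · refine fun j => hae _ _ fun x hx => ?_
        rw [norm_mul, Real.norm_eq_abs, abs_of_nonneg (hη01 m x).1]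
        refine (mul_le_of_le_one_left (norm_nonneg _) (hη01 m x).2).trans ?_
        exact (norm_inner_le_norm _ _).trans
          (mul_le_mul_of_nonneg_right (hYC j x hx) (norm_nonneg _))
      · exact hae _ _ fun x hx => ((hYX x hx).inner tendsto_const_nhds).const_mul _
    · refine tendsto_integral_of_dominated_convergence (fun x => C) ?_
        (integrable_const _) ?_ ?_
      · exact fun j => (hYm _ j).norm
      · refine fun j => hae _ _ fun x hx => ?_
        simpa using hYC j x hx
      · exact hae _ _ fun x hx => (hYX x hx).norm
  refine le_of_tendsto_of_tendsto' (b := (atTop : Filter ℕ)) ?_ ?_ hB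
  · refine tendsto_integral_of_dominated_convergence (fun x => C * ‖g x‖) ?_
      (hg.norm.const_mul C) ?_ ?_
    · exact fun j => (hη j).continuous.aestronglyMeasurable.mul ((hXm _).inner hg.1)
    · refine fun j => hae _ _ fun x hx => ?_
      rw [norm_mul, Real.norm_eq_abs, abs_of_nonneg (hη01 j x).1]
      refine (mul_le_of_le_one_left (norm_nonneg _) (hη01 j x).2).trans ?_
      exact (norm_inner_le_norm _ _).trans
        (mul_le_mul_of_nonneg_right (hXC x hx) (norm_nonneg _))
    · refine hae _ _ fun x hx => ?_
      simpa using (hη1 x hx).mul_const (inner ℝ (X x) (g x))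
  · simpa using (herr.const_mul C).const_add (∫ x in Ω, ‖X x‖ ∂Dv.variation)

end LeastGradient

/-! ### Radial cutoffs and boundary values -/

namespace LeastGradient

theorem deriv_smoothTransition_eq_zero {t : ℝ} (ht : t < 0 ∨ 1 < t) :
    deriv Real.smoothTransition t = 0 := by
  rcases ht with ht | ht
  · have : Real.smoothTransition =ᶠ[𝓝 t] fun _ => 0 := by
      filter_upwards [Iio_mem_nhds ht] with x hx
      exact Real.smoothTransition.zero_of_nonpos (le_of_lt hx)
    rw [this.deriv_eq, deriv_const]
  · have : Real.smoothTransition =ᶠ[𝓝 t] fun _ => 1 := by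
      filter_upwards [Ioi_mem_nhds ht] with x hx
      exact Real.smoothTransition.one_of_one_le (le_of_lt hx)
    rw [this.deriv_eq, deriv_const]

theorem exists_bound_deriv_smoothTransition :
    ∃ C : ℝ, 0 ≤ C ∧ ∀ t, |deriv Real.smoothTransition t| ≤ C := by
  have hc : Continuous (deriv Real.smoothTransition) :=
    (Real.smoothTransition.contDiff (n := 1)).continuous_deriv le_rfl
  obtain ⟨C, hC⟩ := (isCompact_Icc (a := (0 : ℝ)) (b := 1)).exists_bound_of_continuousOn
    hc.continuousOn
  refine ⟨C, (norm_nonneg _).trans (hC 0 (by simp)), fun t => ?_⟩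
  by_cases ht : t ∈ Icc (0 : ℝ) 1
  · exact hC t ht
  · rw [deriv_smoothTransition_eq_zero, abs_zero]
    · exact (norm_nonneg _).trans (hC 0 (by simp))
    · by_contra! h
      exact ht h

theorem hasDerivAt_smoothTransition (t : ℝ) :
    HasDerivAt Real.smoothTransition (deriv Real.smoothTransition t) t :=
  ((Real.smoothTransition.contDiff (n := 1)).differentiable (by simp) t).hasDerivAt

variable {n : ℕ}

/-- The radial cutoff that is supported in `‖x‖² ≤ R² - δ`. -/
noncomputable def radialCutoff (R δ : ℝ) (x : EuclideanSpace ℝ (Fin n)) : ℝ :=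
  Real.smoothTransition ((R ^ 2 - ‖x‖ ^ 2) / δ - 1)

theorem contDiff_radialCutoff (R δ : ℝ) :
    ContDiff ℝ ∞ (radialCutoff R δ : EuclideanSpace ℝ (Fin n) → ℝ) :=
  Real.smoothTransition.contDiff.comp
    (((contDiff_const.sub (contDiff_norm_sq ℝ)).div_const δ).sub contDiff_const)

theorem tsupport_radialCutoff_subset {R δ : ℝ} (hδ : 0 < δ) :
    tsupport (radialCutoff R δ : EuclideanSpace ℝ (Fin n) → ℝ) ⊆ {x | ‖x‖ ^ 2 ≤ R ^ 2 - δ} := by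
  refine closure_minimal (fun x hx => ?_) (isClosed_le (by fun_prop) continuous_const)
  by_contra h
  refine hx (Real.smoothTransition.zero_of_nonpos ?_)
  simp only [mem_ofPred_eq, not_le] at h
  rw [sub_nonpos, div_le_one hδ]
  linarith

theorem tsupport_radialCutoff_subset_ball {R δ : ℝ} (hR : 0 < R) (hδ : 0 < δ) :
    tsupport (radialCutoff R δ : EuclideanSpace ℝ (Fin n) → ℝ) ⊆ Metric.ball 0 R := by
  intro x hx
  have h : ‖x‖ ^ 2 ≤ R ^ 2 - δ := tsupport_radialCutoff_subset hδ hx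
  rw [mem_ball_zero_iff]
  exact lt_of_pow_lt_pow_left₀ 2 hR.le (by linarith)

theorem hasCompactSupport_radialCutoff {R δ : ℝ} (hR : 0 < R) (hδ : 0 < δ) :
    HasCompactSupport (radialCutoff R δ : EuclideanSpace ℝ (Fin n) → ℝ) :=
  (isCompact_closedBall 0 R).of_isClosed_subset (isClosed_tsupport _)
    ((tsupport_radialCutoff_subset_ball hR hδ).trans Metric.ball_subset_closedBall)

/-- The cutoff varies only where R² - ‖x‖² ≤ 2δ, and R² - ‖x‖² ≥ R(R - ‖x‖) places this in a shell
of thickness 2δ/R. Slope times thickness stays bounded as δ → 0, which is what the boundary term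
needs. -/
theorem norm_fderiv_radialCutoff_le {R δ C : ℝ} (hR : 0 < R) (hδ : 0 < δ)
    (hC : ∀ t, |deriv Real.smoothTransition t| ≤ C) {x : EuclideanSpace ℝ (Fin n)}
    (hx : x ∈ Metric.ball (0 : EuclideanSpace ℝ (Fin n)) R) :
    ‖fderiv ℝ (radialCutoff R δ) x‖ ≤
      indicator {x | R - 2 * δ / R ≤ ‖x‖} (fun _ => C * (2 * R / δ)) x := by
  rw [mem_ball_zero_iff] at hx
  have h1 : HasFDerivAt (fun x : EuclideanSpace ℝ (Fin n) => (R ^ 2 - ‖x‖ ^ 2) / δ - 1)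
      (-(2 / δ) • innerSL ℝ x) x := by
    have h := (((hasStrictFDerivAt_norm_sq x).hasFDerivAt.const_sub (R ^ 2)).mul_const
      (δ⁻¹)).sub_const 1
    convert! h using 1
    ext w
    simp
    ring
  have h2 := (hasDerivAt_smoothTransition ((R ^ 2 - ‖x‖ ^ 2) / δ - 1)).comp_hasFDerivAt x h1
  have h3 : fderiv ℝ (radialCutoff R δ) x = _ := h2.fderiv
  rw [h3, norm_smul, norm_smul, innerSL_apply_norm, norm_neg, Real.norm_eq_abs,
    Real.norm_of_nonneg (by positivity : 0 ≤ 2 / δ)]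
  by_cases hm : R - 2 * δ / R ≤ ‖x‖
  · rw [indicator_of_mem (by exact hm)]
    have : 2 / δ * ‖x‖ ≤ 2 * R / δ := by
      rw [div_mul_eq_mul_div]
      gcongr
    exact mul_le_mul (hC _) this (by positivity) ((abs_nonneg _).trans (hC 0))
  · rw [indicator_of_notMem (by exact hm), deriv_smoothTransition_eq_zero]
    · simp
    · right
      push Not at hm
      rw [lt_sub_iff_add_lt, lt_div_iff₀ hδ]
      have h5 : 2 * δ / R < R - ‖x‖ := by linarith
      rw [div_lt_iff₀ hR] at h5
      nlinarith [norm_nonneg x]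

/-- Bernoulli's inequality for (1 - t/R)^n. -/
theorem volume_shell_le {R t : ℝ} (hR : 0 < R) (ht0 : 0 < t) (ht : t < R) :
    volume.real (Metric.ball (0 : EuclideanSpace ℝ (Fin n)) R ∩ {x | R - t ≤ ‖x‖}) ≤
      n * (t / R) * volume.real (Metric.ball (0 : EuclideanSpace ℝ (Fin n)) R) := by
  have hset : Metric.ball (0 : EuclideanSpace ℝ (Fin n)) R ∩ {x | R - t ≤ ‖x‖} =
      Metric.ball 0 R \ Metric.ball 0 (R - t) := by
    ext x
    simp
  have hvol : ∀ r : ℝ, 0 < r → volume.real (Metric.ball (0 : EuclideanSpace ℝ (Fin n)) r) =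
      r ^ n * volume.real (Metric.ball (0 : EuclideanSpace ℝ (Fin n)) 1) := by
    intro r hr
    have := congrArg ENNReal.toReal
      (Measure.addHaar_ball_of_pos volume (0 : EuclideanSpace ℝ (Fin n)) hr)
    rw [ENNReal.toReal_mul, ENNReal.toReal_ofReal (by positivity), finrank_euclideanSpace_fin]
      at this
    exact this
  rw [hset, measureReal_sdiff (Metric.ball_subset_ball (by linarith)) measurableSet_ball,
    hvol R hR, hvol (R - t) (by linarith)]
  have hb := one_add_mul_le_pow (a := -(t / R)) (by
    have : t / R < 1 := (div_lt_one hR).2 ht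
    linarith) n
  have h2 : (R - t) ^ n = R ^ n * (1 + -(t / R)) ^ n := by
    rw [← mul_pow]
    congr 1
    field_simp
    ring
  rw [h2]
  have hV := measureReal_nonneg (μ := volume) (s := Metric.ball (0 : EuclideanSpace ℝ (Fin n)) 1)
  have h3 := mul_le_mul_of_nonneg_left hb
    (mul_nonneg (pow_nonneg hR.le n) hV)
  nlinarith

/-- If `w` has zero boundary values in the uniform sense, it does not see the gradient of the
radial cutoffs in the limit. -/
theorem tendsto_integral_radialCutoff {R : ℝ} (hR : 0 < R) {w : EuclideanSpace ℝ (Fin n) → ℝ}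
    (hw : ∀ ε > 0, ∃ δ > 0, ∀ᵐ x ∂volume.restrict (Metric.ball 0 R), R - δ ≤ ‖x‖ → |w x| ≤ ε) :
    Tendsto (fun δ : ℝ => ∫ x in Metric.ball 0 R, |w x| * ‖fderiv ℝ (radialCutoff R δ) x‖)
      (𝓝[>] 0) (𝓝 0) := by
  obtain ⟨C, hC0, hC⟩ := exists_bound_deriv_smoothTransition
  set V := volume.real (Metric.ball (0 : EuclideanSpace ℝ (Fin n)) R) with hV
  have hV0 : 0 ≤ V := measureReal_nonneg
  -- Slope C · 2R/δ times the shell volume bound n · (2δ/R²) · V; the δ cancels. Below, `K + 1`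
  -- replaces `K` in a denominator because `K` may vanish.
  set K := C * 4 * n * V / R with hK
  have hK0 : 0 ≤ K := by positivity
  rw [Metric.tendsto_nhdsWithin_nhds]
  intro ε hε
  obtain ⟨d, hd, hwd⟩ := hw (ε / (2 * (K + 1))) (by positivity)
  refine ⟨min (d * R / 2) (R ^ 2 / 2), by positivity, fun δ hδ hδ2 => ?_⟩
  have hδ0 : 0 < δ := hδ
  rw [dist_zero_right, Real.norm_eq_abs, abs_of_pos hδ0] at hδ2
  have hδd : 2 * δ / R ≤ d := by
    rw [div_le_iff₀ hR]
    linarith [min_le_left (d * R / 2) (R ^ 2 / 2)]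
  have hδR : 2 * δ / R < R := by
    rw [div_lt_iff₀ hR]
    nlinarith [min_le_right (d * R / 2) (R ^ 2 / 2)]
  have hnn : 0 ≤ ∫ x in Metric.ball 0 R, |w x| * ‖fderiv ℝ (radialCutoff R δ) x‖ :=
    integral_nonneg fun x => by positivity
  rw [dist_zero_right, Real.norm_eq_abs, abs_of_nonneg hnn]
  have hmeas : MeasurableSet {x : EuclideanSpace ℝ (Fin n) | R - 2 * δ / R ≤ ‖x‖} :=
    (isClosed_le continuous_const continuous_norm).measurableSet
  have h1 : ∫ x in Metric.ball 0 R, |w x| * ‖fderiv ℝ (radialCutoff R δ) x‖ ≤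
      ∫ x in Metric.ball (0 : EuclideanSpace ℝ (Fin n)) R,
        indicator {x | R - 2 * δ / R ≤ ‖x‖}
          (fun _ => (ε / (2 * (K + 1))) * (C * (2 * R / δ))) x := by
    refine integral_mono_of_nonneg (Eventually.of_forall fun x => by positivity) ?_ ?_
    · have : IsFiniteMeasure (volume.restrict (Metric.ball (0 : EuclideanSpace ℝ (Fin n)) R)) :=
        ⟨by simpa using! measure_ball_lt_top⟩
      exact (integrable_const _).indicator hmeas
    · filter_upwards [hwd, ae_restrict_mem measurableSet_ball] with x hx hxb
      have h2 := norm_fderiv_radialCutoff_le hR hδ0 hC hxb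
      by_cases hm : R - 2 * δ / R ≤ ‖x‖
      · rw [indicator_of_mem (by exact hm)] at h2 ⊢
        exact mul_le_mul (hx (by linarith)) h2 (norm_nonneg _) (by positivity)
      · rw [indicator_of_notMem (by exact hm)] at h2 ⊢
        rw [le_antisymm h2 (norm_nonneg _), mul_zero]
  rw [integral_indicator hmeas, Measure.restrict_restrict hmeas, setIntegral_const, inter_comm,
    smul_eq_mul] at h1
  have h3 := volume_shell_le (n := n) hR (by positivity) hδR
  have h4 : n * (2 * δ / R / R) * V * ((ε / (2 * (K + 1))) * (C * (2 * R / δ))) =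
      K / (K + 1) * (ε / 2) := by
    rw [hK]
    field_simp
    ring
  have h5 : K / (K + 1) < 1 := by rw [div_lt_one (by positivity)]; linarith
  calc _ ≤ _ := h1
    _ ≤ _ := mul_le_mul_of_nonneg_right h3 (by positivity)
    _ = _ := h4
    _ < ε := by nlinarith

theorem tendsto_radialCutoff {R : ℝ} (hR : 0 < R) {x : EuclideanSpace ℝ (Fin n)}
    (hx : x ∈ Metric.ball (0 : EuclideanSpace ℝ (Fin n)) R) :
    Tendsto (fun δ : ℝ => radialCutoff R δ x) (𝓝[>] 0) (𝓝 1) := by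
  rw [mem_ball_zero_iff] at hx
  have h : 0 < R ^ 2 - ‖x‖ ^ 2 := by nlinarith [norm_nonneg x]
  refine tendsto_const_nhds.congr' ?_
  filter_upwards [Ioo_mem_nhdsGT (show 0 < (R ^ 2 - ‖x‖ ^ 2) / 2 by linarith)] with δ hδ
  refine (Real.smoothTransition.one_of_one_le ?_).symm
  rw [le_sub_iff_add_le, le_div_iff₀ hδ.1]
  linarith [hδ.2]

/-- Two functions with the same boundary values are uniformly close near the sphere. -/
theorem exists_ae_abs_sub_le {R : ℝ} (hR : 0 < R) {Ω : Set (EuclideanSpace ℝ (Fin n))}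
    (hΩ : Ω = Metric.ball 0 R)
    {f : frontier Ω → ℝ}
    {u v : EuclideanSpace ℝ (Fin n) → ℝ}
    (hu : ∀ x : frontier Ω,
      Tendsto (fun r : ℝ => essSup (fun y => ENNReal.ofReal |f x - u y|)
        (volume.restrict (Ω ∩
          Metric.ball (x : EuclideanSpace ℝ (Fin n)) r))) (𝓝[>] 0) (𝓝 0))
    (hv : ∀ x : frontier Ω,
      Tendsto (fun r : ℝ => essSup (fun y => ENNReal.ofReal |f x - v y|)
        (volume.restrict (Ω ∩
          Metric.ball (x : EuclideanSpace ℝ (Fin n)) r))) (𝓝[>] 0) (𝓝 0))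
    {ε : ℝ} (hε : 0 < ε) :
    ∃ δ > 0, ∀ᵐ x ∂volume.restrict Ω, R - δ ≤ ‖x‖ → |v x - u x| ≤ ε := by
  have hΩm : MeasurableSet Ω := hΩ ▸ measurableSet_ball
  have hloc : ∀ w : EuclideanSpace ℝ (Fin n) → ℝ, ∀ x : frontier Ω,
      Tendsto (fun r : ℝ => essSup (fun y => ENNReal.ofReal |f x - w y|)
        (volume.restrict (Ω ∩ Metric.ball (x : EuclideanSpace ℝ (Fin n)) r))) (𝓝[>] 0) (𝓝 0) →
      ∀ᶠ r : ℝ in 𝓝[>] 0, ∀ᵐ y ∂volume.restrict Ω,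
        y ∈ Metric.ball (x : EuclideanSpace ℝ (Fin n)) r → |f x - w y| ≤ ε / 2 := by
    intro w x hw
    have h0 : (0 : ENNReal) < ENNReal.ofReal (ε / 2) := by simpa using hε
    filter_upwards [hw.eventually (gt_mem_nhds h0)] with r hr
    have h1 : ∀ᵐ y ∂volume.restrict (Ω ∩ Metric.ball (x : EuclideanSpace ℝ (Fin n)) r),
        ENNReal.ofReal |f x - w y| ≤ ENNReal.ofReal (ε / 2) := by
      filter_upwards [ae_le_essSup (f := fun y => ENNReal.ofReal |f x - w y|)
        (μ := volume.restrict (Ω ∩ Metric.ball (x : EuclideanSpace ℝ (Fin n)) r))] with y hy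
      exact hy.trans hr.le
    rw [inter_comm, ← Measure.restrict_restrict measurableSet_ball,
      ae_restrict_iff' measurableSet_ball] at h1
    filter_upwards [h1] with y hy hyb
    exact (ENNReal.ofReal_le_ofReal_iff (by positivity)).1 (hy hyb)
  have hloc2 : ∀ x : frontier Ω, ∃ r > 0, ∀ᵐ y ∂volume.restrict Ω,
      y ∈ Metric.ball (x : EuclideanSpace ℝ (Fin n)) r → |v y - u y| ≤ ε := by
    intro x
    obtain ⟨r, ⟨h1, h2⟩, h3⟩ := (((hloc u x (hu x)).and (hloc v x (hv x))).and
      (self_mem_nhdsWithin : Ioi (0 : ℝ) ∈ 𝓝[>] 0)).exists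
    refine ⟨r, h3, ?_⟩
    filter_upwards [h1, h2] with y hy1 hy2 hyb
    have h4 := abs_le.1 (hy1 hyb)
    have h5 := abs_le.1 (hy2 hyb)
    rw [abs_le]
    constructor <;> linarith [h4.1, h4.2, h5.1, h5.2]
  choose r hr0 hr using hloc2
  -- The boundary condition is pointwise on the sphere; compactness makes it uniform in a collar.
  have hcomp : IsCompact (frontier Ω) := by
    rw [hΩ, frontier_ball _ hR.ne']
    exact isCompact_sphere _ _
  obtain ⟨t, ht⟩ := hcomp.elim_finite_subcover
    (fun x : frontier Ω => Metric.ball (x : EuclideanSpace ℝ (Fin n)) (r x))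
    (fun _ => Metric.isOpen_ball) (fun x hx => mem_iUnion.2 ⟨⟨x, hx⟩, Metric.mem_ball_self (hr0 _)⟩)
  have hopen : IsOpen (⋃ x ∈ t, Metric.ball ((x : frontier Ω) : EuclideanSpace ℝ (Fin n)) (r x)) :=
    isOpen_biUnion fun _ _ => Metric.isOpen_ball
  obtain ⟨d, hd, hdU⟩ := hcomp.exists_thickening_subset_open hopen ht
  -- The bound R/2 keeps `y` away from the centre, so that it can be projected radially to the
  -- sphere.
  refine ⟨min (d / 2) (R / 2), by positivity, ?_⟩
  have hall : ∀ᵐ y ∂volume.restrict Ω, ∀ x ∈ t,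
      y ∈ Metric.ball ((x : frontier Ω) : EuclideanSpace ℝ (Fin n)) (r x) → |v y - u y| ≤ ε :=
    (ae_ball_iff t.countable_toSet).2 fun x _ => hr x
  filter_upwards [hall, ae_restrict_mem hΩm] with y hy hyΩ hyR
  rw [hΩ, mem_ball_zero_iff] at hyΩ
  have hy0 : 0 < ‖y‖ := by linarith [min_le_right (d / 2) (R / 2)]
  have hmem : y ∈ Metric.thickening d (frontier Ω) := by
    rw [Metric.mem_thickening_iff]
    refine ⟨(R / ‖y‖) • y, ?_, ?_⟩
    · rw [hΩ, frontier_ball _ hR.ne', mem_sphere_zero_iff_norm, norm_smul, Real.norm_eq_abs,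
        abs_of_pos (by positivity)]
      field_simp
    · have : y - (R / ‖y‖) • y = (1 - R / ‖y‖) • y := by rw [sub_smul, one_smul]
      have h6 : (1 - R / ‖y‖) * ‖y‖ = -(R - ‖y‖) := by
        field_simp
        ring
      rw [dist_eq_norm, this, norm_smul, Real.norm_eq_abs, ← abs_of_pos hy0, ← abs_mul,
        abs_of_pos hy0, h6, abs_neg, abs_of_pos (by linarith)]
      linarith [min_le_left (d / 2) (R / 2)]
  obtain ⟨x, hxt, hxy⟩ := mem_iUnion₂.1 (hdU hmem)
  exact hy x hxt hxy

end LeastGradient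

/-! ### Calibrated functions minimize; removable singularities -/

namespace LeastGradient

variable {n : ℕ}

theorem IsGradientMeasure.congr {Ω : Set (EuclideanSpace ℝ (Fin n))}
    {u v : EuclideanSpace ℝ (Fin n) → ℝ}
    {D : VectorMeasure (EuclideanSpace ℝ (Fin n)) (EuclideanSpace ℝ (Fin n))}
    (h : IsGradientMeasure Ω u D) (huv : u =ᵐ[volume.restrict Ω] v) : IsGradientMeasure Ω v D where
  variation_lt_top := h.variation_lt_top
  variation_compl := h.variation_compl
  integral_gradient φ h1 h2 h3 := by
    rw [← h.integral_gradient φ h1 h2 h3]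
    refine integral_congr_ae ?_
    filter_upwards [huv] with x hx
    rw [hx]

/-- A function that is calibrated by a limit of divergence free fields is a minimizer. -/
theorem mem_minimizers_of_calibration {R : ℝ} (hR : 0 < R) {Ω : Set (EuclideanSpace ℝ (Fin n))}
    (hΩ : Ω = Metric.ball 0 R) {f : C(frontier Ω, ℝ)} {a : EuclideanSpace ℝ (Fin n) → ℝ}
    {u : Lp ℝ 1 (volume.restrict Ω)} (huf : u ∈ BVf Ω f)
    {g : EuclideanSpace ℝ (Fin n) → EuclideanSpace ℝ (Fin n)} (hg : IntegrableOn g Ω)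
    (hDu : IsGradientMeasure Ω u ((volume.restrict Ω).withDensityᵥ g))
    {X : EuclideanSpace ℝ (Fin n) → EuclideanSpace ℝ (Fin n)}
    (hX : ∀ x ∈ Ω, a x = ‖X x‖)
    (hXg : ∀ᵐ x ∂volume.restrict Ω, inner ℝ (X x) (g x) = ‖X x‖ * ‖g x‖)
    {Y : ℕ → EuclideanSpace ℝ (Fin n) → EuclideanSpace ℝ (Fin n)}
    (hY : ∀ j, ContDiffOn ℝ ∞ (Y j) Ω) (hdiv : ∀ j, ∀ x ∈ Ω, divergence (Y j) x = 0)
    {C : ℝ} (hYC : ∀ j, ∀ x ∈ Ω, ‖Y j x‖ ≤ C)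
    (hYX : ∀ x ∈ Ω, Tendsto (fun j => Y j x) atTop (𝓝 (X x))) :
    u ∈ minimizers Ω a f := by
  have hΩo : IsOpen Ω := hΩ ▸ Metric.isOpen_ball
  have hΩm : MeasurableSet Ω := hΩo.measurableSet
  have hYm : ∀ (μ : Measure (EuclideanSpace ℝ (Fin n))) j,
      AEStronglyMeasurable (Y j) (μ.restrict Ω) := fun μ j =>
    (hY j).continuousOn.aestronglyMeasurable hΩm
  have hXm : ∀ (μ : Measure (EuclideanSpace ℝ (Fin n))),
      AEStronglyMeasurable X (μ.restrict Ω) := fun μ =>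
    aestronglyMeasurable_of_tendsto_ae atTop (hYm μ)
      ((ae_restrict_iff' hΩm).2 (Eventually.of_forall hYX))
  have hXC : ∀ x ∈ Ω, ‖X x‖ ≤ C := fun x hx =>
    le_of_tendsto (hYX x hx).norm (Eventually.of_forall fun j => hYC j x hx)
  refine ⟨huf, fun v hv => ?_⟩
  -- For the calibrated function the Cauchy–Schwarz inequality is an equality, so its energy is the
  -- flux integral, which the calibration inequality bounds by the energy of any `v`.
  have h1 : weightedTV Ω a u ≤ ENNReal.ofReal (∫ x in Ω, inner ℝ (X x) (g x)) := by
    refine (iInf₂_le _ hDu).trans ?_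
    rw [Measure.variation_withDensityᵥ hg, integral_congr_ae hXg,
      ofReal_integral_eq_lintegral_ofReal]
    · rw [setLIntegral_congr_fun hΩm (g := fun x => ‖X x‖ₑ)
        (fun x hx => by simp only [hX x hx, ofReal_norm]), restrict_withDensity hΩm,
        Measure.restrict_restrict hΩm, inter_self,
        lintegral_withDensity_eq_lintegral_mul₀ hg.1.enorm (hXm _).enorm]
      refine lintegral_mono fun x => ?_
      rw [Pi.mul_apply, ENNReal.ofReal_mul (norm_nonneg _), ofReal_norm,
        ofReal_norm, mul_comm]
    · refine Integrable.bdd_mul hg.norm (hXm _).norm (c := C) ?_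
      exact (ae_restrict_iff' hΩm).2 (Eventually.of_forall fun x hx => by simpa using hXC x hx)
    · exact Eventually.of_forall fun x => by positivity
  refine h1.trans (le_iInf₂ fun D hD => ?_)
  have : IsFiniteMeasure D.variation := ⟨hD.variation_lt_top⟩
  have hev : ∀ m : ℕ, 0 < 1 / ((m : ℝ) + 1) := fun m => Nat.one_div_pos_of_nat
  have hlim : Tendsto (fun m : ℕ => 1 / ((m : ℝ) + 1)) atTop (𝓝[>] 0) :=
    tendsto_nhdsWithin_iff.2 ⟨tendsto_one_div_add_atTop_nhds_zero_nat, Eventually.of_forall hev⟩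
  have h2 : ∫ x in Ω, inner ℝ (X x) (g x) ≤ ∫ x in Ω, ‖X x‖ ∂D.variation := by
    refine integral_inner_le_of_tendsto hΩo hg hDu hD (L1.integrable_coeFn u)
      (L1.integrable_coeFn v) hY hdiv hYC hYX
      (η := fun m => radialCutoff R (1 / ((m : ℝ) + 1))) (fun m => contDiff_radialCutoff _ _)
      (fun m => hasCompactSupport_radialCutoff hR (hev m)) (fun m => ?_) (fun m x => ?_)
      (fun x hx => ?_) ?_
    · rw [hΩ]
      exact tsupport_radialCutoff_subset_ball hR (hev m)
    · exact ⟨Real.smoothTransition.nonneg _, Real.smoothTransition.le_one _⟩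
    · rw [hΩ] at hx
      exact (tendsto_radialCutoff hR hx).comp hlim
    · have h3 := tendsto_integral_radialCutoff hR (w := fun x => v x - u x) (fun ε hε => by
        rw [← hΩ]
        exact exists_ae_abs_sub_le hR hΩ huf.2 hv.2 hε)
      rw [← hΩ] at h3
      exact h3.comp hlim
  refine (ENNReal.ofReal_le_ofReal h2).trans ?_
  rw [ofReal_integral_eq_lintegral_ofReal]
  · exact (setLIntegral_congr_fun hΩm fun x hx => by rw [hX x hx]).le
  · exact Integrable.of_bound (hXm _).norm C
      ((ae_restrict_iff' hΩm).2 (Eventually.of_forall fun x hx => by simpa using hXC x hx))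
  · exact Eventually.of_forall fun x => norm_nonneg _

/-- A bounded function that is differentiable off a removable closed set, with integrable gradient,
has this gradient as its distributional gradient. -/
theorem isGradientMeasure_of_hasFDerivAt {Ω S : Set (EuclideanSpace ℝ (Fin n))} (hΩ : IsOpen Ω)
    {u : EuclideanSpace ℝ (Fin n) → ℝ} {g : EuclideanSpace ℝ (Fin n) → EuclideanSpace ℝ (Fin n)}
    (hu : IntegrableOn u Ω) (hg : IntegrableOn g Ω) {K : ℝ} (huK : ∀ x, |u x| ≤ K)
    (hug : ∀ x ∈ Ω \ S, HasFDerivAt u (innerSL ℝ (g x)) x)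
    {κ : ℕ → EuclideanSpace ℝ (Fin n) → ℝ} (hκ : ∀ m, ContDiff ℝ ∞ (κ m))
    (hκS : ∀ m, Disjoint (tsupport (κ m)) S) (hκ1 : ∀ m x, |κ m x| ≤ 1)
    (hκlim : ∀ᵐ x ∂volume.restrict Ω, ∀ᶠ m in atTop, κ m =ᶠ[𝓝 x] fun _ => 1)
    {H : EuclideanSpace ℝ (Fin n) → ℝ} (hH : IntegrableOn H Ω)
    (hκH : ∀ m, ∀ᵐ x ∂volume.restrict Ω, ‖fderiv ℝ (κ m) x‖ ≤ H x) :
    IsGradientMeasure Ω u ((volume.restrict Ω).withDensityᵥ g) where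
  variation_lt_top := by
    rw [Measure.variation_withDensityᵥ hg, withDensity_apply _ MeasurableSet.univ,
      Measure.restrict_univ]
    exact hg.2
  variation_compl := by
    rw [Measure.variation_withDensityᵥ hg]
    exact withDensity_absolutelyContinuous _ _ (by
      rw [Measure.restrict_apply hΩ.measurableSet.compl, compl_inter_self, measure_empty])
  integral_gradient φ hφ hφc hφs := by
    obtain ⟨C, hC⟩ := hφc.exists_bound_of_continuous hφ.continuous
    have hdφ : Continuous (fderiv ℝ φ) := hφ.continuous_fderiv (by simp)
    obtain ⟨C', hC'⟩ := (hφc.fderiv ℝ).exists_bound_of_continuous hdφ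
    rw [integral_withDensityᵥ hg hφ.continuous.aestronglyMeasurable C hC]
    have hgradc : Continuous (gradient φ) :=
      (InnerProductSpace.toDual ℝ (EuclideanSpace ℝ (Fin n))).symm.continuous.comp hdφ
    have hgradb : ∀ x, ‖gradient φ x‖ ≤ C' := fun x => by
      rw [gradient, LinearIsometryEquiv.norm_map]
      exact hC' x
    have hint1 : IntegrableOn (fun x => u x • gradient φ x) Ω :=
      Integrable.smul_of_top_left hu (memLp_top_of_bound hgradc.aestronglyMeasurable C'
        (Eventually.of_forall hgradb))
    have hint2 : IntegrableOn (fun x => φ x • g x) Ω :=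
      Integrable.smul_of_top_right hg (memLp_top_of_bound hφ.continuous.aestronglyMeasurable C
        (Eventually.of_forall hC))
    ext i
    set e : EuclideanSpace ℝ (Fin n) := EuclideanSpace.single i 1 with he
    have hl : (∫ x in Ω, u x • gradient φ x) i = ∫ x in Ω, u x * fderiv ℝ φ x e := by
      refine ((EuclideanSpace.proj i :
        EuclideanSpace ℝ (Fin n) →L[ℝ] ℝ).integral_comp_comm hint1).symm.trans ?_
      refine integral_congr_ae (Eventually.of_forall fun x => ?_)
      simp [gradient_apply_coord, he]
    have hr : (∫ x in Ω, φ x • g x) i = ∫ x in Ω, φ x * g x i :=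
      ((EuclideanSpace.proj i :
        EuclideanSpace ℝ (Fin n) →L[ℝ] ℝ).integral_comp_comm hint2).symm
    rw [PiLp.neg_apply, hl, hr]
    have he1 : ‖e‖ = 1 := by simp [he]
    have hdφe : Continuous fun x => fderiv ℝ φ x e := hdφ.clm_apply continuous_const
    have hdφeb : ∀ x, ‖fderiv ℝ φ x e‖ ≤ C' := fun x =>
      ((fderiv ℝ φ x).le_opNorm e).trans (by rw [he1, mul_one]; exact hC' x)
    have hdκe : ∀ m, Continuous fun x => fderiv ℝ (κ m) x e := fun m =>
      ((hκ m).continuous_fderiv (by simp)).clm_apply continuous_const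
    have hgi : IntegrableOn (fun x => g x i) Ω :=
      (EuclideanSpace.proj i : EuclideanSpace ℝ (Fin n) →L[ℝ] ℝ).integrable_comp hg
    have hzero : ∀ x, x ∉ Ω → φ x = 0 ∧ fderiv ℝ φ x e = 0 := fun x hx =>
      ⟨image_eq_zero_of_notMem_tsupport fun h => hx (hφs h), by
        rw [image_eq_zero_of_notMem_tsupport (f := fderiv ℝ φ)
          fun h => hx (hφs (tsupport_fderiv_subset ℝ h))]; rfl⟩
    have hHm : ∀ m, ∀ᵐ x ∂volume.restrict Ω, ‖u x * (φ x * fderiv ℝ (κ m) x e)‖ ≤ K * (C * H x) := by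
      intro m
      filter_upwards [hκH m] with x hx
      rw [norm_mul, norm_mul]
      have hK : 0 ≤ K := (abs_nonneg _).trans (huK x)
      have hC0 : 0 ≤ C := (norm_nonneg _).trans (hC x)
      refine mul_le_mul (huK x) (mul_le_mul (hC x) ?_ (norm_nonneg _) hC0) (by positivity) hK
      exact ((fderiv ℝ (κ m) x).le_opNorm e).trans (by rw [he1, mul_one]; exact hx)
    have hu1 : ∀ m, IntegrableOn (fun x => u x * (κ m x * fderiv ℝ φ x e)) Ω := fun m =>
      Integrable.mul_bdd hu ((hκ m).continuous.mul hdφe).aestronglyMeasurable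
        (c := 1 * C') (Eventually.of_forall fun x => by
          rw [norm_mul]
          exact mul_le_mul (hκ1 m x) (hdφeb x) (norm_nonneg _) zero_le_one)
    have hu2 : ∀ m, IntegrableOn (fun x => u x * (φ x * fderiv ℝ (κ m) x e)) Ω := fun m =>
      Integrable.mono' ((hH.const_mul C).const_mul K) (hu.1.mul
        (hφ.continuous.mul (hdκe m)).aestronglyMeasurable) (hHm m)
    have hg1 : ∀ m, IntegrableOn (fun x => g x i * (κ m x * φ x)) Ω := fun m =>
      Integrable.mul_bdd hgi ((hκ m).continuous.mul hφ.continuous).aestronglyMeasurable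
        (c := 1 * C) (Eventually.of_forall fun x => by
          rw [norm_mul]
          exact mul_le_mul (hκ1 m x) (hC x) (norm_nonneg _) zero_le_one)
    -- Integration by parts against `κ m * φ`, whose support avoids `S`, where `u` need not be
    -- differentiable.
    have hparts : ∀ m, (∫ x in Ω, u x * (κ m x * fderiv ℝ φ x e)) +
        (∫ x in Ω, u x * (φ x * fderiv ℝ (κ m) x e)) = -∫ x in Ω, g x i * (κ m x * φ x) := by
      intro m
      have hψ : ContDiff ℝ ∞ fun x => κ m x * φ x := (hκ m).mul hφ
      have hdψ : ∀ x, fderiv ℝ (fun x => κ m x * φ x) x e =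
          κ m x * fderiv ℝ φ x e + φ x * fderiv ℝ (κ m) x e := by
        intro x
        have h := (((hκ m).differentiable (by simp) x).hasFDerivAt.mul
          (hφ.differentiable (by simp) x).hasFDerivAt).fderiv
        have h' : fderiv ℝ (fun x => κ m x * φ x) x = _ := h
        rw [h']
        simp
      have hψs : ∀ x ∈ tsupport (fun x => κ m x * φ x), x ∈ Ω \ S := fun x hx =>
        ⟨hφs (tsupport_mul_subset_right hx),
          Set.disjoint_left.1 (hκS m) (tsupport_mul_subset_left hx)⟩
      have hdu : ∀ x, fderiv ℝ u x e * (κ m x * φ x) = g x i * (κ m x * φ x) := by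
        intro x
        by_cases hx : x ∈ tsupport (fun x => κ m x * φ x)
        · rw [(hug x (hψs x hx)).fderiv]
          simp [he, EuclideanSpace.inner_single_right]
        · have h0 : κ m x * φ x = 0 := image_eq_zero_of_notMem_tsupport
            (f := fun x => κ m x * φ x) hx
          rw [h0, mul_zero, mul_zero]
      have hfull : ∀ F : EuclideanSpace ℝ (Fin n) → ℝ, (∀ x, x ∉ Ω → F x = 0) →
          IntegrableOn F Ω → Integrable F := fun F hF hFi =>
        (integrableOn_iff_integrable_of_support_subset (fun x hx => by
          by_contra h; exact hx (hF x h))).1 hFi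
      have hibp := integral_mul_fderiv_eq_neg_fderiv_mul_of_integrable
        (μ := (volume : Measure (EuclideanSpace ℝ (Fin n)))) (f := u)
        (g := fun x => κ m x * φ x) (v := e) ?_ ?_ ?_
        (fun x hx => (hug x (hψs x hx)).differentiableAt)
        (fun x _ => hψ.differentiable (by simp) x)
      · simp only [hdu, hdψ, mul_add] at hibp
        have h1 := setIntegral_eq_integral_of_forall_compl_eq_zero (s := Ω) (μ := volume)
          (f := fun x => g x i * (κ m x * φ x)) fun x hx => by rw [(hzero x hx).1, mul_zero, mul_zero]
        have h2 := setIntegral_eq_integral_of_forall_compl_eq_zero (s := Ω) (μ := volume)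
          (f := fun x => u x * (κ m x * fderiv ℝ φ x e) + u x * (φ x * fderiv ℝ (κ m) x e))
          fun x hx => by
            rw [(hzero x hx).1, (hzero x hx).2]
            ring
        rw [← integral_add (hu1 m) (hu2 m), h1, h2, hibp]
      · simp only [hdu]
        refine hfull _ (fun x hx => ?_) (hg1 m)
        rw [(hzero x hx).1, mul_zero, mul_zero]
      · simp only [hdψ, mul_add]
        refine hfull _ (fun x hx => ?_) ((hu1 m).add (hu2 m))
        rw [(hzero x hx).1, (hzero x hx).2]
        ring
      · refine hfull _ (fun x hx => ?_) ?_
        · rw [(hzero x hx).1, mul_zero, mul_zero]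
        · exact Integrable.mul_bdd hu ((hκ m).continuous.mul hφ.continuous).aestronglyMeasurable
            (c := 1 * C) (Eventually.of_forall fun x => by
              rw [norm_mul]
              exact mul_le_mul (hκ1 m x) (hC x) (norm_nonneg _) zero_le_one)
    have hlim1 : Tendsto (fun m => ∫ x in Ω, u x * (κ m x * fderiv ℝ φ x e)) atTop
        (𝓝 (∫ x in Ω, u x * fderiv ℝ φ x e)) := by
      refine tendsto_integral_of_dominated_convergence (fun x => ‖u x‖ * C')
        (fun m => (hu1 m).1) (hu.norm.mul_const C') (fun m => ?_) ?_
      · refine Eventually.of_forall fun x => ?_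
        rw [norm_mul, norm_mul]
        refine mul_le_mul_of_nonneg_left ?_ (norm_nonneg _)
        exact (mul_le_of_le_one_left (norm_nonneg _) (hκ1 m x)).trans (hdφeb x)
      · filter_upwards [hκlim] with x hx
        refine tendsto_const_nhds.congr' ?_
        filter_upwards [hx] with m hm
        rw [hm.self_of_nhds, one_mul]
    -- The extra term disappears by dominated convergence: almost every point has a neighbourhood on
    -- which `κ m` is eventually 1, and `H` is a majorant independent of `m`.
    have hlim2 : Tendsto (fun m => ∫ x in Ω, u x * (φ x * fderiv ℝ (κ m) x e)) atTop
        (𝓝 (∫ x in Ω, (0 : ℝ))) := by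
      refine tendsto_integral_of_dominated_convergence (fun x => K * (C * H x))
        (fun m => (hu2 m).1) ((hH.const_mul C).const_mul K) hHm ?_
      filter_upwards [hκlim] with x hx
      refine tendsto_const_nhds.congr' ?_
      filter_upwards [hx] with m hm
      rw [hm.fderiv_eq]
      simp
    have hlim3 : Tendsto (fun m => ∫ x in Ω, g x i * (κ m x * φ x)) atTop
        (𝓝 (∫ x in Ω, φ x * g x i)) := by
      refine tendsto_integral_of_dominated_convergence (fun x => ‖g x i‖ * C)
        (fun m => (hg1 m).1) (hgi.norm.mul_const C) (fun m => ?_) ?_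
      · refine Eventually.of_forall fun x => ?_
        rw [norm_mul, norm_mul]
        refine mul_le_mul_of_nonneg_left ?_ (norm_nonneg _)
        exact (mul_le_of_le_one_left (norm_nonneg _) (hκ1 m x)).trans (hC x)
      · filter_upwards [hκlim] with x hx
        refine tendsto_const_nhds.congr' ?_
        filter_upwards [hx] with m hm
        rw [hm.self_of_nhds, one_mul, mul_comm]
    rw [integral_zero] at hlim2
    have h1 := hlim1.add hlim2
    rw [add_zero] at h1
    refine tendsto_nhds_unique (h1.congr hparts) hlim3.neg

end LeastGradient

/-! ### Integrability of the singular majorants -/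

namespace LeastGradient

theorem integrableOn_abs_rpow {p : ℝ} (hp : p < 1) (c R : ℝ) :
    IntegrableOn (fun t : ℝ => |t - c| ^ (-p)) (Icc (-R) R) := by
  have h0 : ∀ L : ℝ, 0 ≤ L → IntegrableOn (fun t : ℝ => |t| ^ (-p)) (Icc (-L) L) := by
    intro L hL
    have h1 : IntegrableOn (fun t : ℝ => t ^ (-p)) (Icc 0 L) := by
      have := intervalIntegral.intervalIntegrable_rpow' (a := 0) (b := L) (r := -p) (by linarith)
      rwa [intervalIntegrable_iff_integrableOn_Icc_of_le hL] at this
    have h2 : Integrable (fun t : ℝ => (Icc (0 : ℝ) L).indicator (fun t => t ^ (-p)) ‖t‖) := by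
      rw [integrable_fun_norm_addHaar]
      simp only [Module.finrank_self, tsub_self, pow_zero, one_smul]
      exact ((integrable_indicator_iff measurableSet_Icc).2 h1).integrableOn
    have h3 : (fun t : ℝ => (Icc (0 : ℝ) L).indicator (fun t => t ^ (-p)) ‖t‖) =
        (Icc (-L) L).indicator fun t => |t| ^ (-p) := by
      ext t
      by_cases ht : t ∈ Icc (-L) L
      · rw [indicator_of_mem ht, indicator_of_mem (show ‖t‖ ∈ Icc 0 L from ⟨norm_nonneg t, abs_le.2 ht⟩), Real.norm_eq_abs]
      · rw [indicator_of_notMem ht, indicator_of_notMem fun h => ht (abs_le.1 h.2)]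
    rw [h3] at h2
    exact (integrable_indicator_iff measurableSet_Icc).1 h2
  have h1 := h0 (|R| + |c|) (by positivity)
  have h2 : IntegrableOn (fun t : ℝ => |t - c| ^ (-p)) ((fun t => t - c) ⁻¹' Icc (-(|R| + |c|)) (|R| + |c|)) :=
    ((measurePreserving_sub_right volume c).integrableOn_comp_preimage
      (measurableEmbedding_subRight c)).2 h1
  refine h2.mono_set fun t ht => ?_
  have := abs_le.2 ht
  refine abs_le.1 ((abs_sub _ _).trans ?_)
  have h3 := le_abs_self R
  linarith

/-- The splitting of the first coordinate. -/
noncomputable def splitFirst (N : ℕ) (x : EuclideanSpace ℝ (Fin (N + 1))) :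
    ℝ × EuclideanSpace ℝ (Fin N) :=
  (x 0, WithLp.toLp 2 fun i => x i.succ)

theorem measurePreserving_splitFirst (N : ℕ) : MeasurePreserving (splitFirst N) := by
  have h1 := PiLp.volume_preserving_ofLp (Fin (N + 1))
  have h2 := volume_preserving_piFinSuccAbove (fun _ : Fin (N + 1) => ℝ) 0
  have h3 : MeasurePreserving (Prod.map (id : ℝ → ℝ) (WithLp.toLp 2 : (Fin N → ℝ) → _)) :=
    (MeasurePreserving.id volume).prod (PiLp.volume_preserving_toLp (Fin N))
  exact h3.comp (h2.comp h1)

theorem norm_sq_eq_splitFirst {N : ℕ} (x : EuclideanSpace ℝ (Fin (N + 1))) :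
    ‖x‖ ^ 2 = (x 0) ^ 2 + ‖(splitFirst N x).2‖ ^ 2 := by
  rw [EuclideanSpace.norm_sq_eq, EuclideanSpace.norm_sq_eq, Fin.sum_univ_succ]
  simp [splitFirst]

/-- Products of negative powers of the first coordinate and of the distance to the unit cylinder are
integrable on balls. -/
theorem integrableOn_singular {N : ℕ} (hN : 1 ≤ N) {p q : ℝ} (hp : p < 1) (hq0 : 0 ≤ q)
    (hq : q < 1) (R : ℝ) :
    IntegrableOn (fun x : EuclideanSpace ℝ (Fin (N + 1)) =>
      |x 0| ^ (-p) * |‖x‖ ^ 2 - (x 0) ^ 2 - 1| ^ (-q)) (Metric.ball 0 R) := by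
  have hR : 0 ≤ |R| := abs_nonneg R
  have h1 : Integrable ((Icc (-|R|) |R|).indicator fun t : ℝ => |t| ^ (-p)) := by
    have := integrableOn_abs_rpow hp 0 |R|
    simp only [sub_zero] at this
    exact (integrable_indicator_iff measurableSet_Icc).2 this
  have h2 : Integrable fun z : EuclideanSpace ℝ (Fin N) =>
      (Icc (0 : ℝ) |R|).indicator (fun t => |t ^ 2 - 1| ^ (-q)) ‖z‖ := by
    have : Nonempty (Fin N) := ⟨⟨0, hN⟩⟩
    -- Polar coordinates in the transverse variables; the Jacobian t^(N-1) is bounded by |R|^(N-1)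
    -- on the relevant interval.
    rw [integrable_fun_norm_addHaar]
    have h3 := ((integrableOn_abs_rpow hq 1 |R|).const_mul (|R| ^ (N - 1)))
    have h4 : Integrable ((Icc (-|R|) |R|).indicator fun t : ℝ => |R| ^ (N - 1) * |t - 1| ^ (-q)) :=
      (integrable_indicator_iff measurableSet_Icc).2 h3
    refine Integrable.mono' h4.integrableOn ?_ ?_
    · refine Measurable.aestronglyMeasurable ?_
      refine (measurable_id.pow_const _).smul (Measurable.indicator ?_ measurableSet_Icc)
      fun_prop
    · filter_upwards [ae_restrict_mem measurableSet_Ioi] with t ht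
      have ht : 0 < t := ht
      by_cases htR : t ≤ |R|
      · rw [indicator_of_mem (show t ∈ Icc (0 : ℝ) |R| from ⟨ht.le, htR⟩),
          indicator_of_mem (show t ∈ Icc (-|R|) |R| from ⟨by linarith, htR⟩), norm_smul,
          Real.norm_of_nonneg (by positivity), Real.norm_of_nonneg (by positivity),
          finrank_euclideanSpace_fin]
        -- Since t + 1 ≥ 1, the distance to the cylinder in s is at least |t - 1|; at t = 1 both
        -- sides are the same junk or unit value.
        have h5 : |t ^ 2 - 1| ^ (-q) ≤ |t - 1| ^ (-q) := by
          by_cases h1 : t = 1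
          · simp [h1]
          · refine Real.rpow_le_rpow_of_nonpos (abs_pos.2 (sub_ne_zero.2 h1)) ?_ (by linarith)
            rw [show t ^ 2 - 1 = (t - 1) * (t + 1) by ring, abs_mul]
            refine le_mul_of_one_le_right (abs_nonneg _) ?_
            rw [abs_of_pos (by linarith)]
            linarith
        gcongr
      · rw [indicator_of_notMem fun h => htR h.2, smul_zero, norm_zero]
        exact indicator_nonneg (fun t _ => by positivity) _
  have h3 := (measurePreserving_splitFirst N).integrable_comp_of_integrable (h1.mul_prod h2)
  refine h3.integrableOn.congr_fun (fun x hx => ?_) measurableSet_ball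
  rw [mem_ball_zero_iff] at hx
  have hxR : ‖x‖ ≤ |R| := hx.le.trans (le_abs_self R)
  have hx0 : |x 0| ≤ |R| := (PiLp.norm_apply_le x 0).trans hxR
  have hsq := norm_sq_eq_splitFirst x
  have hz : ‖(splitFirst N x).2‖ ≤ |R| := by
    refine le_trans ?_ hxR
    refine le_of_sq_le_sq ?_ (norm_nonneg _)
    rw [hsq]
    exact le_add_of_nonneg_left (sq_nonneg _)
  simp only [Function.comp]
  rw [indicator_of_mem (show (splitFirst N x).1 ∈ Icc (-|R|) |R| from abs_le.1 hx0),
    indicator_of_mem (show ‖(splitFirst N x).2‖ ∈ Icc 0 |R| from ⟨norm_nonneg _, hz⟩), hsq]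
  have : (splitFirst N x).1 = x 0 := rfl
  rw [this, add_sub_cancel_left]

end LeastGradient

/-! ### Calculus of functions with Hölder continuous derivative -/

namespace LeastGradient

section HolderC1

variable {V W G : Type*} [NormedAddCommGroup V] [NormedSpace ℝ V] [NormedAddCommGroup W]
  [NormedSpace ℝ W] [NormedAddCommGroup G] [NormedSpace ℝ G]

/-- `f` is bounded in `U`, and so is its derivative, which moreover is Hölder continuous with
exponent `α` in `U`. -/
def HolderC1 (α : ℝ) (U : Set V) (f : V → W) : Prop :=
  ∃ (C : ℝ) (f' : V → V →L[ℝ] W), 0 ≤ C ∧ ∀ x ∈ U, HasFDerivAt f (f' x) x ∧ ‖f x‖ ≤ C ∧ ‖f' x‖ ≤ C ∧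
    ∀ y ∈ U, ‖f' x - f' y‖ ≤ C * ‖x - y‖ ^ α

theorem HolderC1.mono {α : ℝ} {U U' : Set V} {f : V → W} (h : HolderC1 α U f) (hU : U' ⊆ U) :
    HolderC1 α U' f := by
  obtain ⟨C, f', hC, h⟩ := h
  exact ⟨C, f', hC, fun x hx => ⟨(h x (hU hx)).1, (h x (hU hx)).2.1, (h x (hU hx)).2.2.1,
    fun y hy => (h x (hU hx)).2.2.2 y (hU hy)⟩⟩

theorem HolderC1.prodMk {α : ℝ} {U : Set V} {f : V → W} {g : V → G} (hf : HolderC1 α U f)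
    (hg : HolderC1 α U g) : HolderC1 α U fun x => (f x, g x) := by
  obtain ⟨C, f', hC, hf⟩ := hf
  obtain ⟨K, g', hK, hg⟩ := hg
  refine ⟨max C K, fun x => (f' x).prod (g' x), le_max_of_le_left hC, fun x hx => ?_⟩
  obtain ⟨h1, h2, h3, h4⟩ := hf x hx
  obtain ⟨k1, k2, k3, k4⟩ := hg x hx
  refine ⟨h1.prodMk k1, max_le_max h2 k2, ?_, fun y hy => ?_⟩
  · rw [ContinuousLinearMap.opNorm_prod]
    exact max_le_max h3 k3
  · have : (f' x).prod (g' x) - (f' y).prod (g' y) = (f' x - f' y).prod (g' x - g' y) := by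
      ext w <;> simp
    rw [this, ContinuousLinearMap.opNorm_prod]
    refine max_le ((h4 y hy).trans ?_) ((k4 y hy).trans ?_)
    · gcongr
      exact le_max_left _ _
    · gcongr
      exact le_max_right _ _

/-- Convexity of `U` makes `f` Lipschitz with its derivative bound, so the outer derivative stays
α-Hölder after composition; the rest is the product rule for differences. -/
theorem HolderC1.comp {α : ℝ} (hα : 0 ≤ α) {U : Set V} (hU : Convex ℝ U) {U' : Set W} {f : V → W}
    {g : W → G} (hg : HolderC1 α U' g) (hf : HolderC1 α U f) (hUU' : MapsTo f U U') :
    HolderC1 α U fun x => g (f x) := by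
  obtain ⟨C, f', hC, hf⟩ := hf
  obtain ⟨K, g', hK, hg⟩ := hg
  refine ⟨max K (max (K * C) (K * C ^ α * C + K * C)), fun x => (g' (f x)).comp (f' x),
    le_max_of_le_left hK, fun x hx => ?_⟩
  obtain ⟨h1, h2, h3, h4⟩ := hf x hx
  obtain ⟨k1, k2, k3, k4⟩ := hg (f x) (hUU' hx)
  refine ⟨k1.comp x h1, k2.trans (le_max_left _ _), ?_, fun y hy => ?_⟩
  · refine le_max_of_le_right (le_max_of_le_left ?_)
    exact (ContinuousLinearMap.opNorm_comp_le _ _).trans (by gcongr)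
  · have hlip : ‖f x - f y‖ ≤ C * ‖x - y‖ :=
      hU.norm_image_sub_le_of_norm_hasFDerivWithin_le
        (fun z hz => (hf z hz).1.hasFDerivWithinAt) (fun z hz => (hf z hz).2.2.1) hy hx
    have h5 : ‖g' (f x) - g' (f y)‖ ≤ K * C ^ α * ‖x - y‖ ^ α := by
      refine (k4 (f y) (hUU' hy)).trans ?_
      rw [mul_assoc, ← Real.mul_rpow hC (norm_nonneg _)]
      gcongr
    have h6 : (g' (f x)).comp (f' x) - (g' (f y)).comp (f' y) =
        (g' (f x) - g' (f y)).comp (f' x) + (g' (f y)).comp (f' x - f' y) := by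
      ext w
      simp
    rw [h6]
    refine (norm_add_le _ _).trans (le_trans ?_ (mul_le_mul_of_nonneg_right
      (le_max_of_le_right (le_max_right _ _)) (by positivity)))
    rw [add_mul]
    refine add_le_add ?_ ?_
    · refine (ContinuousLinearMap.opNorm_comp_le _ _).trans ?_
      calc ‖g' (f x) - g' (f y)‖ * ‖f' x‖ ≤ (K * C ^ α * ‖x - y‖ ^ α) * C := by gcongr
        _ = _ := by ring
    · refine (ContinuousLinearMap.opNorm_comp_le _ _).trans ?_
      calc ‖g' (f y)‖ * ‖f' x - f' y‖ ≤ K * (C * ‖x - y‖ ^ α) := by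
            gcongr
            · exact (hg (f y) (hUU' hy)).2.2.1
            · exact h4 y hy
        _ = _ := by ring

/-- The derivative is Lipschitz on a compact convex set, and a diameter of at most 2M trades the
excess power ‖x - y‖^(1-α) for a constant. -/
theorem HolderC1.of_contDiffOn {α : ℝ} (hα : α ≤ 1) {U O : Set V} (hU : Convex ℝ U)
    (hUc : IsCompact U) (hO : IsOpen O) (hUO : U ⊆ O) {f : V → W} (hf : ContDiffOn ℝ 2 f O) :
    HolderC1 α U f := by
  have hd : ContDiffOn ℝ 1 (fderiv ℝ f) O := hf.fderiv_of_isOpen hO (by norm_num)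
  have hdd : ContinuousOn (fderiv ℝ (fderiv ℝ f)) O := hd.continuousOn_fderiv_of_isOpen hO le_rfl
  obtain ⟨C1, hC1⟩ := hUc.exists_bound_of_continuousOn (hf.continuousOn.mono hUO)
  obtain ⟨C2, hC2⟩ := hUc.exists_bound_of_continuousOn (hd.continuousOn.mono hUO)
  obtain ⟨C3, hC3⟩ := hUc.exists_bound_of_continuousOn (E := V →L[ℝ] V →L[ℝ] W) (hdd.mono hUO)
  obtain ⟨M, hM⟩ := hUc.isBounded.exists_norm_le
  rcases U.eq_empty_or_nonempty with rfl | ⟨x0, hx0⟩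
  · exact ⟨0, fun _ => 0, le_rfl, fun x hx => hx.elim⟩
  have hC30 : 0 ≤ C3 := (norm_nonneg _).trans (hC3 x0 hx0)
  have hC10 : 0 ≤ C1 := (norm_nonneg _).trans (hC1 x0 hx0)
  have hM0 : 0 ≤ M := (norm_nonneg _).trans (hM x0 hx0)
  refine ⟨max C1 (max C2 (C3 * (2 * M) ^ (1 - α))), fderiv ℝ f, le_max_of_le_left hC10,
    fun x hx => ⟨?_, ?_, ?_, fun y hy => ?_⟩⟩
  · exact ((hf.contDiffAt (hO.mem_nhds (hUO hx))).differentiableAt (by norm_num)).hasFDerivAt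
  · exact (hC1 x hx).trans (le_max_left _ _)
  · exact (hC2 x hx).trans (le_max_of_le_right (le_max_left _ _))
  · have hlip : ‖fderiv ℝ f x - fderiv ℝ f y‖ ≤ C3 * ‖x - y‖ :=
      hU.norm_image_sub_le_of_norm_hasFDerivWithin_le
        (fun z hz => ((hd.contDiffAt (hO.mem_nhds (hUO hz))).differentiableAt
          (by norm_num)).hasFDerivAt.hasFDerivWithinAt) hC3 hy hx
    refine hlip.trans ?_
    rcases (norm_nonneg (x - y)).eq_or_lt with h0 | h0
    · rw [← h0, mul_zero]
      have : 0 ≤ max C1 (max C2 (C3 * (2 * M) ^ (1 - α))) := le_max_of_le_left hC10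
      positivity
    · have h1 : ‖x - y‖ = ‖x - y‖ ^ (1 - α) * ‖x - y‖ ^ α := by
        rw [← Real.rpow_add h0]
        simp
      have h2 : ‖x - y‖ ≤ 2 * M := (norm_sub_le _ _).trans (by linarith [hM x hx, hM y hy])
      have h3 : ‖x - y‖ ^ (1 - α) ≤ (2 * M) ^ (1 - α) :=
        Real.rpow_le_rpow h0.le h2 (by linarith)
      calc C3 * ‖x - y‖ = C3 * ‖x - y‖ ^ (1 - α) * ‖x - y‖ ^ α := by rw [mul_assoc, ← h1]
        _ ≤ C3 * (2 * M) ^ (1 - α) * ‖x - y‖ ^ α := by gcongr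
        _ ≤ _ := by
          gcongr
          exact le_max_of_le_right (le_max_right _ _)

/-- The positive exponent β supplies continuity of the derivative, which exponent α would not do for
α = 0. Distances below 1 allow lowering the exponent; for larger ones the sup bound suffices. -/
theorem HolderC1.isC1Holder {n : ℕ} {α : ℝ≥0} {β : ℝ} {Ω : Set (EuclideanSpace ℝ (Fin n))}
    (hΩ : IsOpen Ω) {a : EuclideanSpace ℝ (Fin n) → ℝ} (hβ : 0 < β) (hαβ : α ≤ β)
    (h : HolderC1 β Ω a) : IsC1Holder α Ω a := by
  obtain ⟨C, a', hC, h⟩ := h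
  have hd : ∀ x ∈ Ω, fderiv ℝ a x = a' x := fun x hx => (h x hx).1.fderiv
  have hH : ∀ (K : ℝ) (γ : ℝ≥0), 0 ≤ K → (∀ x ∈ Ω, ∀ y ∈ Ω, ‖a' x - a' y‖ ≤ K * ‖x - y‖ ^ (γ : ℝ)) →
      HolderOnWith K.toNNReal γ (fderiv ℝ a) Ω := by
    intro K γ hK hγ x hx y hy
    rw [hd x hx, hd y hy, edist_dist, edist_dist, dist_eq_norm, dist_eq_norm,
      ENNReal.ofReal_rpow_of_nonneg (x := ‖x - y‖) (norm_nonneg _) γ.coe_nonneg]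
    change _ ≤ ENNReal.ofReal K * _
    rw [← ENNReal.ofReal_mul hK]
    exact ENNReal.ofReal_le_ofReal (hγ x hx y hy)
  refine ⟨?_, ⟨C, fun x hx => ⟨(h x hx).2.1, ?_⟩⟩, ⟨_, hH (2 * C) α (by positivity)
    fun x hx y hy => ?_⟩⟩
  · rw [show (1 : WithTop ℕ∞) = 0 + 1 from rfl, contDiffOn_succ_iff_fderiv_of_isOpen hΩ]
    refine ⟨fun x hx => (h x hx).1.differentiableAt.differentiableWithinAt, by simp, ?_⟩
    rw [contDiffOn_zero]
    exact (hH C ⟨β, hβ.le⟩ hC fun x hx => (h x hx).2.2.2).continuousOn hβ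
  · rw [hd x hx]
    exact (h x hx).2.2.1
  · rcases le_total ‖x - y‖ 1 with h1 | h1
    · refine ((h x hx).2.2.2 y hy).trans ?_
      have h2 : ‖x - y‖ ^ β ≤ ‖x - y‖ ^ (α : ℝ) :=
        Real.rpow_le_rpow_of_exponent_ge' (norm_nonneg _) h1 α.coe_nonneg hαβ
      have h3 : 0 ≤ ‖x - y‖ ^ (α : ℝ) := by positivity
      nlinarith
    · have h2 : 1 ≤ ‖x - y‖ ^ (α : ℝ) := Real.one_le_rpow h1 α.2
      have h3 := norm_sub_le (a' x) (a' y)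
      have h4 := (h x hx).2.2.1
      have h5 := (h y hy).2.2.1
      nlinarith

end HolderC1

end LeastGradient

/-! ### Anisotropically scaled profiles s^m Q(s, y/s^k) -/

namespace LeastGradient

/-- The strip in which profiles are defined. -/
def strip : Set (ℝ × ℝ) := {z | |z.1| < 2}

theorem isOpen_strip : IsOpen strip := isOpen_lt (by fun_prop) continuous_const

/-- A smooth function on the strip that vanishes for `|z.2| > 1`. -/
structure IsProfile (Q : ℝ × ℝ → ℝ) : Prop where
  contDiffOn : ContDiffOn ℝ ∞ Q strip
  eq_zero : ∀ z, 1 < |z.2| → Q z = 0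

/-- The function `s ^ m * Q (s, y / s ^ k)`. -/
noncomputable def scaled (k m : ℕ) (Q : ℝ × ℝ → ℝ) (z : ℝ × ℝ) : ℝ :=
  z.1 ^ m * Q (z.1, z.2 / z.1 ^ k)

/-- Surplus powers of s are absorbed into the profile, which brings different terms to a common
exponent. -/
theorem scaled_add_exponent (k m j : ℕ) (Q : ℝ × ℝ → ℝ) :
    scaled k (m + j) Q = scaled k m fun z => z.1 ^ j * Q z := by
  ext z
  simp only [scaled]
  ring

/-- The profile of the partial derivative of `scaled k m Q` in the first direction. -/
noncomputable def profileFst (k m : ℕ) (Q : ℝ × ℝ → ℝ) (z : ℝ × ℝ) : ℝ :=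
  m * Q z + z.1 * fderiv ℝ Q z (1, 0) - k * z.2 * fderiv ℝ Q z (0, 1)

/-- The profile of the partial derivative of `scaled k m Q` in the second direction. -/
noncomputable def profileSnd (Q : ℝ × ℝ → ℝ) (z : ℝ × ℝ) : ℝ := fderiv ℝ Q z (0, 1)

namespace IsProfile

variable {Q P : ℝ × ℝ → ℝ}

theorem add (hQ : IsProfile Q) (hP : IsProfile P) : IsProfile fun z => Q z + P z :=
  ⟨hQ.contDiffOn.add hP.contDiffOn, fun z hz => by rw [hQ.eq_zero z hz, hP.eq_zero z hz, add_zero]⟩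

theorem smooth_mul (hQ : IsProfile Q) {φ : ℝ × ℝ → ℝ} (hφ : ContDiffOn ℝ ∞ φ strip) :
    IsProfile fun z => φ z * Q z :=
  ⟨hφ.mul hQ.contDiffOn, fun z hz => by rw [hQ.eq_zero z hz, mul_zero]⟩

theorem fderiv_apply (hQ : IsProfile Q) (w : ℝ × ℝ) : IsProfile fun z => fderiv ℝ Q z w := by
  refine ⟨(hQ.contDiffOn.fderiv_of_isOpen isOpen_strip (m := ∞) (by simp)).clm_apply
    contDiffOn_const, fun z hz => ?_⟩
  have h : Q =ᶠ[𝓝 z] fun _ => 0 := by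
    have ho : IsOpen {z : ℝ × ℝ | 1 < |z.2|} := isOpen_lt continuous_const (by fun_prop)
    filter_upwards [ho.mem_nhds hz] with x hx
    exact hQ.eq_zero x hx
  rw [h.fderiv_eq]
  simp

theorem profileSnd (hQ : IsProfile Q) : IsProfile (profileSnd Q) := hQ.fderiv_apply _

theorem profileFst (hQ : IsProfile Q) (k m : ℕ) : IsProfile (profileFst k m Q) := by
  have h1 := hQ.smooth_mul (contDiffOn_const (c := (m : ℝ)))
  have h2 := (hQ.fderiv_apply (1, 0)).smooth_mul (φ := fun z => z.1) contDiff_fst.contDiffOn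
  have h3 := (hQ.fderiv_apply (0, 1)).smooth_mul (φ := fun z => -(k * z.2))
    (contDiff_const.mul contDiff_snd).neg.contDiffOn
  convert! (h1.add h2).add h3 using 2 with z
  simp only [LeastGradient.profileFst]
  ring

/-- The support in `z.2` reduces this to a compact box. The value 3/2 leaves room on both sides:
estimates are needed for |s| ≤ 1, mean value arguments leave that range slightly, and profiles live
for |s| < 2. -/
theorem exists_bound (hQ : IsProfile Q) : ∃ C, 0 ≤ C ∧ ∀ z : ℝ × ℝ, |z.1| ≤ 3 / 2 → |Q z| ≤ C := by
  have hK : IsCompact (Icc (-(3 / 2) : ℝ) (3 / 2) ×ˢ Icc (-1 : ℝ) 1) :=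
    isCompact_Icc.prod isCompact_Icc
  obtain ⟨C, hC⟩ := hK.exists_bound_of_continuousOn (hQ.contDiffOn.continuousOn.mono fun z hz => by
    have : |z.1| ≤ 3 / 2 := abs_le.2 hz.1
    change |z.1| < 2
    linarith)
  have h0 : 0 ≤ C := (norm_nonneg _).trans (hC (0, 0) (by norm_num))
  refine ⟨C, h0, fun z hz => ?_⟩
  by_cases h : |z.2| ≤ 1
  · exact hC z ⟨abs_le.1 hz, abs_le.1 h⟩
  · rw [hQ.eq_zero z (not_le.1 h), abs_zero]
    exact h0

end IsProfile

variable {Q : ℝ × ℝ → ℝ}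

theorem abs_scaled_le {C : ℝ} (hC : ∀ z : ℝ × ℝ, |z.1| ≤ 3 / 2 → |Q z| ≤ C) (k m : ℕ) {z : ℝ × ℝ}
    (hz : |z.1| ≤ 3 / 2) : |scaled k m Q z| ≤ C * |z.1| ^ m := by
  rw [scaled, abs_mul, abs_pow, mul_comm]
  gcongr
  exact hC _ hz

/-- A derivative in s costs one power of s, a derivative in y costs k of them, and both results are
again scaled profiles. -/
theorem hasFDerivAt_scaled_of_ne (hQ : IsProfile Q) (k m : ℕ) {z : ℝ × ℝ} (hz : z ∈ strip)
    (h0 : z.1 ≠ 0) :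
    HasFDerivAt (scaled k m Q)
      ((z.1 ^ m / z.1 * profileFst k m Q (z.1, z.2 / z.1 ^ k)) • ContinuousLinearMap.fst ℝ ℝ ℝ +
        (z.1 ^ m / z.1 ^ k * profileSnd Q (z.1, z.2 / z.1 ^ k)) •
          ContinuousLinearMap.snd ℝ ℝ ℝ) z := by
  have h1 : HasFDerivAt (fun z : ℝ × ℝ => z.1) (ContinuousLinearMap.fst ℝ ℝ ℝ) z := hasFDerivAt_fst
  have h2 : HasFDerivAt (fun z : ℝ × ℝ => z.2) (ContinuousLinearMap.snd ℝ ℝ ℝ) z := hasFDerivAt_snd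
  have hθ : HasFDerivAt (fun z : ℝ × ℝ => z.2 / z.1 ^ k) _ z :=
    h2.mul (((hasDerivAt_pow k z.1).inv (pow_ne_zero k h0)).comp_hasFDerivAt z h1)
  have hin := h1.prodMk hθ
  have hQd : HasFDerivAt Q (fderiv ℝ Q (z.1, z.2 / z.1 ^ k)) (z.1, z.2 / z.1 ^ k) := by
    refine ((hQ.contDiffOn.contDiffAt (isOpen_strip.mem_nhds ?_)).differentiableAt
      (by simp)).hasFDerivAt
    exact hz
  have h := ((hasDerivAt_pow m z.1).comp_hasFDerivAt z h1).mul (hQd.comp z hin)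
  refine h.congr_fderiv ?_
  have hpow : ∀ j : ℕ, (j : ℝ) * z.1 ^ (j - 1) = j * (z.1 ^ j / z.1) := by
    intro j
    rcases j with _ | j
    · simp
    · rw [Nat.add_sub_cancel, pow_succ, mul_div_cancel_right₀ _ h0]
  rw [hpow, hpow]
  unfold profileFst profileSnd
  generalize fderiv ℝ Q (z.1, z.2 / z.1 ^ k) = L at h ⊢
  have hlin : ∀ a b : ℝ, L (a, b) = a * L (1, 0) + b * L (0, 1) := by
    intro a b
    have : ((a, b) : ℝ × ℝ) = a • (1, 0) + b • (0, 1) := by simp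
    rw [this, map_add, map_smul, map_smul, smul_eq_mul, smul_eq_mul]
  refine ContinuousLinearMap.ext fun w => ?_
  simp only [add_apply, smul_apply, Function.comp_apply, ContinuousLinearMap.comp_apply,
    ContinuousLinearMap.prod_apply, ContinuousLinearMap.coe_fst', ContinuousLinearMap.coe_snd',
    smul_eq_mul]
  rw [hlin]
  field_simp
  ring

/-- On s = 0 the value is 0 and the function is O(|s|^m) with m ≥ 2, so the derivative vanishes
there, as the formula predicts because both remaining exponents are positive. -/
theorem hasFDerivAt_scaled (hQ : IsProfile Q) {k m : ℕ} (hk : 1 ≤ k) (hm : k < m) {z : ℝ × ℝ}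
    (hz : z ∈ strip) :
    HasFDerivAt (scaled k m Q)
      (scaled k (m - 1) (profileFst k m Q) z • ContinuousLinearMap.fst ℝ ℝ ℝ +
        scaled k (m - k) (profileSnd Q) z • ContinuousLinearMap.snd ℝ ℝ ℝ) z := by
  by_cases h0 : z.1 = 0
  · have e1 : scaled k (m - 1) (profileFst k m Q) z = 0 := by
      rw [scaled, h0, zero_pow (by omega), zero_mul]
    have e2 : scaled k (m - k) (profileSnd Q) z = 0 := by
      rw [scaled, h0, zero_pow (by omega), zero_mul]
    rw [e1, e2, zero_smul, zero_smul, add_zero]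
    obtain ⟨C, hC0, hC⟩ := hQ.exists_bound
    have hz0 : scaled k m Q z = 0 := by rw [scaled, h0, zero_pow (by omega), zero_mul]
    refine HasFDerivAt.of_isLittleO ?_
    have h1 : (fun w => scaled k m Q w - scaled k m Q z -
        (0 : ℝ × ℝ →L[ℝ] ℝ) (w - z)) =O[𝓝 z] fun w => ‖w - z‖ ^ 2 := by
      refine Asymptotics.IsBigO.of_bound C ?_
      filter_upwards [Metric.ball_mem_nhds z one_pos] with w hw
      rw [mem_ball_iff_norm] at hw
      have h2 : |w.1| ≤ ‖w - z‖ := by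
        have := norm_fst_le (w - z)
        rwa [Prod.fst_sub, h0, sub_zero] at this
      rw [hz0, sub_zero, zero_apply, sub_zero, Real.norm_eq_abs, norm_pow, norm_norm]
      refine (abs_scaled_le hC k m (by linarith)).trans ?_
      gcongr
      calc |w.1| ^ m ≤ |w.1| ^ 2 := pow_le_pow_of_le_one (abs_nonneg _) (by linarith) (by omega)
        _ ≤ _ := by gcongr
    refine h1.trans_isLittleO ?_
    have h3 : Tendsto (fun w => ‖w - z‖) (𝓝 z) (𝓝 0) := by
      have : Continuous fun w : ℝ × ℝ => ‖w - z‖ := by fun_prop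
      simpa using this.tendsto z
    have h4 := (Asymptotics.isLittleO_pow_id (𝕜 := ℝ) one_lt_two).comp_tendsto h3
    exact Asymptotics.isLittleO_norm_right.1 h4
  · refine (hasFDerivAt_scaled_of_ne hQ k m hz h0).congr_fderiv ?_
    congr 2
    · rw [scaled, pow_sub₀ _ h0 (by omega), pow_one, div_eq_mul_inv]
    · rw [scaled, pow_sub₀ _ h0 (by omega), div_eq_mul_inv]

/-- Let σ be the larger of the two |s|. Points further apart than σ^k/4 are handled by the size σ^m
≤ (σ^k)^α. Closer points are joined inside a ball where |s| is comparable to σ; there the gradient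
is at most Kσ^(m-k), and ‖z - w‖^(1-α) ≤ (σ^k)^(1-α) does the rest. -/
theorem scaled_holder (hQ : IsProfile Q) {k m : ℕ} (hk : 1 ≤ k) {α : ℝ} (hα0 : 0 ≤ α)
    (hα1 : α ≤ 1) (hkm : k * α ≤ m) :
    ∃ C, 0 ≤ C ∧ ∀ z w : ℝ × ℝ, |z.1| ≤ 1 → |w.1| ≤ 1 →
      |scaled k m Q z - scaled k m Q w| ≤ C * ‖z - w‖ ^ α := by
  obtain ⟨C, hC0, hC⟩ := hQ.exists_bound
  obtain ⟨C1, hC10, hC1⟩ := (hQ.profileFst k m).exists_bound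
  obtain ⟨C2, hC20, hC2⟩ := hQ.profileSnd.exists_bound
  set K := (2 ^ k * C1 + C2) * (2 ^ m * 2 ^ k) with hK
  have hK0 : 0 ≤ K := by positivity
  have hpow : ∀ σ : ℝ, 0 ≤ σ → σ ≤ 1 → σ ^ m ≤ (σ ^ k) ^ α := by
    intro σ h0 h1
    rw [← Real.rpow_natCast σ k, ← Real.rpow_mul h0, ← Real.rpow_natCast σ m]
    exact Real.rpow_le_rpow_of_exponent_ge' h0 h1 (by positivity) hkm
  refine ⟨max (8 * C) K, le_max_of_le_right hK0, ?_⟩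
  suffices H : ∀ z w : ℝ × ℝ, |z.1| ≤ 1 → |w.1| ≤ |z.1| →
      |scaled k m Q z - scaled k m Q w| ≤ max (8 * C) K * ‖z - w‖ ^ α by
    intro z w hz hw
    rcases le_total |w.1| |z.1| with h | h
    · exact H z w hz h
    · rw [abs_sub_comm, norm_sub_rev]
      exact H w z hw h
  intro z w hz hwz
  set σ := |z.1| with hσ
  have hσ0 : 0 ≤ σ := abs_nonneg _
  by_cases hd : σ ^ k / 4 ≤ ‖z - w‖
  · have h1 := abs_scaled_le hC k m (z := z) (by linarith)
    have h2 := abs_scaled_le hC k m (z := w) (by linarith)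
    have h3 : |w.1| ^ m ≤ σ ^ m := by gcongr
    have h4 : σ ^ m ≤ 4 * ‖z - w‖ ^ α := by
      refine (hpow σ hσ0 hz).trans ?_
      calc (σ ^ k) ^ α ≤ (4 * ‖z - w‖) ^ α := by gcongr; linarith
        _ = 4 ^ α * ‖z - w‖ ^ α := Real.mul_rpow (by norm_num) (norm_nonneg _)
        _ ≤ 4 ^ (1 : ℝ) * ‖z - w‖ ^ α := by gcongr; norm_num
        _ = _ := by rw [Real.rpow_one]
    calc |scaled k m Q z - scaled k m Q w| ≤ |scaled k m Q z| + |scaled k m Q w| := abs_sub _ _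
      _ ≤ C * σ ^ m + C * σ ^ m := add_le_add h1 (h2.trans (by gcongr))
      _ = 2 * C * σ ^ m := by ring
      _ ≤ 2 * C * (4 * ‖z - w‖ ^ α) := by gcongr
      _ = 8 * C * ‖z - w‖ ^ α := by ring
      _ ≤ _ := by gcongr; exact le_max_left _ _
  · push Not at hd
    have hσp : 0 < σ := by
      rcases hσ0.eq_or_lt with h | h
      · rw [← h, zero_pow (by omega)] at hd
        linarith [norm_nonneg (z - w)]
      · exact h
    have hσk : σ ^ k ≤ σ := pow_le_of_le_one hσ0 hz (by omega)
    have hball : ∀ v ∈ Metric.closedBall z (σ ^ k / 4), σ / 2 ≤ |v.1| ∧ |v.1| ≤ 2 * σ ∧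
        |v.1| ≤ 3 / 2 := by
      intro v hv
      rw [mem_closedBall_iff_norm] at hv
      have h1 : |v.1 - z.1| ≤ σ ^ k / 4 := (norm_fst_le (v - z)).trans hv
      have h2 := abs_sub_abs_le_abs_sub v.1 z.1
      have h3 := abs_sub_abs_le_abs_sub z.1 v.1
      rw [abs_sub_comm z.1] at h3
      refine ⟨by linarith, by linarith, by linarith⟩
    have hder : ∀ v ∈ Metric.closedBall z (σ ^ k / 4),
        ‖(v.1 ^ m / v.1 * profileFst k m Q (v.1, v.2 / v.1 ^ k)) • ContinuousLinearMap.fst ℝ ℝ ℝ +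
        (v.1 ^ m / v.1 ^ k * profileSnd Q (v.1, v.2 / v.1 ^ k)) •
          ContinuousLinearMap.snd ℝ ℝ ℝ‖ ≤ K * (σ ^ m / σ ^ k) := by
      intro v hv
      obtain ⟨h1, h2, h3⟩ := hball v hv
      have hv0 : 0 < |v.1| := by linarith
      have h4 : |v.1| ^ m / |v.1| ^ k ≤ (2 ^ m * 2 ^ k) * (σ ^ m / σ ^ k) := by
        calc |v.1| ^ m / |v.1| ^ k ≤ (2 * σ) ^ m / (σ / 2) ^ k := by gcongr
          _ = _ := by rw [mul_pow, div_pow]; field_simp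
      have h5 : |v.1| ^ m / |v.1| ≤ 2 ^ k * (|v.1| ^ m / |v.1| ^ k) := by
        rw [div_le_iff₀ hv0]
        have h6 : |v.1| ^ k ≤ 2 ^ k * |v.1| := by
          obtain ⟨j, rfl⟩ := Nat.exists_eq_add_of_le hk
          have : |v.1| ^ j ≤ 2 ^ j := by gcongr; linarith
          calc |v.1| ^ (1 + j) = |v.1| ^ j * |v.1| := by ring
            _ ≤ 2 ^ j * |v.1| := by gcongr
            _ ≤ 2 ^ (1 + j) * |v.1| := by gcongr <;> linarith
        have h7 : |v.1| ^ m = |v.1| ^ m / |v.1| ^ k * |v.1| ^ k := by field_simp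
        calc |v.1| ^ m = |v.1| ^ m / |v.1| ^ k * |v.1| ^ k := h7
          _ ≤ |v.1| ^ m / |v.1| ^ k * (2 ^ k * |v.1|) := by gcongr
          _ = _ := by ring
      refine (norm_add_le _ _).trans ?_
      rw [norm_smul, norm_smul]
      have h8 : ‖v.1 ^ m / v.1 * profileFst k m Q (v.1, v.2 / v.1 ^ k)‖ ≤
          2 ^ k * (|v.1| ^ m / |v.1| ^ k) * C1 := by
        rw [norm_mul, norm_div, norm_pow, Real.norm_eq_abs, Real.norm_eq_abs]
        exact mul_le_mul h5 (hC1 _ h3) (abs_nonneg _) (by positivity)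
      have h9 : ‖v.1 ^ m / v.1 ^ k * profileSnd Q (v.1, v.2 / v.1 ^ k)‖ ≤
          (|v.1| ^ m / |v.1| ^ k) * C2 := by
        rw [norm_mul, norm_div, norm_pow, norm_pow, Real.norm_eq_abs, Real.norm_eq_abs]
        exact mul_le_mul le_rfl (hC2 _ h3) (abs_nonneg _) (by positivity)
      calc _ ≤ 2 ^ k * (|v.1| ^ m / |v.1| ^ k) * C1 * 1 + (|v.1| ^ m / |v.1| ^ k) * C2 * 1 := by
            gcongr
            · exact ContinuousLinearMap.norm_fst_le ℝ ℝ ℝ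
            · exact ContinuousLinearMap.norm_snd_le ℝ ℝ ℝ
        _ = (2 ^ k * C1 + C2) * (|v.1| ^ m / |v.1| ^ k) := by ring
        _ ≤ (2 ^ k * C1 + C2) * ((2 ^ m * 2 ^ k) * (σ ^ m / σ ^ k)) := by gcongr
        _ = _ := by rw [hK]; ring
    have hmv := (convex_closedBall z (σ ^ k / 4)).norm_image_sub_le_of_norm_hasFDerivWithin_le
      (fun v hv => by
        obtain ⟨h1, h2, h3⟩ := hball v hv
        refine (hasFDerivAt_scaled_of_ne hQ k m (z := v) ?_ ?_).hasFDerivWithinAt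
        · change |v.1| < 2
          linarith
        · intro h
          rw [h, abs_zero] at h1
          linarith) hder (x := w) (y := z)
      (by rw [mem_closedBall_iff_norm, norm_sub_rev]; exact hd.le)
      (Metric.mem_closedBall_self (by positivity))
    rw [Real.norm_eq_abs] at hmv
    refine hmv.trans ?_
    have h10 : σ ^ m / σ ^ k * ‖z - w‖ ≤ ‖z - w‖ ^ α := by
      rcases (norm_nonneg (z - w)).eq_or_lt with h | h
      · rw [← h, mul_zero]
        positivity
      · have e1 : ‖z - w‖ = ‖z - w‖ ^ (1 - α) * ‖z - w‖ ^ α := by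
          rw [← Real.rpow_add h]
          simp
        have e2 : ‖z - w‖ ^ (1 - α) ≤ (σ ^ k) ^ (1 - α) := by
          refine Real.rpow_le_rpow h.le ?_ (by linarith)
          linarith [pow_pos hσp k]
        have e3 : (σ ^ k) ^ (1 - α) * (σ ^ k) ^ α = σ ^ k := by
          rw [← Real.rpow_add (by positivity)]
          simp
        have e4 := hpow σ hσ0 hz
        have e5 : σ ^ m / σ ^ k * (σ ^ k) ^ (1 - α) ≤ 1 := by
          rw [div_mul_eq_mul_div, div_le_one (by positivity)]
          calc σ ^ m * (σ ^ k) ^ (1 - α) ≤ (σ ^ k) ^ α * (σ ^ k) ^ (1 - α) := by gcongr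
            _ = σ ^ k := by rw [mul_comm, e3]
        calc σ ^ m / σ ^ k * ‖z - w‖ = σ ^ m / σ ^ k * ‖z - w‖ ^ (1 - α) * ‖z - w‖ ^ α := by
              rw [mul_assoc, ← e1]
          _ ≤ σ ^ m / σ ^ k * (σ ^ k) ^ (1 - α) * ‖z - w‖ ^ α := by gcongr
          _ ≤ 1 * ‖z - w‖ ^ α := by gcongr
          _ = _ := one_mul _
    calc K * (σ ^ m / σ ^ k) * ‖z - w‖ = K * (σ ^ m / σ ^ k * ‖z - w‖) := by ring
      _ ≤ K * ‖z - w‖ ^ α := by gcongr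
      _ ≤ _ := by gcongr; exact le_max_right _ _

/-- Scaled profiles are of class `C^{1,α}`. -/
theorem holderC1_scaled (hQ : IsProfile Q) {k : ℕ} (hk : 3 ≤ k) {α : ℝ} (hα0 : 0 ≤ α)
    (hα1 : α ≤ 1) (hkα : k * α ≤ k - 2) :
    HolderC1 α {z : ℝ × ℝ | |z.1| ≤ 1} (scaled k (2 * k - 2) Q) := by
  have hcast : (((k - 2 : ℕ) : ℝ)) = k - 2 := by
    rw [Nat.cast_sub (by omega)]
    norm_num
  -- The s-derivative has the better exponent 2k - 3; the y-derivative has k - 2 and determines the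
  -- Hölder exponent (k-2)/k.
  have e1 : scaled k (2 * k - 2 - 1) (profileFst k (2 * k - 2) Q) =
      scaled k (k - 2) fun z => z.1 ^ (k - 1) * profileFst k (2 * k - 2) Q z := by
    rw [← scaled_add_exponent]
    congr 1
    omega
  have e2 : 2 * k - 2 - k = k - 2 := by omega
  have hP1 : IsProfile fun z => z.1 ^ (k - 1) * profileFst k (2 * k - 2) Q z :=
    (hQ.profileFst k (2 * k - 2)).smooth_mul (contDiff_fst.pow _).contDiffOn
  obtain ⟨C0, hC00, hC0⟩ := hQ.exists_bound
  obtain ⟨C1, hC10, hC1⟩ := hP1.exists_bound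
  obtain ⟨C2, hC20, hC2⟩ := hQ.profileSnd.exists_bound
  obtain ⟨K1, hK10, hK1⟩ := scaled_holder hP1 (k := k) (m := k - 2) (by omega) hα0 hα1
    (by rw [hcast]; exact hkα)
  obtain ⟨K2, hK20, hK2⟩ := scaled_holder hQ.profileSnd (k := k) (m := k - 2) (by omega) hα0 hα1
    (by rw [hcast]; exact hkα)
  have hb : ∀ {P : ℝ × ℝ → ℝ} {C : ℝ}, 0 ≤ C → (∀ z : ℝ × ℝ, |z.1| ≤ 3 / 2 → |P z| ≤ C) →
      ∀ (m : ℕ) (z : ℝ × ℝ), |z.1| ≤ 1 → |scaled k m P z| ≤ C := by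
    intro P C hC hP m z hz
    refine (abs_scaled_le hP k m (by linarith)).trans ?_
    exact mul_le_of_le_one_right hC (pow_le_one₀ (abs_nonneg _) hz)
  have hlin : ∀ a b : ℝ, ‖a • ContinuousLinearMap.fst ℝ ℝ ℝ + b • ContinuousLinearMap.snd ℝ ℝ ℝ‖ ≤
      |a| + |b| := by
    intro a b
    refine (norm_add_le _ _).trans ?_
    rw [norm_smul, norm_smul]
    exact add_le_add
      (mul_le_of_le_one_right (norm_nonneg _) (ContinuousLinearMap.norm_fst_le ℝ ℝ ℝ))
      (mul_le_of_le_one_right (norm_nonneg _) (ContinuousLinearMap.norm_snd_le ℝ ℝ ℝ))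
  refine ⟨C0 + (C1 + C2) + (K1 + K2), fun z =>
    scaled k (2 * k - 2 - 1) (profileFst k (2 * k - 2) Q) z • ContinuousLinearMap.fst ℝ ℝ ℝ +
      scaled k (2 * k - 2 - k) (profileSnd Q) z • ContinuousLinearMap.snd ℝ ℝ ℝ, by positivity,
    fun z hz => ⟨?_, ?_, ?_, fun w hw => ?_⟩⟩
  · refine hasFDerivAt_scaled hQ (by omega) (by omega) ?_
    have : |z.1| ≤ 1 := hz
    change |z.1| < 2
    linarith
  · refine (hb hC00 hC0 _ z hz).trans ?_
    linarith
  · refine (hlin _ _).trans ?_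
    rw [e1]
    have h1 := hb hC10 hC1 (k - 2) z hz
    have h2 := hb hC20 hC2 (2 * k - 2 - k) z hz
    linarith
  · rw [e1, e2, add_sub_add_comm, ← sub_smul, ← sub_smul]
    refine (hlin _ _).trans ?_
    have h1 := hK1 z w hz hw
    have h2 := hK2 z w hz hw
    have h3 : 0 ≤ ‖z - w‖ ^ α := by positivity
    nlinarith

end LeastGradient

/-! ### The bump and the density of the calibrating field -/

namespace LeastGradient

theorem deriv_smoothTransition_zero : deriv Real.smoothTransition 0 = 0 :=
  IsLocalMin.deriv_eq_zero <| Eventually.of_forall fun x => by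
    rw [Real.smoothTransition.zero]
    exact Real.smoothTransition.nonneg x

/-- A small smooth function supported in `[-1, 1]` that equals `4 k θ²` near `0`. -/
structure IsBump (k : ℕ) (ε : ℝ) (M : ℝ → ℝ) : Prop where
  pos : 0 < ε
  lt_one : ε < 1
  contDiff : ContDiff ℝ ∞ M
  eq_zero : ∀ θ, 1 < |θ| → M θ = 0
  eq_sq : ∀ θ, |θ| ≤ ε → M θ = 4 * k * θ ^ 2
  nonneg : ∀ θ, 0 ≤ M θ
  le : ∀ θ, M θ ≤ 1 / (4 ^ k * (8 * k))
  abs_deriv_le : ∀ θ, |θ * deriv M θ| ≤ 1 / (4 ^ k * (8 * k))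

/-- The parabola 4kθ² is cut off at width δ. Both M and θM' scale like δ², because θ times the
derivative of a cutoff at width δ is bounded; so a small δ meets the smallness conditions. -/
theorem exists_isBump {k : ℕ} (hk : 1 ≤ k) : ∃ ε M, IsBump k ε M := by
  obtain ⟨C, hC0, hC⟩ := exists_bound_deriv_smoothTransition
  set η : ℝ := 1 / (4 ^ k * (8 * k)) with hη
  have hη0 : 0 < η := by positivity
  have hkr : (1 : ℝ) ≤ k := by exact_mod_cast hk
  -- The factor 4 + 8C is twice 2 + 4C, the bound for the bracket in θM' on θ² ≤ 2δ².
  obtain ⟨δ, hδ0, hδ1, hδη⟩ : ∃ δ : ℝ, 0 < δ ∧ δ < 1 / 2 ∧ 4 * k * δ ^ 2 * (4 + 8 * C) ≤ η := by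
    refine ⟨min (1 / 3) (η / (4 * k * (4 + 8 * C))), by positivity, ?_, ?_⟩
    · exact (min_le_left _ _).trans_lt (by norm_num)
    · set δ := min (1 / 3) (η / (4 * k * (4 + 8 * C)))
      have h0 : 0 < δ := by positivity
      have h1 : δ ≤ 1 := (min_le_left _ _).trans (by norm_num)
      have h2 : δ ≤ η / (4 * k * (4 + 8 * C)) := min_le_right _ _
      rw [le_div_iff₀ (by positivity)] at h2
      have h3 : 4 * k * δ ^ 2 * (4 + 8 * C) = δ * (δ * (4 * k * (4 + 8 * C))) := by ring
      rw [h3]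
      nlinarith
  have hsm : ContDiff ℝ ∞ fun θ : ℝ => 4 * k * θ ^ 2 * Real.smoothTransition (2 - (θ / δ) ^ 2) := by
    refine (contDiff_const.mul (contDiff_id.pow 2)).mul (Real.smoothTransition.contDiff.comp ?_)
    fun_prop
  have hsupp : ∀ θ : ℝ, 2 * δ ^ 2 ≤ θ ^ 2 → Real.smoothTransition (2 - (θ / δ) ^ 2) = 0 := by
    intro θ h
    refine Real.smoothTransition.zero_of_nonpos ?_
    rw [div_pow, sub_nonpos, le_div_iff₀ (by positivity)]
    exact h
  have hsmall : 4 * k * (2 * δ ^ 2) ≤ η := by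
    have : 4 * k * δ ^ 2 * 2 ≤ 4 * k * δ ^ 2 * (4 + 8 * C) := by gcongr; linarith
    linarith
  refine ⟨δ, fun θ => 4 * k * θ ^ 2 * Real.smoothTransition (2 - (θ / δ) ^ 2), hδ0, by linarith,
    hsm, fun θ hθ => ?_, fun θ hθ => ?_, fun θ => ?_, fun θ => ?_, fun θ => ?_⟩
  · rw [hsupp θ, mul_zero]
    have h1 : 1 < θ ^ 2 := by
      rw [← sq_abs]
      nlinarith [abs_nonneg θ]
    nlinarith
  · rw [Real.smoothTransition.one_of_one_le, mul_one]
    have h1 : (θ / δ) ^ 2 ≤ 1 := by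
      rw [div_pow, div_le_one (by positivity), ← sq_abs]
      gcongr
    linarith
  · exact mul_nonneg (by positivity) (Real.smoothTransition.nonneg _)
  · by_cases h : 2 * δ ^ 2 ≤ θ ^ 2
    · rw [hsupp θ h, mul_zero]
      exact hη0.le
    · push Not at h
      refine (mul_le_of_le_one_right (by positivity) (Real.smoothTransition.le_one _)).trans ?_
      refine le_trans ?_ hsmall
      gcongr
  · have hd : HasDerivAt (fun θ : ℝ => 4 * k * θ ^ 2 * Real.smoothTransition (2 - (θ / δ) ^ 2))
        (4 * k * (2 * θ) * Real.smoothTransition (2 - (θ / δ) ^ 2) +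
          4 * k * θ ^ 2 * (deriv Real.smoothTransition (2 - (θ / δ) ^ 2) * -(2 * θ / δ ^ 2))) θ := by
      have h1 : HasDerivAt (fun θ : ℝ => 4 * k * θ ^ 2) (4 * k * (2 * θ)) θ := by
        simpa using (hasDerivAt_pow 2 θ).const_mul (4 * (k : ℝ))
      have h2 : HasDerivAt (fun θ : ℝ => 2 - (θ / δ) ^ 2) (-(2 * θ / δ ^ 2)) θ := by
        convert! (((hasDerivAt_id θ).div_const δ).pow 2).const_sub 2 using 1
        simp
        field_simp
      exact h1.mul ((hasDerivAt_smoothTransition _).comp θ h2)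
    rw [hd.deriv]
    by_cases h : 2 * δ ^ 2 ≤ θ ^ 2
    · have h0 : deriv Real.smoothTransition (2 - (θ / δ) ^ 2) * θ = 0 := by
        rcases h.eq_or_lt with h | h
        · rw [show (2 : ℝ) - (θ / δ) ^ 2 = 0 by rw [div_pow, ← h]; field_simp; norm_num,
            deriv_smoothTransition_zero, zero_mul]
        · rw [deriv_smoothTransition_eq_zero, zero_mul]
          left
          rw [div_pow, sub_neg, lt_div_iff₀ (by positivity)]
          exact h
      rw [hsupp θ h]
      have : θ * (4 * k * (2 * θ) * 0 +
          4 * k * θ ^ 2 * (deriv Real.smoothTransition (2 - (θ / δ) ^ 2) * -(2 * θ / δ ^ 2))) =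
          (deriv Real.smoothTransition (2 - (θ / δ) ^ 2) * θ) * (-(4 * k * θ ^ 2 * (2 * θ / δ ^ 2))) := by
        ring
      rw [this, h0, zero_mul, abs_zero]
      exact hη0.le
    · push Not at h
      have h5 : θ ^ 2 / δ ^ 2 ≤ 2 := by
        rw [div_le_iff₀ (by positivity)]
        exact h.le
      have h6 : θ * (4 * k * (2 * θ) * Real.smoothTransition (2 - (θ / δ) ^ 2) +
          4 * k * θ ^ 2 * (deriv Real.smoothTransition (2 - (θ / δ) ^ 2) * -(2 * θ / δ ^ 2))) =
          4 * k * θ ^ 2 * (2 * Real.smoothTransition (2 - (θ / δ) ^ 2) -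
            2 * deriv Real.smoothTransition (2 - (θ / δ) ^ 2) * (θ ^ 2 / δ ^ 2)) := by ring
      rw [h6, abs_mul, abs_of_nonneg (by positivity)]
      have h7 : |2 * Real.smoothTransition (2 - (θ / δ) ^ 2) -
            2 * deriv Real.smoothTransition (2 - (θ / δ) ^ 2) * (θ ^ 2 / δ ^ 2)| ≤ 2 + 4 * C := by
        refine (abs_sub _ _).trans ?_
        rw [abs_mul, abs_mul, abs_mul, abs_of_nonneg (Real.smoothTransition.nonneg _), abs_two,
          abs_of_nonneg (show 0 ≤ θ ^ 2 / δ ^ 2 by positivity)]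
        have h8 := Real.smoothTransition.le_one (2 - (θ / δ) ^ 2)
        have h9 : |deriv Real.smoothTransition (2 - (θ / δ) ^ 2)| * (θ ^ 2 / δ ^ 2) ≤ C * 2 :=
          mul_le_mul (hC _) h5 (by positivity) hC0
        linarith
      calc 4 * k * θ ^ 2 * _ ≤ 4 * k * (2 * δ ^ 2) * (2 + 4 * C) := by gcongr
        _ = 4 * k * δ ^ 2 * (4 + 8 * C) := by ring
        _ ≤ η := hδη

/-- The profile of the radicand. -/
noncomputable def radProfile (M : ℝ → ℝ) (z : ℝ × ℝ) : ℝ := (1 - z.1 ^ 2) * M z.2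

/-- `√(1 + (1 - s²) s^(2k-2) M)`, as a function of `s` and `y`. -/
noncomputable def root (k : ℕ) (M : ℝ → ℝ) (z : ℝ × ℝ) : ℝ :=
  √(1 + scaled k (2 * k - 2) (radProfile M) z)

/-- The profile of the density `ϱ`. -/
noncomputable def densityProfile (k : ℕ) (M : ℝ → ℝ) (z : ℝ × ℝ) : ℝ :=
  (1 + √(1 + z.1 ^ (2 * k - 2) * radProfile M z))⁻¹ * ((1 - z.1) * M z.2)

/-- The density `ϱ`, which satisfies `(1 + s) ϱ = 1 + s √(1 + (1 - s²) s^(2k-2) M)`. -/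
noncomputable def density (k : ℕ) (M : ℝ → ℝ) (z : ℝ × ℝ) : ℝ :=
  1 + scaled k (2 * k - 1) (densityProfile k M) z

/-- The partial derivative of the density in `s`. -/
noncomputable def densityFst (k : ℕ) (M : ℝ → ℝ) : ℝ × ℝ → ℝ :=
  scaled k (2 * k - 2) (profileFst k (2 * k - 1) (densityProfile k M))

/-- The partial derivative of the density in `y`. -/
noncomputable def densitySnd (k : ℕ) (M : ℝ → ℝ) : ℝ × ℝ → ℝ :=
  scaled k (k - 1) (profileSnd (densityProfile k M))

namespace IsBump

variable {k : ℕ} {ε : ℝ} {M : ℝ → ℝ}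

theorem isProfile (hM : IsBump k ε M) : IsProfile fun z => M z.2 :=
  ⟨(hM.contDiff.comp contDiff_snd).contDiffOn, fun _ hz => hM.eq_zero _ hz⟩

theorem isProfile_rad (hM : IsBump k ε M) : IsProfile (radProfile M) :=
  hM.isProfile.smooth_mul (contDiff_const.sub (contDiff_fst.pow 2)).contDiffOn

theorem bound_le_one (hk : 1 ≤ k) : 1 / (4 ^ k * (8 * (k : ℝ))) ≤ 1 / 32 := by
  have hkr : (1 : ℝ) ≤ k := by exact_mod_cast hk
  have h1 : (4 : ℝ) ^ 1 ≤ 4 ^ k := pow_le_pow_right₀ (by norm_num) hk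
  refine one_div_le_one_div_of_le (by norm_num) ?_
  nlinarith

/-- For 1 < |s| < 2 the factor 1 - s² is negative but at least -3. The 4^k in the bound on M
compensates for s^(2k-2), so the square root is smooth on the whole strip. -/
theorem radicand_pos (hM : IsBump k ε M) (hk : 1 ≤ k) {z : ℝ × ℝ} (hz : z ∈ strip) :
    1 / 2 ≤ 1 + z.1 ^ (2 * k - 2) * radProfile M z := by
  have hz : |z.1| < 2 := hz
  have hkr : (1 : ℝ) ≤ k := by exact_mod_cast hk
  have hM0 := hM.nonneg z.2
  have hM1 := hM.le z.2
  have hp : 0 ≤ z.1 ^ (2 * k - 2) := Even.pow_nonneg (by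
    rw [show 2 * k - 2 = 2 * (k - 1) by omega]; exact even_two_mul _) _
  have hp2 : z.1 ^ (2 * k - 2) ≤ 4 ^ (k - 1) := by
    calc z.1 ^ (2 * k - 2) = |z.1| ^ (2 * k - 2) := by rw [← abs_pow, abs_of_nonneg hp]
      _ ≤ 2 ^ (2 * k - 2) := by gcongr
      _ = 4 ^ (k - 1) := by rw [show 2 * k - 2 = 2 * (k - 1) by omega, pow_mul]; norm_num
  have hz2 : z.1 ^ 2 ≤ 4 := by
    rw [← sq_abs]
    nlinarith [abs_nonneg z.1]
  have h4 : (4 : ℝ) ^ k = 4 * 4 ^ (k - 1) := by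
    rw [← pow_succ']
    congr 1
    omega
  have h5 : z.1 ^ (2 * k - 2) * M z.2 ≤ 1 / 32 := by
    calc z.1 ^ (2 * k - 2) * M z.2 ≤ 4 ^ (k - 1) * (1 / (4 ^ k * (8 * k))) := by gcongr
      _ = 1 / (32 * k) := by rw [h4]; field_simp; norm_num
      _ ≤ 1 / 32 := one_div_le_one_div_of_le (by norm_num) (by linarith)
  have h6 : 0 ≤ z.1 ^ (2 * k - 2) * M z.2 := by positivity
  have h7 : z.1 ^ (2 * k - 2) * radProfile M z = (1 - z.1 ^ 2) * (z.1 ^ (2 * k - 2) * M z.2) := by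
    rw [radProfile]; ring
  rw [h7]
  nlinarith

theorem isProfile_density (hM : IsBump k ε M) (hk : 1 ≤ k) : IsProfile (densityProfile k M) := by
  refine (hM.isProfile.smooth_mul (φ := fun z => 1 - z.1)
    (contDiff_const.sub contDiff_fst).contDiffOn).smooth_mul ?_
  have h1 : ContDiffOn ℝ ∞ (fun z : ℝ × ℝ => 1 + z.1 ^ (2 * k - 2) * radProfile M z) strip :=
    contDiffOn_const.add ((contDiff_fst.pow _).contDiffOn.mul hM.isProfile_rad.contDiffOn)
  refine (contDiffOn_const.add (h1.sqrt fun z hz => ?_)).inv fun z hz => ?_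
  · linarith [hM.radicand_pos hk hz]
  · positivity

theorem root_sq (hM : IsBump k ε M) (hk : 1 ≤ k) {z : ℝ × ℝ} (hz : z ∈ strip) :
    root k M z ^ 2 = 1 + scaled k (2 * k - 2) (radProfile M) z := by
  have h := hM.radicand_pos hk (z := (z.1, z.2 / z.1 ^ k)) hz
  rw [root, Real.sq_sqrt]
  exact le_trans (by norm_num) h

theorem root_pos (hM : IsBump k ε M) (hk : 1 ≤ k) {z : ℝ × ℝ} (hz : z ∈ strip) :
    0 < root k M z := by
  have h := hM.radicand_pos hk (z := (z.1, z.2 / z.1 ^ k)) hz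
  exact Real.sqrt_pos.2 (lt_of_lt_of_le (by norm_num) h)

theorem one_le_root (hM : IsBump k ε M) {z : ℝ × ℝ} (hk : 1 ≤ k) (hz : |z.1| ≤ 1) :
    1 ≤ root k M z := by
  rw [root, Real.one_le_sqrt, le_add_iff_nonneg_right, scaled, radProfile]
  have h1 : z.1 ^ 2 ≤ 1 := by rwa [sq_le_one_iff_abs_le_one]
  have h2 := hM.nonneg (z.2 / z.1 ^ k)
  have hp : 0 ≤ z.1 ^ (2 * k - 2) := Even.pow_nonneg (by
    rw [show 2 * k - 2 = 2 * (k - 1) by omega]; exact even_two_mul _) _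
  have h3 : 0 ≤ 1 - z.1 ^ 2 := by linarith
  positivity

/-- Rationalizing root - 1 produces the factor 1 - s² = (1 - s)(1 + s), so division by 1 + s leaves
the profile chosen for the density. In particular ϱ has no singularity on the axis s = -1. -/
theorem one_add_mul_density (hM : IsBump k ε M) (hk : 1 ≤ k) {z : ℝ × ℝ} (hz : z ∈ strip) :
    (1 + z.1) * density k M z = 1 + z.1 * root k M z := by
  have h1 := hM.root_sq hk hz
  have h2 := hM.root_pos hk hz
  have h3 : density k M z = 1 + z.1 * z.1 ^ (2 * k - 2) *
      ((1 + root k M z)⁻¹ * ((1 - z.1) * M (z.2 / z.1 ^ k))) := by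
    rw [density, scaled, densityProfile, root, scaled]
    have : z.1 ^ (2 * k - 1) = z.1 * z.1 ^ (2 * k - 2) := by
      rw [← pow_succ']
      congr 1
      omega
    rw [this]
  rw [scaled, radProfile] at h1
  simp only at h1
  rw [h3]
  field_simp
  linear_combination (-z.1) * h1

theorem hasFDerivAt_density (hM : IsBump k ε M) (hk : 2 ≤ k) {z : ℝ × ℝ} (hz : z ∈ strip) :
    HasFDerivAt (density k M) (densityFst k M z • ContinuousLinearMap.fst ℝ ℝ ℝ +
      densitySnd k M z • ContinuousLinearMap.snd ℝ ℝ ℝ) z := by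
  have h := (hasFDerivAt_scaled (hM.isProfile_density (by omega)) (k := k) (m := 2 * k - 1)
    (by omega) (by omega) hz).const_add 1
  have e1 : 2 * k - 1 - 1 = 2 * k - 2 := by omega
  have e2 : 2 * k - 1 - k = k - 1 := by omega
  rw [e1, e2] at h
  exact h

theorem hasFDerivAt_radProfile (hM : IsBump k ε M) (z : ℝ × ℝ) :
    HasFDerivAt (radProfile M) ((-(2 * z.1 * M z.2)) • ContinuousLinearMap.fst ℝ ℝ ℝ +
      ((1 - z.1 ^ 2) * deriv M z.2) • ContinuousLinearMap.snd ℝ ℝ ℝ) z := by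
  have h1 : HasFDerivAt (fun z : ℝ × ℝ => z.1) (ContinuousLinearMap.fst ℝ ℝ ℝ) z := hasFDerivAt_fst
  have h2 : HasFDerivAt (fun z : ℝ × ℝ => z.2) (ContinuousLinearMap.snd ℝ ℝ ℝ) z := hasFDerivAt_snd
  have h3 := (((hM.contDiff.differentiable (by simp)) z.2).hasDerivAt).comp_hasFDerivAt z h2
  refine (((h1.pow 2).const_sub 1).mul h3).congr_fderiv ?_
  refine ContinuousLinearMap.ext fun w => ?_
  simp
  ring

theorem profileSnd_rad (hM : IsBump k ε M) (z : ℝ × ℝ) :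
    profileSnd (radProfile M) z = (1 - z.1 ^ 2) * deriv M z.2 := by
  rw [profileSnd, (hM.hasFDerivAt_radProfile z).fderiv]
  simp

theorem profileFst_rad (hM : IsBump k ε M) (m : ℕ) (z : ℝ × ℝ) :
    profileFst k m (radProfile M) z = m * ((1 - z.1 ^ 2) * M z.2) - 2 * z.1 ^ 2 * M z.2 -
      k * ((1 - z.1 ^ 2) * (z.2 * deriv M z.2)) := by
  rw [profileFst, (hM.hasFDerivAt_radProfile z).fderiv, radProfile]
  simp
  ring

/-- The partial derivatives of the density, from `(1 + s) ϱ = 1 + s √…`. -/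
theorem density_partials (hM : IsBump k ε M) (hk : 3 ≤ k) {z : ℝ × ℝ} (hz : z ∈ strip) :
    density k M z + (1 + z.1) * densityFst k M z = root k M z +
      z.1 ^ (2 * k - 2) * profileFst k (2 * k - 2) (radProfile M) (z.1, z.2 / z.1 ^ k) /
        (2 * root k M z) ∧
    (1 + z.1) * densitySnd k M z =
      z.1 ^ (k - 1) * ((1 - z.1 ^ 2) * deriv M (z.2 / z.1 ^ k)) / (2 * root k M z) := by
  have hr := hM.root_pos (by omega) hz
  have h1 : HasFDerivAt (fun z : ℝ × ℝ => z.1) (ContinuousLinearMap.fst ℝ ℝ ℝ) z := hasFDerivAt_fst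
  have hL := (h1.const_add 1).mul (hM.hasFDerivAt_density (by omega) hz)
  have hR : HasFDerivAt (root k M) _ z :=
    ((hasFDerivAt_scaled hM.isProfile_rad (k := k) (m := 2 * k - 2) (by omega) (by omega)
      hz).const_add 1).sqrt (by rw [← hM.root_sq (by omega) hz]; positivity)
  have hR2 := (h1.mul hR).const_add 1
  have heq : (fun z : ℝ × ℝ => (1 + z.1) * density k M z) =ᶠ[𝓝 z]
      fun z => 1 + z.1 * root k M z := by
    filter_upwards [isOpen_strip.mem_nhds hz] with w hw
    exact hM.one_add_mul_density (by omega) hw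
  -- Differentiating the defining relation avoids differentiating the quotient in the profile.
  have hu := (hL.congr_of_eventuallyEq heq.symm).unique hR2
  have e3 : 2 * k - 2 - k = k - 2 := by omega
  have e4 : z.1 ^ (2 * k - 2) = z.1 * z.1 ^ (2 * k - 2 - 1) := by
    rw [← pow_succ']; congr 1; omega
  have e5 : z.1 ^ (k - 1) = z.1 * z.1 ^ (k - 2) := by
    rw [← pow_succ']; congr 1; omega
  have hroot : √(1 + scaled k (2 * k - 2) (radProfile M) z) = root k M z := rfl
  constructor
  · have h := congrArg (fun L : ℝ × ℝ →L[ℝ] ℝ => L (1, 0)) hu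
    simp [hroot] at h
    rw [e4, add_comm (density k M z), add_comm (root k M z)]
    rw [h, scaled]
    ring
  · have h := congrArg (fun L : ℝ × ℝ →L[ℝ] ℝ => L (0, 1)) hu
    simp [hroot] at h
    rw [e5, h, scaled, hM.profileSnd_rad, e3]
    ring

end IsBump

end LeastGradient

/-! ### Positivity and regularity of the weight -/

namespace LeastGradient

/-- The axial component of the calibrating field, up to the factor `N ϱ ^ (N / 2 - 1)`. -/
noncomputable def axial (k : ℕ) (M : ℝ → ℝ) (z : ℝ × ℝ) : ℝ :=
  density k M z + (1 + z.1) * densityFst k M z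

/-- The squared norm of the calibrating field, up to the factor `N ϱ ^ (N / 2 - 1)`. -/
noncomputable def speedSq (k : ℕ) (M : ℝ → ℝ) (z : ℝ × ℝ) : ℝ :=
  axial k M z ^ 2 + (1 + z.1) * (densitySnd k M z / 2) ^ 2

/-- The weight, as a function of `s` and `y`. -/
noncomputable def planeWeight (N k : ℕ) (M : ℝ → ℝ) (z : ℝ × ℝ) : ℝ :=
  N * density k M z ^ ((N : ℝ) / 2 - 1) * √(speedSq k M z)

theorem mem_strip_of_abs_le_one {z : ℝ × ℝ} (hz : |z.1| ≤ 1) : z ∈ strip := by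
  change |z.1| < 2
  linarith

namespace IsBump

variable {k : ℕ} {ε : ℝ} {M : ℝ → ℝ}

theorem abs_density_sub_one_le (hM : IsBump k ε M) (hk : 1 ≤ k) {z : ℝ × ℝ} (hz : |z.1| ≤ 1) :
    |density k M z - 1| ≤ 1 / 2 := by
  have h1 := hM.le (z.2 / z.1 ^ k)
  have h2 := hM.nonneg (z.2 / z.1 ^ k)
  have h3 := bound_le_one hk
  have e : density k M z - 1 =
      z.1 ^ (2 * k - 1) * ((1 + root k M z)⁻¹ * ((1 - z.1) * M (z.2 / z.1 ^ k))) := by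
    rw [density, scaled, densityProfile, root, scaled, add_sub_cancel_left]
  have h4 := hM.one_le_root hk hz
  rw [e, abs_mul, abs_mul, abs_mul, abs_of_nonneg h2, abs_inv,
    abs_of_nonneg (show 0 ≤ 1 + root k M z by linarith), abs_pow]
  have h5 : |1 - z.1| ≤ 2 := (abs_sub _ _).trans (by rw [abs_one]; linarith)
  calc |z.1| ^ (2 * k - 1) * ((1 + root k M z)⁻¹ * (|1 - z.1| * M (z.2 / z.1 ^ k)))
      ≤ 1 * (1 * (2 * (1 / 32))) := by
        gcongr
        · exact pow_le_one₀ (abs_nonneg _) hz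
        · exact inv_le_one_of_one_le₀ (by linarith)
        · exact h1.trans h3
    _ ≤ 1 / 2 := by norm_num

theorem density_mem (hM : IsBump k ε M) (hk : 1 ≤ k) {z : ℝ × ℝ} (hz : |z.1| ≤ 1) :
    density k M z ∈ Icc (1 / 2 : ℝ) (3 / 2) := by
  have := abs_le.1 (hM.abs_density_sub_one_le hk hz)
  constructor <;> linarith

/-- The axial component is the root, which is at least 1, plus a correction. The three terms of the
correction are at most (2k-2)η, 2η and kη, where kη ≤ 1/32; this is why M and θM' must be small
compared with 1/k. -/
theorem half_le_axial (hM : IsBump k ε M) (hk : 3 ≤ k) {z : ℝ × ℝ} (hz : |z.1| ≤ 1) :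
    1 / 2 ≤ axial k M z := by
  have hroot := hM.one_le_root (by omega) hz
  rw [axial, (hM.density_partials hk (mem_strip_of_abs_le_one hz)).1, hM.profileFst_rad]
  set θ := z.2 / z.1 ^ k
  set η : ℝ := 1 / (4 ^ k * (8 * k)) with hη
  have hkr : (3 : ℝ) ≤ k := by exact_mod_cast hk
  have hη0 : 0 ≤ η := by positivity
  have hkη : k * η ≤ 1 / 32 := by
    have h4 : (4 : ℝ) ^ 1 ≤ 4 ^ k := pow_le_pow_right₀ (by norm_num) (by omega)
    have : k * η = 1 / (4 ^ k * 8) := by rw [hη]; field_simp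
    rw [this]
    exact one_div_le_one_div_of_le (by norm_num) (by linarith)
  have h1 := hM.le θ
  have h2 := hM.nonneg θ
  have h3 := hM.abs_deriv_le θ
  have hz2 : z.1 ^ 2 ≤ 1 := by rwa [sq_le_one_iff_abs_le_one]
  have hz0 : 0 ≤ z.1 ^ 2 := sq_nonneg _
  have hcast : (((2 * k - 2 : ℕ) : ℝ)) = 2 * k - 2 := by
    rw [Nat.cast_sub (by omega)]
    push_cast
    ring
  have h6 : ((2 * k - 2 : ℕ) : ℝ) * ((1 - z.1 ^ 2) * M θ) ≤ (2 * k - 2) * (1 * η) := by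
    rw [hcast]
    gcongr <;> linarith
  have h6' : 0 ≤ ((2 * k - 2 : ℕ) : ℝ) * ((1 - z.1 ^ 2) * M θ) :=
    mul_nonneg (Nat.cast_nonneg _) (mul_nonneg (by linarith) h2)
  have h7 : 2 * z.1 ^ 2 * M θ ≤ 2 * 1 * η := by gcongr
  have h7' : 0 ≤ 2 * z.1 ^ 2 * M θ := by positivity
  have h8 : |k * ((1 - z.1 ^ 2) * (θ * deriv M θ))| ≤ k * (1 * η) := by
    rw [abs_mul, abs_mul, Nat.abs_cast, abs_of_nonneg (show 0 ≤ 1 - z.1 ^ 2 by linarith)]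
    gcongr
    linarith
  have h8' := abs_le.1 h8
  set P := ((2 * k - 2 : ℕ) : ℝ) * ((1 - z.1 ^ 2) * M θ) - 2 * z.1 ^ 2 * M θ -
      k * ((1 - z.1 ^ 2) * (θ * deriv M θ)) with hP
  have hPb : |P| ≤ 1 / 8 := by
    rw [abs_le]
    constructor <;> nlinarith
  have h9 : |z.1 ^ (2 * k - 2) * P / (2 * root k M z)| ≤ 1 / 8 := by
    rw [abs_div, abs_mul, abs_pow, abs_of_nonneg (show 0 ≤ 2 * root k M z by linarith)]
    rw [div_le_iff₀ (by linarith)]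
    calc |z.1| ^ (2 * k - 2) * |P| ≤ 1 * (1 / 8) := by
          gcongr
          exact pow_le_one₀ (abs_nonneg _) hz
      _ ≤ _ := by linarith
  have := (abs_le.1 h9).1
  linarith

/-- The axial component in the wedge. -/
theorem axial_eq (hM : IsBump k ε M) (hk : 3 ≤ k) {z : ℝ × ℝ} (hz : |z.1| ≤ 1) (h0 : z.1 ≠ 0)
    (hθ : |z.2 / z.1 ^ k| < ε) :
    axial k M z = (1 - 4 * k * z.2 ^ 2) / root k M z ∧
      (1 + z.1) * densitySnd k M z =
        4 * k * (1 - z.1 ^ 2) * z.2 / (z.1 * root k M z) := by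
  have hs := mem_strip_of_abs_le_one hz
  have hroot := hM.root_pos (by omega) hs
  have hd : deriv M (z.2 / z.1 ^ k) = 8 * k * (z.2 / z.1 ^ k) := by
    have : M =ᶠ[𝓝 (z.2 / z.1 ^ k)] fun θ => 4 * k * θ ^ 2 := by
      have ho : IsOpen {θ : ℝ | |θ| < ε} := isOpen_lt (by fun_prop) continuous_const
      filter_upwards [ho.mem_nhds hθ] with θ h
      exact hM.eq_sq θ (le_of_lt h)
    rw [this.deriv_eq]
    have h1 : HasDerivAt (fun θ : ℝ => 4 * k * θ ^ 2) (4 * k * (2 * (z.2 / z.1 ^ k)))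
        (z.2 / z.1 ^ k) := by
      simpa using (hasDerivAt_pow 2 (z.2 / z.1 ^ k)).const_mul (4 * (k : ℝ))
    rw [h1.deriv]
    ring
  have hm := hM.eq_sq _ hθ.le
  obtain ⟨h1, h2⟩ := hM.density_partials hk hs
  have hsq := hM.root_sq (by omega) hs
  rw [scaled, radProfile, hm] at hsq
  rw [hM.profileFst_rad, hm, hd] at h1
  rw [hd] at h2
  have hcast : (((2 * k - 2 : ℕ) : ℝ)) = 2 * k - 2 := by
    rw [Nat.cast_sub (by omega)]
    push_cast
    ring
  rw [hcast] at h1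
  -- For a quadratic M the exponent k drops out of the radicand, which becomes 1 + 4k(1 - s²)y²/s².
  have hp : z.1 ^ (2 * k - 2) * (z.2 / z.1 ^ k) ^ 2 = z.2 ^ 2 / z.1 ^ 2 := by
    have : z.1 ^ (2 * k - 2) = z.1 ^ k * z.1 ^ k / z.1 ^ 2 := by
      rw [eq_div_iff (pow_ne_zero 2 h0), ← pow_add, ← pow_add]
      congr 1
      omega
    rw [this, div_pow]
    have := pow_ne_zero k h0
    field_simp
  have hp2 : z.1 ^ (k - 1) * (z.2 / z.1 ^ k) = z.2 / z.1 := by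
    have : z.1 ^ k = z.1 ^ (k - 1) * z.1 := by
      rw [← pow_succ]
      congr 1
      omega
    rw [this]
    have := pow_ne_zero (k - 1) h0
    field_simp
  constructor
  · rw [axial, h1]
    -- The bracket (2k - 2)(1 - s²) - 2s² - 2k(1 - s²) collapses to -2, which makes the axial
    -- component a simple quotient.
    have e : z.1 ^ (2 * k - 2) * ((2 * k - 2) * ((1 - z.1 ^ 2) * (4 * k * (z.2 / z.1 ^ k) ^ 2)) -
        2 * z.1 ^ 2 * (4 * k * (z.2 / z.1 ^ k) ^ 2) -
        k * ((1 - z.1 ^ 2) * (z.2 / z.1 ^ k * (8 * k * (z.2 / z.1 ^ k))))) =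
        -8 * k * (z.2 ^ 2 / z.1 ^ 2) := by
      rw [← hp]
      ring
    have hsq' : root k M z ^ 2 = 1 + (1 - z.1 ^ 2) * (4 * k) * (z.2 ^ 2 / z.1 ^ 2) := by
      rw [hsq, ← hp]
      ring
    simp only
    rw [e]
    have e2 : z.1 ^ 2 * (z.2 ^ 2 / z.1 ^ 2) = z.2 ^ 2 := by field_simp
    rw [eq_div_iff hroot.ne', add_mul, div_mul_eq_mul_div,
      mul_div_mul_right _ _ hroot.ne', ← sq, hsq']
    linear_combination (-4 * k) * e2
  · rw [h2]
    have e : z.1 ^ (k - 1) * ((1 - z.1 ^ 2) * (8 * k * (z.2 / z.1 ^ k))) =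
        (1 - z.1 ^ 2) * (8 * k) * (z.2 / z.1) := by
      rw [← hp2]
      ring
    rw [e]
    field_simp
    ring

/-- The squared speed is a scaled profile, up to a constant. -/
theorem exists_speedSq_eq (hM : IsBump k ε M) (hk : 3 ≤ k) :
    ∃ Q, IsProfile Q ∧ ∀ z, speedSq k M z = 1 + scaled k (2 * k - 2) Q z := by
  set q := densityProfile k M with hq
  have hqP : IsProfile q := hM.isProfile_density (by omega)
  set q1 := profileFst k (2 * k - 1) q with hq1
  have hq1P : IsProfile q1 := hqP.profileFst k _
  set q2 := profileSnd q with hq2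
  have hq2P : IsProfile q2 := hqP.profileSnd
  -- The axial component is 1 + s^(2k-2) w. The y-derivative of ϱ has only the factor s^(k-1), but
  -- it enters squared, so both contributions carry the same s^(2k-2).
  set w : ℝ × ℝ → ℝ := fun z => z.1 * q z + (1 + z.1) * q1 z with hw
  have hwP : IsProfile w :=
    (hqP.smooth_mul (φ := fun z => z.1) contDiff_fst.contDiffOn).add
      (hq1P.smooth_mul (φ := fun z => 1 + z.1) (contDiff_const.add contDiff_fst).contDiffOn)
  refine ⟨fun z => (2 + z.1 ^ (2 * k - 2) * w z) * w z + ((1 + z.1) / 4 * q2 z) * q2 z,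
    (hwP.smooth_mul ?_).add (hq2P.smooth_mul ?_), fun z => ?_⟩
  · exact contDiffOn_const.add ((contDiff_fst.pow _).contDiffOn.mul hwP.contDiffOn)
  · exact ((contDiff_const.add contDiff_fst).div_const _).contDiffOn.mul hq2P.contDiffOn
  · have e1 : z.1 ^ (2 * k - 1) = z.1 ^ (2 * k - 2) * z.1 := by
      rw [← pow_succ]
      congr 1
      omega
    have e2 : z.1 ^ (2 * k - 2) = z.1 ^ (k - 1) * z.1 ^ (k - 1) := by
      rw [← pow_add]
      congr 1
      omega
    simp only [speedSq, axial, density, densityFst, densitySnd, scaled]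
    rw [← hq, ← hq1, ← hq2, e1]
    simp only [hw]
    rw [e2]
    ring

theorem speedSq_pos (hM : IsBump k ε M) (hk : 3 ≤ k) {z : ℝ × ℝ} (hz : |z.1| ≤ 1) :
    1 / 4 ≤ speedSq k M z := by
  have h1 := hM.half_le_axial hk hz
  have h2 := (abs_le.1 hz).1
  have h3 : 0 ≤ (1 + z.1) * (densitySnd k M z / 2) ^ 2 := mul_nonneg (by linarith) (sq_nonneg _)
  rw [speedSq]
  nlinarith

/-- The exponent N/2 - 1 is negative for N = 1, so the power of the density is minimized over its
compact range instead of by monotonicity. -/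
theorem exists_planeWeight_ge (hM : IsBump k ε M) (hk : 3 ≤ k) {N : ℕ} (hN : 1 ≤ N) :
    ∃ c : ℝ, 0 < c ∧ ∀ z : ℝ × ℝ, |z.1| ≤ 1 → c ≤ planeWeight N k M z := by
  have hc : ContinuousOn (fun p : ℝ => p ^ ((N : ℝ) / 2 - 1)) (Icc (1 / 2) (3 / 2)) := fun p hp =>
    (Real.continuousAt_rpow_const p _ (Or.inl (by linarith [hp.1]))).continuousWithinAt
  obtain ⟨p, hp, hmin⟩ := isCompact_Icc.exists_isMinOn
    (nonempty_Icc.2 (by norm_num : (1 / 2 : ℝ) ≤ 3 / 2)) hc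
  have hp0 : 0 < p ^ ((N : ℝ) / 2 - 1) := Real.rpow_pos_of_pos (by linarith [hp.1]) _
  refine ⟨p ^ ((N : ℝ) / 2 - 1) * (1 / 2), by positivity, fun z hz => ?_⟩
  have h1 : p ^ ((N : ℝ) / 2 - 1) ≤ density k M z ^ ((N : ℝ) / 2 - 1) :=
    hmin (hM.density_mem (by omega) hz)
  have h2 : 1 / 2 ≤ √(speedSq k M z) := by
    refine Real.le_sqrt_of_sq_le ?_
    have := hM.speedSq_pos hk hz
    linarith
  have hNr : (1 : ℝ) ≤ N := by exact_mod_cast hN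
  calc p ^ ((N : ℝ) / 2 - 1) * (1 / 2) = 1 * p ^ ((N : ℝ) / 2 - 1) * (1 / 2) := by ring
    _ ≤ N * density k M z ^ ((N : ℝ) / 2 - 1) * √(speedSq k M z) := by
      have h3 : 0 ≤ density k M z ^ ((N : ℝ) / 2 - 1) := hp0.le.trans h1
      gcongr

/-- The weight is a smooth function of ϱ - 1 and of the squared speed minus 1, two scaled profiles
of exponent 2k - 2 with values in a compact box where power and square root are smooth. -/
theorem holderC1_planeWeight (hM : IsBump k ε M) (hk : 3 ≤ k) (N : ℕ) {α : ℝ} (hα0 : 0 ≤ α)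
    (hα1 : α ≤ 1) (hkα : k * α ≤ k - 2) :
    HolderC1 α {z : ℝ × ℝ | |z.1| ≤ 1} (planeWeight N k M) := by
  obtain ⟨Q, hQ, hQe⟩ := hM.exists_speedSq_eq hk
  obtain ⟨C, hC0, hC⟩ := hQ.exists_bound
  have hconv : Convex ℝ {z : ℝ × ℝ | |z.1| ≤ 1} := by
    have : {z : ℝ × ℝ | |z.1| ≤ 1} = Prod.fst ⁻¹' Icc (-1 : ℝ) 1 := by
      ext z
      simp [abs_le]
    rw [this]
    exact (convex_Icc (-1 : ℝ) 1).linear_preimage (LinearMap.fst ℝ ℝ ℝ)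
  have hdens : ∀ z, density k M z =
      1 + scaled k (2 * k - 2) (fun z => z.1 ^ 1 * densityProfile k M z) z := by
    intro z
    rw [density, ← scaled_add_exponent, show 2 * k - 2 + 1 = 2 * k - 1 by omega]
  have hP : IsProfile fun z : ℝ × ℝ => z.1 ^ 1 * densityProfile k M z :=
    (hM.isProfile_density (by omega)).smooth_mul (contDiff_fst.pow _).contDiffOn
  have hbox : IsCompact (Icc (-(1 / 2) : ℝ) (1 / 2) ×ˢ Icc (-(3 / 4) : ℝ) C) :=
    isCompact_Icc.prod isCompact_Icc
  have hO : IsOpen (Ioi (-1 : ℝ) ×ˢ Ioi (-1 : ℝ)) := isOpen_Ioi.prod isOpen_Ioi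
  have hΨ : ContDiffOn ℝ 2 (fun p : ℝ × ℝ => N * (1 + p.1) ^ ((N : ℝ) / 2 - 1) * √(1 + p.2))
      (Ioi (-1 : ℝ) ×ˢ Ioi (-1 : ℝ)) := by
    have h1 : ContDiffOn ℝ 2 (fun p : ℝ × ℝ => (1 + p.1) ^ ((N : ℝ) / 2 - 1))
        (Ioi (-1 : ℝ) ×ˢ Ioi (-1 : ℝ)) :=
      (contDiff_const.add contDiff_fst).contDiffOn.rpow_const_of_ne fun p hp => by
        have : -1 < p.1 := hp.1
        change 1 + p.1 ≠ 0
        linarith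
    have h2 : ContDiffOn ℝ 2 (fun p : ℝ × ℝ => √(1 + p.2)) (Ioi (-1 : ℝ) ×ˢ Ioi (-1 : ℝ)) :=
      (contDiff_const.add contDiff_snd).contDiffOn.sqrt fun p hp => by
        have : -1 < p.2 := hp.2
        change 1 + p.2 ≠ 0
        linarith
    exact (contDiffOn_const.mul h1).mul h2
  have h1 := HolderC1.of_contDiffOn hα1 ((convex_Icc (-(1 / 2) : ℝ) (1 / 2)).prod
    (convex_Icc (-(3 / 4) : ℝ) C)) hbox hO (fun p hp => ⟨by
      have := hp.1.1
      change -1 < p.1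
      linarith, by
      have := hp.2.1
      change -1 < p.2
      linarith⟩) hΨ
  have h2 := h1.comp hα0 hconv ((holderC1_scaled hP hk hα0 hα1 hkα).prodMk
    (holderC1_scaled hQ hk hα0 hα1 hkα)) fun z hz => by
      have hz : |z.1| ≤ 1 := hz
      have e1 := hM.density_mem (by omega) hz
      rw [hdens] at e1
      have e2 := hM.speedSq_pos hk hz
      rw [hQe] at e2
      have e3 := (le_abs_self _).trans (abs_scaled_le hC k (2 * k - 2) (z := z) (by linarith))
      refine ⟨⟨?_, ?_⟩, ⟨?_, e3.trans ?_⟩⟩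
      · linarith [e1.1]
      · linarith [e1.2]
      · linarith
      · exact mul_le_of_le_one_right hC0 (pow_le_one₀ (abs_nonneg _) hz)
  convert! h2 using 1
  ext z
  rw [planeWeight, hdens, hQe]

end IsBump

end LeastGradient

/-! ### Divergence free fields with rotational symmetry -/

namespace LeastGradient

theorem divergence_sub {n : ℕ} {Y Z : EuclideanSpace ℝ (Fin n) → EuclideanSpace ℝ (Fin n)}
    {x : EuclideanSpace ℝ (Fin n)} (hY : DifferentiableAt ℝ Y x) (hZ : DifferentiableAt ℝ Z x) :
    divergence (fun z => Y z - Z z) x = divergence Y x - divergence Z x := by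
  unfold divergence
  rw [fderiv_fun_sub hY hZ, ← Finset.sum_sub_distrib]
  rfl

variable {N : ℕ}

/-- The first unit vector. -/
noncomputable def axis (N : ℕ) : EuclideanSpace ℝ (Fin (N + 1)) := EuclideanSpace.single 0 1

/-- The projection to the orthogonal complement of the first unit vector. -/
noncomputable def transverse (N : ℕ) :
    EuclideanSpace ℝ (Fin (N + 1)) →L[ℝ] EuclideanSpace ℝ (Fin (N + 1)) :=
  ContinuousLinearMap.id ℝ _ -
    (EuclideanSpace.proj 0 : EuclideanSpace ℝ (Fin (N + 1)) →L[ℝ] ℝ).smulRight (axis N)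

theorem transverse_apply (x : EuclideanSpace ℝ (Fin (N + 1))) :
    transverse N x = x - x 0 • axis N := rfl

theorem axis_zero : axis N 0 = 1 := by simp [axis]

theorem norm_axis : ‖axis N‖ = 1 := by simp [axis]

theorem inner_axis (x : EuclideanSpace ℝ (Fin (N + 1))) : inner ℝ (axis N) x = x 0 := by
  simp [axis, EuclideanSpace.inner_single_left]

theorem transverse_axis : transverse N (axis N) = 0 := by
  rw [transverse_apply, axis_zero, one_smul, sub_self]

theorem inner_axis_transverse (x : EuclideanSpace ℝ (Fin (N + 1))) :
    inner ℝ (axis N) (transverse N x) = 0 := by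
  rw [inner_axis, transverse_apply]
  simp [axis_zero]

theorem norm_transverse_sq (x : EuclideanSpace ℝ (Fin (N + 1))) :
    ‖transverse N x‖ ^ 2 = ‖x‖ ^ 2 - x 0 ^ 2 := by
  rw [transverse_apply, norm_sub_sq_real, inner_smul_right, real_inner_comm, inner_axis, norm_smul,
    norm_axis, Real.norm_eq_abs, mul_one, sq_abs]
  ring

theorem divergence_const {n : ℕ} (c x : EuclideanSpace ℝ (Fin n)) :
    divergence (fun _ => c) x = 0 := by
  simp [divergence]

theorem divergence_transverse (x : EuclideanSpace ℝ (Fin (N + 1))) :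
    divergence (transverse N) x = N := by
  unfold divergence
  rw [ContinuousLinearMap.fderiv, Fin.sum_univ_succ]
  simp [transverse_apply, axis]

/-- The divergence free field with potential `K`. -/
noncomputable def rotationField (K : EuclideanSpace ℝ (Fin (N + 1)) → ℝ)
    (x : EuclideanSpace ℝ (Fin (N + 1))) : EuclideanSpace ℝ (Fin (N + 1)) :=
  (N * K x + fderiv ℝ K x (transverse N x)) • axis N - fderiv ℝ K x (axis N) • transverse N x

theorem contDiffOn_rotationField {Ω : Set (EuclideanSpace ℝ (Fin (N + 1)))} (hΩ : IsOpen Ω)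
    {K : EuclideanSpace ℝ (Fin (N + 1)) → ℝ} (hK : ContDiffOn ℝ ∞ K Ω) :
    ContDiffOn ℝ ∞ (rotationField K) Ω := by
  have hd : ContDiffOn ℝ ∞ (fderiv ℝ K) Ω := hK.fderiv_of_isOpen hΩ (by simp)
  have ht : ContDiffOn ℝ ∞ (transverse N) Ω := (transverse N).contDiff.contDiffOn
  exact (((contDiffOn_const.mul hK).add (hd.clm_apply ht)).smul contDiffOn_const).sub
    ((hd.clm_apply contDiffOn_const).smul ht)

/-- The term N ∂₀K cancels against ∂₀K times the divergence N of x', and the second order terms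
cancel by symmetry of the second derivative. -/
theorem divergence_rotationField {Ω : Set (EuclideanSpace ℝ (Fin (N + 1)))} (hΩ : IsOpen Ω)
    {K : EuclideanSpace ℝ (Fin (N + 1)) → ℝ} (hK : ContDiffOn ℝ ∞ K Ω)
    {x : EuclideanSpace ℝ (Fin (N + 1))} (hx : x ∈ Ω) : divergence (rotationField K) x = 0 := by
  have hKx : ContDiffAt ℝ ∞ K x := hK.contDiffAt (hΩ.mem_nhds hx)
  have hd : ContDiffAt ℝ ∞ (fderiv ℝ K) x :=
    (hK.fderiv_of_isOpen hΩ (by simp)).contDiffAt (hΩ.mem_nhds hx)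
  have h1 : HasFDerivAt K (fderiv ℝ K x) x := (hKx.differentiableAt (by simp)).hasFDerivAt
  have h2 : HasFDerivAt (fderiv ℝ K) (fderiv ℝ (fderiv ℝ K) x) x :=
    (hd.differentiableAt (by simp)).hasFDerivAt
  have ht : HasFDerivAt (transverse N) (transverse N) x := (transverse N).hasFDerivAt
  have h3 := (h1.const_mul (N : ℝ)).add (h2.clm_apply ht)
  have h4 := h2.clm_apply (hasFDerivAt_const (axis N) x)
  have d1 : DifferentiableAt ℝ (fun z => N * K z + fderiv ℝ K z (transverse N z)) x :=
    h3.differentiableAt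
  have d2 : DifferentiableAt ℝ (fun z => fderiv ℝ K z (axis N)) x := h4.differentiableAt
  have f1 : fderiv ℝ (fun z => N * K z + fderiv ℝ K z (transverse N z)) x = _ := h3.fderiv
  have f2 : fderiv ℝ (fun z => fderiv ℝ K z (axis N)) x = _ := h4.fderiv
  have hsymm := (hKx.isSymmSndFDerivAt (by
    simp only [minSmoothness_of_isRCLikeNormedField]
    exact WithTop.coe_le_coe.2 le_top)).eq (axis N) (transverse N x)
  refine (divergence_sub (Y := fun z => (N * K z + fderiv ℝ K z (transverse N z)) • axis N)
    (Z := fun z => fderiv ℝ K z (axis N) • transverse N z) (d1.smul_const _)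
    (d2.smul ht.differentiableAt)).trans ?_
  rw [divergence_smul d1 (differentiableAt_const _), divergence_smul d2 ht.differentiableAt,
    divergence_const, divergence_transverse, f1, f2]
  simp only [add_apply, smul_apply, ContinuousLinearMap.comp_apply,
    ContinuousLinearMap.flip_apply, transverse_axis, map_zero, smul_eq_mul, zero_apply,
    hsymm]
  ring

/-- The coordinates `s = |x'|² - 1` and `y = x₀`. -/
noncomputable def planeMap (N : ℕ) (x : EuclideanSpace ℝ (Fin (N + 1))) : ℝ × ℝ :=
  (‖x‖ ^ 2 - x 0 ^ 2 - 1, x 0)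

theorem contDiff_coord_zero {m : WithTop ℕ∞} :
    ContDiff ℝ m fun x : EuclideanSpace ℝ (Fin (N + 1)) => x 0 :=
  (EuclideanSpace.proj 0 : EuclideanSpace ℝ (Fin (N + 1)) →L[ℝ] ℝ).contDiff

theorem contDiff_planeMap {m : WithTop ℕ∞} : ContDiff ℝ m (planeMap N) :=
  (((contDiff_norm_sq ℝ).sub (contDiff_coord_zero.pow 2)).sub contDiff_const).prodMk
    contDiff_coord_zero

theorem hasFDerivAt_coord_zero (x : EuclideanSpace ℝ (Fin (N + 1))) :
    HasFDerivAt (fun x : EuclideanSpace ℝ (Fin (N + 1)) => x 0) (innerSL ℝ (axis N)) x := by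
  refine (EuclideanSpace.proj 0 : EuclideanSpace ℝ (Fin (N + 1)) →L[ℝ] ℝ).hasFDerivAt.congr_fderiv ?_
  ext w
  simp [inner_axis]

theorem hasFDerivAt_planeMap_fst (x : EuclideanSpace ℝ (Fin (N + 1))) :
    HasFDerivAt (fun x => (planeMap N x).1) (innerSL ℝ ((2 : ℝ) • transverse N x)) x := by
  refine (((hasStrictFDerivAt_norm_sq x).hasFDerivAt.sub
    ((hasFDerivAt_coord_zero x).pow 2)).sub_const 1).congr_fderiv ?_
  ext w
  simp [transverse_apply]
  ring

theorem one_add_planeMap_fst (x : EuclideanSpace ℝ (Fin (N + 1))) :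
    1 + (planeMap N x).1 = ‖transverse N x‖ ^ 2 := by
  rw [norm_transverse_sq, planeMap]
  ring

/-- The radius 5/4 exceeds 1, so that the singular sphere lies inside, and its square is below 2,
which keeps s in the range of the profile estimates. -/
theorem abs_planeMap_fst_le {x : EuclideanSpace ℝ (Fin (N + 1))} (hx : ‖x‖ ≤ 5 / 4) :
    |(planeMap N x).1| ≤ 1 := by
  have h1 := one_add_planeMap_fst x
  have h2 := sq_nonneg ‖transverse N x‖
  have h3 := norm_transverse_sq x
  rw [abs_le]
  refine ⟨by linarith, ?_⟩
  nlinarith [norm_nonneg x, sq_nonneg (x 0)]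

/-- The field of the density `r` with partial derivatives `r1` and `r2`. -/
noncomputable def planeField (N : ℕ) (r r1 r2 : ℝ × ℝ → ℝ) (x : EuclideanSpace ℝ (Fin (N + 1))) :
    EuclideanSpace ℝ (Fin (N + 1)) :=
  (N * r (planeMap N x) ^ ((N : ℝ) / 2 - 1)) •
    ((r (planeMap N x) + (1 + (planeMap N x).1) * r1 (planeMap N x)) • axis N -
      (r2 (planeMap N x) / 2) • transverse N x)

theorem hasFDerivAt_comp_planeMap {r : ℝ × ℝ → ℝ} {a b : ℝ} {x : EuclideanSpace ℝ (Fin (N + 1))}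
    (hr : HasFDerivAt r (a • ContinuousLinearMap.fst ℝ ℝ ℝ + b • ContinuousLinearMap.snd ℝ ℝ ℝ)
      (planeMap N x)) :
    HasFDerivAt (fun x => r (planeMap N x))
      (innerSL ℝ ((2 * a) • transverse N x + b • axis N)) x := by
  have hπ : HasFDerivAt (planeMap N) _ x :=
    (hasFDerivAt_planeMap_fst x).prodMk (hasFDerivAt_coord_zero x)
  refine (hr.comp x hπ).congr_fderiv ?_
  ext w
  simp
  ring

/-- On functions of s and y the operator x'·∇ is 2(1 + s)∂_s. With the exponent N/2 all terms share
the factor N r^(N/2-1), and the bracket becomes linear in r and its derivatives. -/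
theorem rotationField_comp_planeMap {r r1 r2 : ℝ × ℝ → ℝ} {x : EuclideanSpace ℝ (Fin (N + 1))}
    (hr : HasFDerivAt r (r1 (planeMap N x) • ContinuousLinearMap.fst ℝ ℝ ℝ +
      r2 (planeMap N x) • ContinuousLinearMap.snd ℝ ℝ ℝ) (planeMap N x))
    (h0 : 0 < r (planeMap N x)) :
    rotationField (fun x => r (planeMap N x) ^ ((N : ℝ) / 2)) x = planeField N r r1 r2 x := by
  have h := (hasFDerivAt_comp_planeMap hr).rpow_const (p := (N : ℝ) / 2) (Or.inl h0.ne')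
  have hp : r (planeMap N x) ^ ((N : ℝ) / 2) =
      r (planeMap N x) ^ ((N : ℝ) / 2 - 1) * r (planeMap N x) := by
    rw [← Real.rpow_add_one h0.ne']
    congr 1
    ring
  have h1 := one_add_planeMap_fst x
  rw [rotationField, h.fderiv, planeField, hp, h1, smul_sub, smul_smul, smul_smul]
  congr 2
  · simp only [smul_apply, innerSL_apply_apply, inner_add_left, inner_smul_left,
      inner_axis_transverse, real_inner_self_eq_norm_sq, smul_eq_mul, conj_trivial]
    ring
  · simp only [smul_apply, innerSL_apply_apply, inner_add_left, inner_smul_left,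
      real_inner_comm _ (transverse N x),
      inner_axis_transverse, real_inner_self_eq_norm_sq, smul_eq_mul, conj_trivial, norm_axis]
    ring

theorem norm_planeField_sq (r r1 r2 : ℝ × ℝ → ℝ) (x : EuclideanSpace ℝ (Fin (N + 1))) :
    ‖(r (planeMap N x) + (1 + (planeMap N x).1) * r1 (planeMap N x)) • axis N -
      (r2 (planeMap N x) / 2) • transverse N x‖ ^ 2 =
    (r (planeMap N x) + (1 + (planeMap N x).1) * r1 (planeMap N x)) ^ 2 +
      (1 + (planeMap N x).1) * (r2 (planeMap N x) / 2) ^ 2 := by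
  rw [norm_sub_sq_real, inner_smul_left, inner_smul_right, inner_axis_transverse, norm_smul,
    norm_smul, norm_axis, one_add_planeMap_fst, mul_pow, mul_pow, Real.norm_eq_abs,
    Real.norm_eq_abs, sq_abs, sq_abs]
  simp
  ring

end LeastGradient

/-! ### Smooth approximation of the calibrating field -/

namespace LeastGradient

/-- A cutoff that vanishes for `(j + 1) |s| ≤ 1`. -/
noncomputable def slabCutoff (j : ℕ) (s : ℝ) : ℝ :=
  Real.smoothTransition ((j + 1) ^ 2 * s ^ 2 - 1)

/-- The derivative of the cutoff. -/
noncomputable def slabCutoffDeriv (j : ℕ) (s : ℝ) : ℝ :=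
  deriv Real.smoothTransition ((j + 1) ^ 2 * s ^ 2 - 1) * ((j + 1) ^ 2 * (2 * s))

theorem hasDerivAt_slabCutoff (j : ℕ) (s : ℝ) :
    HasDerivAt (slabCutoff j) (slabCutoffDeriv j s) s := by
  have h : HasDerivAt (fun s : ℝ => (j + 1) ^ 2 * s ^ 2 - 1) (((j : ℝ) + 1) ^ 2 * (2 * s)) s := by
    simpa using ((hasDerivAt_pow 2 s).const_mul (((j : ℝ) + 1) ^ 2)).sub_const 1
  exact (hasDerivAt_smoothTransition _).comp s h

theorem contDiff_slabCutoff (j : ℕ) : ContDiff ℝ ∞ (slabCutoff j) :=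
  Real.smoothTransition.contDiff.comp ((contDiff_const.mul (contDiff_id.pow 2)).sub contDiff_const)

theorem slabCutoff_eq_zero {j : ℕ} {s : ℝ} (h : (j + 1) ^ 2 * s ^ 2 ≤ 1) : slabCutoff j s = 0 :=
  Real.smoothTransition.zero_of_nonpos (by linarith)

theorem slabCutoff_eq_one {j : ℕ} {s : ℝ} (h : 2 ≤ (j + 1) ^ 2 * s ^ 2) : slabCutoff j s = 1 :=
  Real.smoothTransition.one_of_one_le (by linarith)

theorem slabCutoffDeriv_eq_zero {j : ℕ} {s : ℝ} (h : 2 < (j + 1) ^ 2 * s ^ 2) :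
    slabCutoffDeriv j s = 0 := by
  rw [slabCutoffDeriv, deriv_smoothTransition_eq_zero (Or.inr (by linarith)), zero_mul]

/-- The cutoff at scale 1/(j + 1) has slope of order j + 1, but only where |s| is of order 1/(j +
1). This bounds the fields uniformly, as ϱ - 1 = O(s). -/
theorem abs_slabCutoffDeriv_mul_le {C : ℝ} (hC : ∀ t, |deriv Real.smoothTransition t| ≤ C) (j : ℕ)
    (s : ℝ) : |slabCutoffDeriv j s| * |s| ≤ 4 * C := by
  have hC0 : 0 ≤ C := (abs_nonneg _).trans (hC 0)
  by_cases h : 2 < ((j : ℝ) + 1) ^ 2 * s ^ 2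
  · rw [slabCutoffDeriv_eq_zero h, abs_zero, zero_mul]
    positivity
  · push Not at h
    have e : slabCutoffDeriv j s * s =
        deriv Real.smoothTransition ((j + 1) ^ 2 * s ^ 2 - 1) * (2 * ((j + 1) ^ 2 * s ^ 2)) := by
      rw [slabCutoffDeriv]
      ring
    rw [← abs_mul, e, abs_mul, abs_of_nonneg (show 0 ≤ 2 * (((j : ℝ) + 1) ^ 2 * s ^ 2) by positivity)]
    calc _ ≤ C * (2 * 2) := by
          gcongr
          exact hC _
      _ = 4 * C := by ring

theorem eventually_two_lt {s : ℝ} (hs : s ≠ 0) : ∀ᶠ j : ℕ in atTop, 2 < ((j : ℝ) + 1) ^ 2 * s ^ 2 := by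
  have h1 : Tendsto (fun j : ℕ => ((j : ℝ) + 1) ^ 2 * s ^ 2) atTop atTop :=
    Tendsto.atTop_mul_const (by positivity) ((tendsto_pow_atTop two_ne_zero).comp
      (tendsto_natCast_atTop_atTop.atTop_add tendsto_const_nhds))
  exact h1.eventually_gt_atTop 2

variable {k : ℕ} {ε : ℝ} {M : ℝ → ℝ}

/-- Smooth approximations of the density. -/
noncomputable def smoothDensity (k : ℕ) (M : ℝ → ℝ) (j : ℕ) (z : ℝ × ℝ) : ℝ :=
  1 + slabCutoff j z.1 * (density k M z - 1)

/-- The partial derivative of `smoothDensity` in the first direction. -/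
noncomputable def smoothDensityFst (k : ℕ) (M : ℝ → ℝ) (j : ℕ) (z : ℝ × ℝ) : ℝ :=
  slabCutoffDeriv j z.1 * (density k M z - 1) + slabCutoff j z.1 * densityFst k M z

/-- The partial derivative of `smoothDensity` in the second direction. -/
noncomputable def smoothDensitySnd (k : ℕ) (M : ℝ → ℝ) (j : ℕ) (z : ℝ × ℝ) : ℝ :=
  slabCutoff j z.1 * densitySnd k M z

theorem IsProfile.contDiffAt_scaled {Q : ℝ × ℝ → ℝ} (hQ : IsProfile Q) (k m : ℕ) {z : ℝ × ℝ}
    (hz : z ∈ strip) (h0 : z.1 ≠ 0) : ContDiffAt ℝ ∞ (scaled k m Q) z := by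
  have h1 : ContDiffAt ℝ ∞ (fun z : ℝ × ℝ => (z.1, z.2 / z.1 ^ k)) z :=
    contDiffAt_fst.prodMk (contDiffAt_snd.div (contDiffAt_fst.pow k) (pow_ne_zero k h0))
  have h2 : ContDiffAt ℝ ∞ Q (z.1, z.2 / z.1 ^ k) :=
    hQ.contDiffOn.contDiffAt (isOpen_strip.mem_nhds hz)
  exact (contDiffAt_fst.pow m).mul (h2.comp z h1)

theorem scaled_eq_zero {m : ℕ} (hm : m ≠ 0) (k : ℕ) (Q : ℝ × ℝ → ℝ) {z : ℝ × ℝ} (hz : z.1 = 0) :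
    scaled k m Q z = 0 := by
  rw [scaled, hz, zero_pow hm, zero_mul]

namespace IsBump

theorem contDiffOn_smoothDensity (hM : IsBump k ε M) (hk : 1 ≤ k) (j : ℕ) :
    ContDiffOn ℝ ∞ (smoothDensity k M j) strip := by
  intro z hz
  refine ContDiffAt.contDiffWithinAt ?_
  by_cases h0 : z.1 = 0
  · have : smoothDensity k M j =ᶠ[𝓝 z] fun _ => 1 := by
      have ho : IsOpen {w : ℝ × ℝ | ((j : ℝ) + 1) ^ 2 * w.1 ^ 2 < 1} :=
        isOpen_lt (by fun_prop) continuous_const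
      filter_upwards [ho.mem_nhds (show ((j : ℝ) + 1) ^ 2 * z.1 ^ 2 < 1 by rw [h0]; norm_num)]
        with w hw
      rw [smoothDensity, slabCutoff_eq_zero (le_of_lt hw), zero_mul, add_zero]
    exact contDiffAt_const.congr_of_eventuallyEq this
  · exact contDiffAt_const.add (((contDiff_slabCutoff j).contDiffAt.comp z contDiffAt_fst).mul
      ((contDiffAt_const.add ((hM.isProfile_density hk).contDiffAt_scaled k _ hz h0)).sub
        contDiffAt_const))

theorem hasFDerivAt_smoothDensity (hM : IsBump k ε M) (hk : 2 ≤ k) (j : ℕ) {z : ℝ × ℝ}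
    (hz : z ∈ strip) :
    HasFDerivAt (smoothDensity k M j) (smoothDensityFst k M j z • ContinuousLinearMap.fst ℝ ℝ ℝ +
      smoothDensitySnd k M j z • ContinuousLinearMap.snd ℝ ℝ ℝ) z := by
  have h1 : HasFDerivAt (fun z : ℝ × ℝ => z.1) (ContinuousLinearMap.fst ℝ ℝ ℝ) z := hasFDerivAt_fst
  have h2 := (hasDerivAt_slabCutoff j z.1).comp_hasFDerivAt z h1
  refine ((h2.mul ((hM.hasFDerivAt_density hk hz).sub_const 1)).const_add 1).congr_fderiv ?_
  ext <;> simp [smoothDensityFst, smoothDensitySnd]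
  ring

theorem smoothDensity_mem (hM : IsBump k ε M) (hk : 1 ≤ k) (j : ℕ) {z : ℝ × ℝ} (hz : |z.1| ≤ 1) :
    smoothDensity k M j z ∈ Icc (1 / 2 : ℝ) (3 / 2) := by
  have h1 := hM.abs_density_sub_one_le hk hz
  have h2 : |slabCutoff j z.1| ≤ 1 := by
    rw [slabCutoff, abs_of_nonneg (Real.smoothTransition.nonneg _)]
    exact Real.smoothTransition.le_one _
  have h3 : |slabCutoff j z.1 * (density k M z - 1)| ≤ 1 * (1 / 2) := by
    rw [abs_mul]
    gcongr
  have h4 := abs_le.1 h3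
  rw [smoothDensity]
  constructor <;> linarith

theorem exists_bound_smoothDensity_partials (hM : IsBump k ε M) (hk : 2 ≤ k) :
    ∃ C, ∀ j, ∀ z : ℝ × ℝ, |z.1| ≤ 1 →
      |smoothDensityFst k M j z| ≤ C ∧ |smoothDensitySnd k M j z| ≤ C := by
  obtain ⟨C, hC0, hC⟩ := exists_bound_deriv_smoothTransition
  have hP := hM.isProfile_density (k := k) (by omega)
  obtain ⟨C0, hC00, hC0⟩ := hP.exists_bound
  obtain ⟨C1, hC10, hC1⟩ := (hP.profileFst k (2 * k - 1)).exists_bound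
  obtain ⟨C2, hC20, hC2⟩ := hP.profileSnd.exists_bound
  refine ⟨4 * C * C0 + C1 + C2, fun j z hz => ?_⟩
  have hz' : |z.1| ≤ 3 / 2 := by linarith
  have h1 : |slabCutoff j z.1| ≤ 1 := by
    rw [slabCutoff, abs_of_nonneg (Real.smoothTransition.nonneg _)]
    exact Real.smoothTransition.le_one _
  have h2 : |densityFst k M z| ≤ C1 := (abs_scaled_le hC1 k _ hz').trans
    (mul_le_of_le_one_right hC10 (pow_le_one₀ (abs_nonneg _) hz))
  have h3 : |densitySnd k M z| ≤ C2 := (abs_scaled_le hC2 k _ hz').trans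
    (mul_le_of_le_one_right hC20 (pow_le_one₀ (abs_nonneg _) hz))
  have h4 : |density k M z - 1| ≤ C0 * |z.1| := by
    rw [density, add_sub_cancel_left]
    refine (abs_scaled_le hC0 k _ hz').trans ?_
    gcongr
    exact pow_le_of_le_one (abs_nonneg _) hz (by omega)
  have h5 : |slabCutoffDeriv j z.1 * (density k M z - 1)| ≤ 4 * C * C0 := by
    rw [abs_mul]
    calc |slabCutoffDeriv j z.1| * |density k M z - 1|
        ≤ |slabCutoffDeriv j z.1| * (C0 * |z.1|) := by gcongr
      _ = (|slabCutoffDeriv j z.1| * |z.1|) * C0 := by ring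
      _ ≤ 4 * C * C0 := mul_le_mul_of_nonneg_right (abs_slabCutoffDeriv_mul_le hC j z.1) hC00
  constructor
  · refine (abs_add_le _ _).trans ?_
    rw [abs_mul (slabCutoff j z.1)]
    have h6 : |slabCutoff j z.1| * |densityFst k M z| ≤ 1 * C1 := by gcongr
    linarith
  · rw [smoothDensitySnd, abs_mul]
    have h6 : |slabCutoff j z.1| * |densitySnd k M z| ≤ 1 * C2 := by gcongr
    have : 0 ≤ 4 * C * C0 := by positivity
    linarith

/-- Off s = 0 the cutoff is eventually 1, and on s = 0 all quantities it multiplies vanish.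
Convergence is therefore pointwise stationary everywhere, which matters because |Dv| may charge {s =
0}. -/
theorem eventually_smoothDensity_eq (hk : 2 ≤ k) (z : ℝ × ℝ) :
    ∀ᶠ j in atTop, smoothDensity k M j z = density k M z ∧
      smoothDensityFst k M j z = densityFst k M z ∧
      smoothDensitySnd k M j z = densitySnd k M z := by
  by_cases h0 : z.1 = 0
  · refine Eventually.of_forall fun j => ?_
    have e0 : density k M z - 1 = 0 := by
      rw [density, add_sub_cancel_left, scaled_eq_zero (by omega) _ _ h0]
    have e1 : densityFst k M z = 0 := scaled_eq_zero (by omega) _ _ h0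
    have e2 : densitySnd k M z = 0 := scaled_eq_zero (by omega) _ _ h0
    refine ⟨?_, ?_, ?_⟩
    · rw [smoothDensity, e0]
      linarith
    · rw [smoothDensityFst, e0, e1, mul_zero, mul_zero, add_zero]
    · rw [smoothDensitySnd, e2, mul_zero]
  · filter_upwards [eventually_two_lt h0] with j hj
    have e1 := slabCutoff_eq_one hj.le
    refine ⟨?_, ?_, ?_⟩
    · rw [smoothDensity, e1]
      ring
    · rw [smoothDensityFst, e1, slabCutoffDeriv_eq_zero hj]
      ring
    · rw [smoothDensitySnd, e1, one_mul]

end IsBump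

variable {N : ℕ}

/-- The calibrating field. -/
noncomputable def calibration (N k : ℕ) (M : ℝ → ℝ) :
    EuclideanSpace ℝ (Fin (N + 1)) → EuclideanSpace ℝ (Fin (N + 1)) :=
  planeField N (density k M) (densityFst k M) (densitySnd k M)

/-- Smooth divergence free approximations of the calibrating field. -/
noncomputable def smoothCalibration (N k : ℕ) (M : ℝ → ℝ) (j : ℕ) :
    EuclideanSpace ℝ (Fin (N + 1)) → EuclideanSpace ℝ (Fin (N + 1)) :=
  rotationField fun x => smoothDensity k M j (planeMap N x) ^ ((N : ℝ) / 2)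

namespace IsBump

theorem norm_calibration (hM : IsBump k ε M) (hk : 3 ≤ k) {x : EuclideanSpace ℝ (Fin (N + 1))}
    (hx : ‖x‖ ≤ 5 / 4) : ‖calibration N k M x‖ = planeWeight N k M (planeMap N x) := by
  have hz := abs_planeMap_fst_le hx
  have h1 := (hM.density_mem (by omega) hz).1
  have h2 : 0 ≤ density k M (planeMap N x) ^ ((N : ℝ) / 2 - 1) := Real.rpow_nonneg (by linarith) _
  rw [calibration, planeField, norm_smul, planeWeight, Real.norm_eq_abs,
    abs_of_nonneg (by positivity)]
  congr 1
  rw [eq_comm, Real.sqrt_eq_iff_eq_sq (by linarith [hM.speedSq_pos hk hz]) (norm_nonneg _),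
    norm_planeField_sq]
  rfl

theorem contDiffOn_potential (hM : IsBump k ε M) (hk : 1 ≤ k) (j : ℕ) :
    ContDiffOn ℝ ∞ (fun x => smoothDensity k M j (planeMap N x) ^ ((N : ℝ) / 2))
      (Metric.ball 0 (5 / 4)) := by
  have hb : ∀ x ∈ Metric.ball (0 : EuclideanSpace ℝ (Fin (N + 1))) (5 / 4),
      |(planeMap N x).1| ≤ 1 := fun x hx =>
    abs_planeMap_fst_le (mem_ball_zero_iff.1 hx).le
  refine ContDiffOn.rpow_const_of_ne ((hM.contDiffOn_smoothDensity hk j).comp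
    contDiff_planeMap.contDiffOn fun x hx => mem_strip_of_abs_le_one (hb x hx)) fun x hx => ?_
  have := (hM.smoothDensity_mem hk j (hb x hx)).1
  change smoothDensity k M j (planeMap N x) ≠ 0
  linarith

theorem smoothCalibration_eq (hM : IsBump k ε M) (hk : 2 ≤ k) (j : ℕ)
    {x : EuclideanSpace ℝ (Fin (N + 1))} (hx : ‖x‖ ≤ 5 / 4) :
    smoothCalibration N k M j x = planeField N (smoothDensity k M j) (smoothDensityFst k M j)
      (smoothDensitySnd k M j) x := by
  have hz := abs_planeMap_fst_le hx
  refine rotationField_comp_planeMap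
    (hM.hasFDerivAt_smoothDensity hk j (mem_strip_of_abs_le_one hz)) ?_
  linarith [(hM.smoothDensity_mem (by omega) j hz).1]

theorem tendsto_smoothCalibration (hM : IsBump k ε M) (hk : 2 ≤ k)
    {x : EuclideanSpace ℝ (Fin (N + 1))} (hx : ‖x‖ ≤ 5 / 4) :
    Tendsto (fun j => smoothCalibration N k M j x) atTop (𝓝 (calibration N k M x)) := by
  refine tendsto_const_nhds.congr' ?_
  filter_upwards [eventually_smoothDensity_eq hk (planeMap N x)] with j hj
  rw [hM.smoothCalibration_eq hk j hx, planeField, hj.1, hj.2.1, hj.2.2]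
  rfl

theorem exists_bound_smoothCalibration (hM : IsBump k ε M) (hk : 2 ≤ k) :
    ∃ C, ∀ j, ∀ x : EuclideanSpace ℝ (Fin (N + 1)), ‖x‖ ≤ 5 / 4 →
      ‖smoothCalibration N k M j x‖ ≤ C := by
  obtain ⟨C, hC⟩ := hM.exists_bound_smoothDensity_partials hk
  have hc : ContinuousOn (fun p : ℝ => p ^ ((N : ℝ) / 2 - 1)) (Icc (1 / 2) (3 / 2)) := fun p hp =>
    (Real.continuousAt_rpow_const p _ (Or.inl (by linarith [hp.1]))).continuousWithinAt
  obtain ⟨P, hP⟩ := isCompact_Icc.exists_bound_of_continuousOn hc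
  have hP0 : 0 ≤ P := (norm_nonneg _).trans (hP 1 (by norm_num))
  refine ⟨N * P * ((3 / 2 + 2 * C) + (C / 2) * (5 / 4)), fun j x hx => ?_⟩
  have hz := abs_planeMap_fst_le hx
  have hm := hM.smoothDensity_mem (by omega) j hz
  obtain ⟨h1, h2⟩ := hC j _ hz
  have hC0 : 0 ≤ C := (abs_nonneg _).trans h1
  have ht : ‖transverse N x‖ ≤ 5 / 4 := by
    refine le_trans ?_ hx
    refine le_of_sq_le_sq ?_ (norm_nonneg _)
    rw [norm_transverse_sq]
    linarith [sq_nonneg (x 0)]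
  rw [hM.smoothCalibration_eq hk j hx, planeField, norm_smul, norm_mul, Real.norm_natCast]
  have h3 : |1 + (planeMap N x).1| ≤ 2 := (abs_add_le _ _).trans (by rw [abs_one]; linarith)
  have h4 : |smoothDensity k M j (planeMap N x)| ≤ 3 / 2 := by
    rw [abs_of_nonneg (by linarith [hm.1])]
    exact hm.2
  gcongr
  · exact hP _ hm
  · refine (norm_sub_le _ _).trans ?_
    rw [norm_smul, norm_smul, norm_axis, mul_one, Real.norm_eq_abs, Real.norm_eq_abs, abs_div,
      abs_two]
    gcongr
    refine (abs_add_le _ _).trans ?_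
    rw [abs_mul]
    gcongr

end IsBump

end LeastGradient

/-! ### The competitors -/

namespace LeastGradient

/-- Convex combination of two monotone transitions from `0` to `1` in `[-δ, δ]`. -/
noncomputable def transition (δ b t : ℝ) : ℝ :=
  (1 - b) * Real.smoothTransition (t / δ) + b * Real.smoothTransition (t / δ + 1)

/-- The derivative of `transition`. -/
noncomputable def transitionDeriv (δ b t : ℝ) : ℝ :=
  (1 - b) * (deriv Real.smoothTransition (t / δ) / δ) +
    b * (deriv Real.smoothTransition (t / δ + 1) / δ)

theorem hasDerivAt_transition (δ b t : ℝ) :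
    HasDerivAt (transition δ b) (transitionDeriv δ b t) t := by
  have h1 : HasDerivAt (fun t : ℝ => t / δ) (1 / δ) t := (hasDerivAt_id t).div_const δ
  have h2 := ((hasDerivAt_smoothTransition _).comp t h1).const_mul (1 - b)
  have h3 := ((hasDerivAt_smoothTransition _).comp t (h1.add_const 1)).const_mul b
  convert! h2.add h3 using 1
  rw [transitionDeriv]
  ring

theorem transition_eq_one {δ b t : ℝ} (hδ : 0 < δ) (ht : δ ≤ t) : transition δ b t = 1 := by
  have h : 1 ≤ t / δ := (one_le_div hδ).2 ht
  rw [transition, Real.smoothTransition.one_of_one_le h,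
    Real.smoothTransition.one_of_one_le (by linarith)]
  ring

theorem transition_eq_zero {δ b t : ℝ} (hδ : 0 < δ) (ht : t ≤ -δ) : transition δ b t = 0 := by
  have h : t / δ ≤ -1 := by rwa [div_le_iff₀ hδ, neg_one_mul]
  rw [transition, Real.smoothTransition.zero_of_nonpos (by linarith),
    Real.smoothTransition.zero_of_nonpos (by linarith)]
  ring

/-- One transition is complete at 0 and the other has not begun, so b can be read off on the disc y
= 0; this tells the competitors apart. -/
theorem transition_zero (δ b : ℝ) : transition δ b 0 = b := by
  rw [transition, zero_div, Real.smoothTransition.zero, zero_add, Real.smoothTransition.one]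
  ring

theorem abs_transition_le {δ b : ℝ} (hb : b ∈ Icc (0 : ℝ) 1) (t : ℝ) : |transition δ b t| ≤ 1 := by
  have h1 := Real.smoothTransition.nonneg (t / δ)
  have h2 := Real.smoothTransition.le_one (t / δ)
  have h3 := Real.smoothTransition.nonneg (t / δ + 1)
  have h4 := Real.smoothTransition.le_one (t / δ + 1)
  obtain ⟨hb0, hb1⟩ := hb
  rw [transition, abs_of_nonneg (by
    have : 0 ≤ 1 - b := by linarith
    positivity)]
  nlinarith

theorem deriv_smoothTransition_nonneg (t : ℝ) : 0 ≤ deriv Real.smoothTransition t :=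
  Real.smoothTransition.monotone.deriv_nonneg

theorem transitionDeriv_nonneg {δ b : ℝ} (hδ : 0 < δ) (hb : b ∈ Icc (0 : ℝ) 1) (t : ℝ) :
    0 ≤ transitionDeriv δ b t := by
  have h1 := deriv_smoothTransition_nonneg (t / δ)
  have h2 := deriv_smoothTransition_nonneg (t / δ + 1)
  have h3 : 0 ≤ 1 - b := by linarith [hb.2]
  have h4 := hb.1
  rw [transitionDeriv]
  positivity

theorem transitionDeriv_eq_zero {δ b t : ℝ} (hδ : 0 < δ) (ht : δ < |t|) :
    transitionDeriv δ b t = 0 := by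
  rw [transitionDeriv]
  rcases lt_abs.1 ht with h | h
  · have h : 1 < t / δ := (one_lt_div hδ).2 h
    rw [deriv_smoothTransition_eq_zero (Or.inr h),
      deriv_smoothTransition_eq_zero (Or.inr (by linarith))]
    ring
  · have h : t / δ < -1 := by
      rw [div_lt_iff₀ hδ, neg_one_mul]
      linarith
    rw [deriv_smoothTransition_eq_zero (Or.inl (by linarith)),
      deriv_smoothTransition_eq_zero (Or.inl (by linarith))]
    ring

theorem exists_bound_transitionDeriv {δ b : ℝ} (hδ : 0 < δ) (hb : b ∈ Icc (0 : ℝ) 1) :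
    ∃ C, 0 ≤ C ∧ ∀ t, transitionDeriv δ b t ≤ C := by
  obtain ⟨C, hC0, hC⟩ := exists_bound_deriv_smoothTransition
  refine ⟨C / δ, by positivity, fun t => ?_⟩
  have h1 := (le_abs_self _).trans (hC (t / δ))
  have h2 := (le_abs_self _).trans (hC (t / δ + 1))
  have h3 : 0 ≤ 1 - b := by linarith [hb.2]
  have h4 := hb.1
  calc transitionDeriv δ b t ≤ (1 - b) * (C / δ) + b * (C / δ) := by
        rw [transitionDeriv]
        gcongr
    _ = C / δ := by ring

/-- The function with level sets orthogonal to the calibrating field in the wedge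
`|y| < ε |s| ^ k`. -/
noncomputable def wedge (k : ℕ) (z : ℝ × ℝ) : ℝ :=
  z.2 / z.1 ^ k * Real.exp (k * (z.1 - 2 * z.2 ^ 2))

theorem hasFDerivAt_wedge (k : ℕ) {z : ℝ × ℝ} (h0 : z.1 ≠ 0) :
    HasFDerivAt (wedge k)
      ((Real.exp (k * (z.1 - 2 * z.2 ^ 2)) / z.1 ^ k * (k * z.2 * (1 - 1 / z.1))) •
          ContinuousLinearMap.fst ℝ ℝ ℝ +
        (Real.exp (k * (z.1 - 2 * z.2 ^ 2)) / z.1 ^ k * (1 - 4 * k * z.2 ^ 2)) •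
          ContinuousLinearMap.snd ℝ ℝ ℝ) z := by
  have h1 : HasFDerivAt (fun z : ℝ × ℝ => z.1) (ContinuousLinearMap.fst ℝ ℝ ℝ) z := hasFDerivAt_fst
  have h2 : HasFDerivAt (fun z : ℝ × ℝ => z.2) (ContinuousLinearMap.snd ℝ ℝ ℝ) z := hasFDerivAt_snd
  have h3 := h2.mul (((hasDerivAt_pow k z.1).inv (pow_ne_zero k h0)).comp_hasFDerivAt z h1)
  have h4 := ((h1.sub ((h2.pow 2).const_mul 2)).const_mul (k : ℝ)).exp
  have hpow : (k : ℝ) * z.1 ^ (k - 1) = k * (z.1 ^ k / z.1) := by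
    rcases k with _ | j
    · simp
    · rw [Nat.add_sub_cancel, pow_succ, mul_div_cancel_right₀ _ h0]
  have h5 := h3.mul h4
  rw [hpow] at h5
  refine h5.congr_fderiv ?_
  have hk := pow_ne_zero k h0
  refine ContinuousLinearMap.ext fun w => ?_
  simp
  field_simp
  ring

variable {N : ℕ}

/-- The direction of the gradient of `wedge`. -/
noncomputable def wedgeDir (N k : ℕ) (x : EuclideanSpace ℝ (Fin (N + 1))) :
    EuclideanSpace ℝ (Fin (N + 1)) :=
  (1 - 4 * k * (planeMap N x).2 ^ 2) • axis N +
    (2 * k * (planeMap N x).2 * (1 - 1 / (planeMap N x).1)) • transverse N x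

/-- The length of the gradient of `wedge`, relative to `wedgeDir`. -/
noncomputable def wedgeFactor (k : ℕ) (z : ℝ × ℝ) : ℝ :=
  Real.exp (k * (z.1 - 2 * z.2 ^ 2)) / z.1 ^ k

theorem hasFDerivAt_wedge_planeMap (k : ℕ) {x : EuclideanSpace ℝ (Fin (N + 1))}
    (h0 : (planeMap N x).1 ≠ 0) :
    HasFDerivAt (fun x => wedge k (planeMap N x))
      (innerSL ℝ (wedgeFactor k (planeMap N x) • wedgeDir N k x)) x := by
  refine (hasFDerivAt_comp_planeMap (hasFDerivAt_wedge k h0)).congr_fderiv ?_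
  congr 1
  rw [wedgeDir, smul_add, smul_smul, smul_smul, wedgeFactor,
    add_comm (_ • transverse N x)]
  congr 2
  ring

/-- The field is parallel to the gradient of `wedge` in the wedge. -/
theorem IsBump.calibration_eq {k : ℕ} {ε : ℝ} {M : ℝ → ℝ} (hM : IsBump k ε M) (hk : 3 ≤ k)
    {x : EuclideanSpace ℝ (Fin (N + 1))} (hx : ‖x‖ ≤ 5 / 4) (h0 : (planeMap N x).1 ≠ 0)
    (hθ : |(planeMap N x).2 / (planeMap N x).1 ^ k| < ε) :
    ∃ l : ℝ, 0 ≤ l ∧ calibration N k M x = l • wedgeDir N k x := by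
  have hz := abs_planeMap_fst_le hx
  obtain ⟨h1, h2⟩ := hM.axial_eq hk hz h0 hθ
  have hroot := hM.root_pos (k := k) (by omega) (mem_strip_of_abs_le_one hz)
  have hd := (hM.density_mem (k := k) (by omega) hz).1
  refine ⟨N * density k M (planeMap N x) ^ ((N : ℝ) / 2 - 1) * (root k M (planeMap N x))⁻¹,
    ?_, ?_⟩
  · have : 0 ≤ density k M (planeMap N x) ^ ((N : ℝ) / 2 - 1) := Real.rpow_nonneg (by linarith) _
    positivity
  · rw [calibration, planeField, mul_smul _ (root k M (planeMap N x))⁻¹]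
    congr 1
    change axial k M (planeMap N x) • axis N -
      (densitySnd k M (planeMap N x) / 2) • transverse N x = _
    rw [h1, wedgeDir, smul_add, smul_smul, smul_smul, sub_eq_add_neg, ← neg_smul]
    refine congrArg₂ (· + ·) ?_ ?_
    · congr 1
      field_simp
    -- On the axis 1 + s = 0 the relation for the y-derivative cannot be divided by 1 + s, but there
    -- the transverse part vanishes.
    · by_cases ht : transverse N x = 0
      · rw [ht, smul_zero, smul_zero]
      · congr 1
        have h3 : 1 + (planeMap N x).1 ≠ 0 := by
          rw [one_add_planeMap_fst]
          exact pow_ne_zero 2 (norm_ne_zero_iff.2 ht)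
        refine mul_left_cancel₀ h3 ?_
        have e : (1 + (planeMap N x).1) * -(densitySnd k M (planeMap N x) / 2) =
          -((1 + (planeMap N x).1) * densitySnd k M (planeMap N x)) / 2 := by ring
        rw [e, h2]
        field_simp
        ring

/-- The competitors, as functions of `s` and `y`. -/
noncomputable def planeCompetitor (k : ℕ) (δ c : ℝ) (z : ℝ × ℝ) : ℝ :=
  if z.1 = 0 then if 0 < z.2 then 1 else 0
  else transition δ (if z.1 < 0 then c else 0) (wedge k z)

/-- The competitors. -/
noncomputable def competitor (N k : ℕ) (δ c : ℝ) (x : EuclideanSpace ℝ (Fin (N + 1))) : ℝ :=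
  planeCompetitor k δ c (planeMap N x)

/-- The gradient of `competitor`. -/
noncomputable def competitorGrad (N k : ℕ) (δ c : ℝ) (x : EuclideanSpace ℝ (Fin (N + 1))) :
    EuclideanSpace ℝ (Fin (N + 1)) :=
  (if (planeMap N x).1 = 0 then 0
    else transitionDeriv δ (if (planeMap N x).1 < 0 then c else 0) (wedge k (planeMap N x)) *
      wedgeFactor k (planeMap N x)) • wedgeDir N k x

theorem ite_mem_Icc {c : ℝ} (hc : c ∈ Icc (0 : ℝ) 1) (s : ℝ) :
    (if s < 0 then c else 0) ∈ Icc (0 : ℝ) 1 := by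
  split_ifs
  · exact hc
  · simp

theorem abs_competitor_le {c : ℝ} (hc : c ∈ Icc (0 : ℝ) 1) (k : ℕ) (δ : ℝ)
    (x : EuclideanSpace ℝ (Fin (N + 1))) : |competitor N k δ c x| ≤ 1 := by
  rw [competitor, planeCompetitor]
  split_ifs
  · simp
  · simp
  · exact abs_transition_le hc _
  · exact abs_transition_le (by simp) _

/-- The competitors are locally constant near points with `s = 0` and `y ≠ 0`. -/
theorem planeCompetitor_eventuallyEq {k : ℕ} (hk : Even k) (hk0 : k ≠ 0) {δ : ℝ} (hδ : 0 < δ)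
    (c : ℝ) {z : ℝ × ℝ} (h1 : z.1 = 0) (h2 : z.2 ≠ 0) :
    planeCompetitor k δ c =ᶠ[𝓝 z] fun _ => planeCompetitor k δ c z := by
  -- The condition |`wedge`| ≥ δ multiplied by s^k, which makes it meaningful and continuous across
  -- s = 0. As k is even, `wedge` has the sign of y on both sides.
  have hcont : Continuous fun w : ℝ × ℝ => |w.2| * Real.exp (k * (w.1 - 2 * w.2 ^ 2)) - δ * w.1 ^ k := by
    fun_prop
  have hpos : 0 < |z.2| * Real.exp (k * (z.1 - 2 * z.2 ^ 2)) - δ * z.1 ^ k := by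
    rw [h1, zero_pow hk0, mul_zero, sub_zero]
    positivity
  have hw : ∀ w : ℝ × ℝ, 0 < |w.2| * Real.exp (k * (w.1 - 2 * w.2 ^ 2)) - δ * w.1 ^ k → w.1 ≠ 0 →
      δ ≤ |w.2| / w.1 ^ k * Real.exp (k * (w.1 - 2 * w.2 ^ 2)) := by
    intro w hw h0
    have : 0 < w.1 ^ k := hk.pow_pos h0
    rw [div_mul_eq_mul_div, le_div_iff₀ this]
    linarith
  rcases h2.lt_or_gt with h2 | h2
  · have ho : IsOpen {w : ℝ × ℝ | w.2 < 0} := isOpen_lt (by fun_prop) continuous_const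
    filter_upwards [(isOpen_lt continuous_const hcont).mem_nhds hpos, ho.mem_nhds h2] with w hw1 hw2
    have hw2 : w.2 < 0 := hw2
    have e : planeCompetitor k δ c z = 0 := by
      rw [planeCompetitor, if_pos h1, if_neg (by linarith)]
    rw [e, planeCompetitor]
    split_ifs with h3 h4 h5
    · linarith
    · rfl
    all_goals
      refine transition_eq_zero hδ ?_
      have := hw w hw1 h3
      rw [abs_of_neg hw2] at this
      rw [wedge]
      linear_combination this
  · have ho : IsOpen {w : ℝ × ℝ | 0 < w.2} := isOpen_lt continuous_const (by fun_prop)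
    filter_upwards [(isOpen_lt continuous_const hcont).mem_nhds hpos, ho.mem_nhds h2] with w hw1 hw2
    have hw2 : 0 < w.2 := hw2
    have e : planeCompetitor k δ c z = 1 := by
      rw [planeCompetitor, if_pos h1, if_pos h2]
    rw [e, planeCompetitor]
    split_ifs with h3 h4
    · rfl
    all_goals
      refine transition_eq_one hδ ?_
      have := hw w hw1 h3
      rw [abs_of_pos hw2] at this
      exact this

theorem hasFDerivAt_competitor {k : ℕ} (hk : Even k) (hk0 : k ≠ 0) {δ : ℝ} (hδ : 0 < δ) (c : ℝ)
    {x : EuclideanSpace ℝ (Fin (N + 1))} (hx : planeMap N x ≠ 0) :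
    HasFDerivAt (competitor N k δ c) (innerSL ℝ (competitorGrad N k δ c x)) x := by
  have hcont : Continuous (planeMap N) := (contDiff_planeMap (m := 0)).continuous
  by_cases h0 : (planeMap N x).1 = 0
  · have h2 : (planeMap N x).2 ≠ 0 := fun h => hx (Prod.ext h0 h)
    have h := hcont.continuousAt.eventually (planeCompetitor_eventuallyEq hk hk0 hδ c h0 h2)
    have e : competitorGrad N k δ c x = 0 := by rw [competitorGrad, if_pos h0, zero_smul]
    rw [e, map_zero]
    exact (hasFDerivAt_const _ x).congr_of_eventuallyEq h
  · have h1 := (hasDerivAt_transition δ (if (planeMap N x).1 < 0 then c else 0)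
      (wedge k (planeMap N x))).comp_hasFDerivAt x (hasFDerivAt_wedge_planeMap k h0)
    have e : competitorGrad N k δ c x =
        transitionDeriv δ (if (planeMap N x).1 < 0 then c else 0) (wedge k (planeMap N x)) •
          wedgeFactor k (planeMap N x) • wedgeDir N k x := by
      rw [competitorGrad, if_neg h0, mul_smul]
    rw [e, map_smul]
    refine h1.congr_of_eventuallyEq ?_
    have hs : ∀ᶠ w in 𝓝 x, (planeMap N w).1 ≠ 0 ∧
        ((planeMap N w).1 < 0 ↔ (planeMap N x).1 < 0) := by
      have hc1 : Continuous fun w => (planeMap N w).1 := hcont.fst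
      rcases lt_or_gt_of_ne h0 with h | h
      · filter_upwards [(isOpen_lt hc1 continuous_const).mem_nhds h] with w hw
        have hw : (planeMap N w).1 < 0 := hw
        exact ⟨hw.ne, iff_of_true hw h⟩
      · filter_upwards [(isOpen_lt continuous_const hc1).mem_nhds h] with w hw
        have hw : 0 < (planeMap N w).1 := hw
        exact ⟨hw.ne', iff_of_false hw.not_gt h.not_gt⟩
    filter_upwards [hs] with w hw
    rw [competitor, planeCompetitor, if_neg hw.1]
    simp only [hw.2, Function.comp_apply]

end LeastGradient

/-! ### Gradients of the competitors -/

namespace LeastGradient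

variable {N k : ℕ}

theorem abs_coord_zero_le (x : EuclideanSpace ℝ (Fin (N + 1))) : |x 0| ≤ ‖x‖ :=
  PiLp.norm_apply_le x 0

theorem norm_transverse_le (x : EuclideanSpace ℝ (Fin (N + 1))) : ‖transverse N x‖ ≤ ‖x‖ := by
  refine le_of_sq_le_sq ?_ (norm_nonneg _)
  rw [norm_transverse_sq]
  linarith [sq_nonneg (x 0)]

theorem exp_bounds (k : ℕ) {z : ℝ × ℝ} (h1 : |z.1| ≤ 1) (h2 : |z.2| ≤ 5 / 4) :
    Real.exp (-(5 * k)) ≤ Real.exp (k * (z.1 - 2 * z.2 ^ 2)) ∧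
      Real.exp (k * (z.1 - 2 * z.2 ^ 2)) ≤ Real.exp k := by
  obtain ⟨h3, h4⟩ := abs_le.1 h1
  have h5 : z.2 ^ 2 ≤ (5 / 4) ^ 2 := by
    rw [← sq_abs]
    gcongr
  have hk : (0 : ℝ) ≤ k := Nat.cast_nonneg k
  constructor
  · rw [Real.exp_le_exp]
    have : k * (-5 : ℝ) ≤ k * (z.1 - 2 * z.2 ^ 2) := by
      gcongr
      linarith
    linarith
  · rw [Real.exp_le_exp]
    refine mul_le_of_le_one_right hk ?_
    nlinarith [sq_nonneg z.2]

theorem abs_ratio_le (k : ℕ) {z : ℝ × ℝ} (h1 : |z.1| ≤ 1) (h2 : |z.2| ≤ 5 / 4) :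
    |z.2 / z.1 ^ k| * Real.exp (-(5 * k)) ≤ |wedge k z| := by
  rw [wedge, abs_mul, Real.abs_exp]
  exact mul_le_mul_of_nonneg_left (exp_bounds k h1 h2).1 (abs_nonneg _)

/-- The half width of the transition, for a wedge of half width `ε`. -/
noncomputable def transitionWidth (k : ℕ) (ε : ℝ) : ℝ := ε / 2 * Real.exp (-(5 * k))

theorem transitionWidth_pos (k : ℕ) {ε : ℝ} (hε : 0 < ε) : 0 < transitionWidth k ε := by
  unfold transitionWidth
  positivity

/-- The exponential factor of `wedge` is at least e^(-5k) in the ball. The width of the transition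
is chosen so that the gradient lives only where M is exactly the parabola. -/
theorem abs_ratio_le_of_transitionDeriv_ne_zero {ε b : ℝ} (hε : 0 < ε)
    {z : ℝ × ℝ} (h1 : |z.1| ≤ 1) (h2 : |z.2| ≤ 5 / 4)
    (h : transitionDeriv (transitionWidth k ε) b (wedge k z) ≠ 0) : |z.2 / z.1 ^ k| ≤ ε / 2 := by
  by_contra! hlt
  refine h (transitionDeriv_eq_zero (transitionWidth_pos k hε) ?_)
  refine lt_of_lt_of_le ?_ (abs_ratio_le k h1 h2)
  rw [transitionWidth]
  gcongr

theorem inner_smul_smul_self {E : Type*} [NormedAddCommGroup E] [InnerProductSpace ℝ E] {a b : ℝ}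
    (ha : 0 ≤ a) (hb : 0 ≤ b) (v : E) : inner ℝ (a • v) (b • v) = ‖a • v‖ * ‖b • v‖ := by
  rw [inner_smul_left, inner_smul_right, real_inner_self_eq_norm_sq, norm_smul, norm_smul,
    Real.norm_of_nonneg ha, Real.norm_of_nonneg hb, conj_trivial]
  ring

/-- Where the gradient is nonzero, both vectors are nonnegative multiples of the same direction;
evenness of k is what fixes the sign for s < 0. -/
theorem IsBump.inner_calibration {ε : ℝ} {M : ℝ → ℝ} (hM : IsBump k ε M) (hk : 3 ≤ k)
    (hke : Even k) {c : ℝ} (hc : c ∈ Icc (0 : ℝ) 1) {x : EuclideanSpace ℝ (Fin (N + 1))}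
    (hx : ‖x‖ ≤ 5 / 4) :
    inner ℝ (calibration N k M x) (competitorGrad N k (transitionWidth k ε) c x) =
      ‖calibration N k M x‖ * ‖competitorGrad N k (transitionWidth k ε) c x‖ := by
  have hz := abs_planeMap_fst_le hx
  have hy : |(planeMap N x).2| ≤ 5 / 4 := (abs_coord_zero_le x).trans hx
  have hε := hM.pos
  rw [competitorGrad]
  by_cases h0 : (planeMap N x).1 = 0
  · simp [h0]
  rw [if_neg h0]
  set b : ℝ := if (planeMap N x).1 < 0 then c else 0
  by_cases hd : transitionDeriv (transitionWidth k ε) b (wedge k (planeMap N x)) = 0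
  · simp [hd]
  · obtain ⟨l, hl, hl2⟩ := hM.calibration_eq hk hx h0
      ((abs_ratio_le_of_transitionDeriv_ne_zero hε hz hy hd).trans_lt (by linarith))
    rw [hl2]
    refine inner_smul_smul_self hl (mul_nonneg (transitionDeriv_nonneg
      (transitionWidth_pos k hε) (ite_mem_Icc hc _) _) ?_) _
    exact div_nonneg (Real.exp_pos _).le (hke.pow_nonneg _)

/-- Inside y ≤ s^k, most of the non-integrable power of s is exchanged for a power of y, so that
both exponents stay above -1 and the majorant becomes a product. -/
theorem inv_pow_le_rpow (hk : 1 ≤ k) {s y : ℝ} (hs : 0 < s) (hy : 0 < y) (hys : y ≤ s ^ k) :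
    (s ^ k)⁻¹ ≤ y ^ (-(1 - 1 / (2 * (k : ℝ)))) * s ^ (-(1 / 2) : ℝ) := by
  have hkr : (1 : ℝ) ≤ k := by exact_mod_cast hk
  have hp : 0 ≤ 1 - 1 / (2 * (k : ℝ)) := by
    rw [sub_nonneg, div_le_one (by positivity)]
    linarith
  have h1 := Real.rpow_le_rpow_of_nonpos hy hys (neg_nonpos.2 hp)
  have h2 : (s ^ k)⁻¹ = (s ^ k) ^ (-(1 - 1 / (2 * (k : ℝ)))) * s ^ (-(1 / 2) : ℝ) := by
    rw [← Real.rpow_natCast s k, ← Real.rpow_mul hs.le, ← Real.rpow_add hs, ← Real.rpow_neg hs.le]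
    congr 1
    field_simp
    ring
  rw [h2]
  gcongr

/-- The integrable majorant of the gradients of the competitors. -/
theorem exists_norm_competitorGrad_le {ε : ℝ} (hε : 0 < ε) (hε1 : ε < 1) (hk : 1 ≤ k)
    (hke : Even k) {c : ℝ} (hc : c ∈ Icc (0 : ℝ) 1) :
    ∃ C, ∀ x : EuclideanSpace ℝ (Fin (N + 1)), ‖x‖ ≤ 5 / 4 → x 0 ≠ 0 →
      ‖competitorGrad N k (transitionWidth k ε) c x‖ ≤
        C * (|x 0| ^ (-(1 - 1 / (2 * (k : ℝ)))) * |‖x‖ ^ 2 - (x 0) ^ 2 - 1| ^ (-(1 / 2) : ℝ)) := by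
  have hδ := transitionWidth_pos k hε
  obtain ⟨C1, hC10, hC1⟩ := exists_bound_transitionDeriv hδ hc
  obtain ⟨C2, hC20, hC2⟩ := exists_bound_transitionDeriv hδ (b := 0) (by simp)
  set L : ℝ := 1 + 4 * k * (5 / 4) ^ 2 + 2 * k * (5 / 4 + 1) * (5 / 4) with hL
  refine ⟨(C1 + C2) * Real.exp k * L, fun x hx hx0 => ?_⟩
  have hz := abs_planeMap_fst_le hx
  have hy : |(planeMap N x).2| ≤ 5 / 4 := (abs_coord_zero_le x).trans hx
  have hpos : 0 ≤ (C1 + C2) * Real.exp k * L *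
    (|x 0| ^ (-(1 - 1 / (2 * (k : ℝ)))) * |‖x‖ ^ 2 - (x 0) ^ 2 - 1| ^ (-(1 / 2) : ℝ)) := by
    positivity
  rw [competitorGrad]
  by_cases h0 : (planeMap N x).1 = 0
  · rw [if_pos h0, zero_smul, norm_zero]
    exact hpos
  rw [if_neg h0]
  set b : ℝ := if (planeMap N x).1 < 0 then c else 0 with hb
  have hbI : b ∈ Icc (0 : ℝ) 1 := ite_mem_Icc hc _
  by_cases hd : transitionDeriv (transitionWidth k ε) b (wedge k (planeMap N x)) = 0
  · rw [hd, zero_mul, zero_smul, norm_zero]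
    exact hpos
  have hθ := abs_ratio_le_of_transitionDeriv_ne_zero hε hz hy hd
  have hs : 0 < |(planeMap N x).1| := abs_pos.2 h0
  have hsk : 0 < |(planeMap N x).1| ^ k := pow_pos hs k
  have hys : |(planeMap N x).2| ≤ |(planeMap N x).1| ^ k := by
    rw [abs_div, abs_pow, div_le_iff₀ hsk] at hθ
    nlinarith
  have hys1 : |(planeMap N x).2| ≤ |(planeMap N x).1| :=
    hys.trans (pow_le_of_le_one hs.le hz (by omega))
  have hh : transitionDeriv (transitionWidth k ε) b (wedge k (planeMap N x)) ≤ C1 + C2 := by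
    rw [hb]
    split_ifs
    · linarith [hC1 (wedge k (planeMap N x))]
    · linarith [hC2 (wedge k (planeMap N x))]
  have hf : wedgeFactor k (planeMap N x) ≤ Real.exp k *
      (|x 0| ^ (-(1 - 1 / (2 * (k : ℝ)))) * |‖x‖ ^ 2 - (x 0) ^ 2 - 1| ^ (-(1 / 2) : ℝ)) := by
    rw [wedgeFactor, div_eq_mul_inv, ← hke.pow_abs]
    gcongr
    · exact Real.exp_le_exp.1 (exp_bounds k hz hy).2
    · exact inv_pow_le_rpow hk hs (abs_pos.2 hx0) hys
  have hf0 : 0 ≤ wedgeFactor k (planeMap N x) :=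
    div_nonneg (Real.exp_pos _).le (hke.pow_nonneg _)
  have hV : ‖wedgeDir N k x‖ ≤ L := by
    refine (norm_add_le _ _).trans ?_
    rw [norm_smul, norm_smul, norm_axis, mul_one, hL]
    -- The pole of 1/s is harmless since |y| ≤ |s| in the wedge.
    have h3 : |(planeMap N x).2 * (1 - 1 / (planeMap N x).1)| ≤ 5 / 4 + 1 := by
      rw [mul_sub, mul_one]
      refine (abs_sub _ _).trans (add_le_add hy ?_)
      rw [mul_one_div, abs_div]
      exact div_le_one_of_le₀ hys1 hs.le
    gcongr
    · refine (abs_sub _ _).trans ?_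
      rw [abs_one, abs_of_nonneg (by positivity), ← sq_abs]
      gcongr
    · rw [Real.norm_eq_abs, mul_assoc, abs_mul, abs_of_nonneg (by positivity)]
      gcongr
    · exact (norm_transverse_le x).trans hx
  rw [norm_smul, norm_mul, Real.norm_of_nonneg (transitionDeriv_nonneg hδ hbI _),
    Real.norm_of_nonneg hf0]
  calc _ ≤ (C1 + C2) * (Real.exp k *
      (|x 0| ^ (-(1 - 1 / (2 * (k : ℝ)))) * |‖x‖ ^ 2 - (x 0) ^ 2 - 1| ^ (-(1 / 2) : ℝ))) * L := by
        gcongr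
    _ = _ := by ring

theorem measurable_planeMap : Measurable (planeMap N) :=
  (contDiff_planeMap (m := 0)).continuous.measurable

theorem measurable_wedge (k : ℕ) : Measurable (wedge k) := by
  unfold wedge
  fun_prop

theorem measurable_transition (δ b : ℝ) : Measurable (transition δ b) :=
  Continuous.measurable <| continuous_iff_continuousAt.2 fun t =>
    (hasDerivAt_transition δ b t).continuousAt

theorem measurable_transitionDeriv (δ b : ℝ) : Measurable (transitionDeriv δ b) := by
  have h : Continuous (deriv Real.smoothTransition) :=
    (Real.smoothTransition.contDiff (n := 1)).continuous_deriv le_rfl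
  unfold transitionDeriv
  exact Continuous.measurable (by fun_prop)

theorem measurable_competitor (k : ℕ) (δ c : ℝ) : Measurable (competitor N k δ c) := by
  have h1 : Measurable fun x => (planeMap N x).1 := measurable_planeMap.fst
  have h2 : Measurable fun x => (planeMap N x).2 := measurable_planeMap.snd
  have hw := (measurable_wedge k).comp (measurable_planeMap (N := N))
  have e : competitor N k δ c = fun x => if (planeMap N x).1 = 0 then
      if 0 < (planeMap N x).2 then 1 else 0
      else if (planeMap N x).1 < 0 then transition δ c (wedge k (planeMap N x))
      else transition δ 0 (wedge k (planeMap N x)) := by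
    ext x
    rw [competitor, planeCompetitor]
    split_ifs <;> rfl
  rw [e]
  refine Measurable.ite (h1 (measurableSet_singleton 0))
    (Measurable.ite (measurableSet_lt measurable_const h2) measurable_const measurable_const)
    (Measurable.ite (measurableSet_lt h1 measurable_const)
      ((measurable_transition δ c).comp hw) ((measurable_transition δ 0).comp hw))

theorem measurable_competitorGrad (k : ℕ) (δ c : ℝ) : Measurable (competitorGrad N k δ c) := by
  have h1 : Measurable fun x => (planeMap N x).1 := measurable_planeMap.fst
  have h2 : Measurable fun x => (planeMap N x).2 := measurable_planeMap.snd
  have hw := (measurable_wedge k).comp (measurable_planeMap (N := N))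
  have ht : Measurable (transverse N) := (transverse N).continuous.measurable
  have hf : Measurable fun x => wedgeFactor k (planeMap N x) := by
    unfold wedgeFactor
    fun_prop
  have hd : Measurable (wedgeDir N k) := by
    unfold wedgeDir
    fun_prop
  have e : competitorGrad N k δ c = fun x => (if (planeMap N x).1 = 0 then 0
      else (if (planeMap N x).1 < 0 then transitionDeriv δ c (wedge k (planeMap N x))
      else transitionDeriv δ 0 (wedge k (planeMap N x))) * wedgeFactor k (planeMap N x)) •
        wedgeDir N k x := by
    ext1 x
    rw [competitorGrad]
    split_ifs <;> rfl
  rw [e]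
  exact (Measurable.ite (h1 (measurableSet_singleton 0)) measurable_const
    ((Measurable.ite (measurableSet_lt h1 measurable_const)
      ((measurable_transitionDeriv δ c).comp hw)
      ((measurable_transitionDeriv δ 0).comp hw)).mul hf)).smul hd

theorem ae_coord_zero_ne_zero : ∀ᵐ x : EuclideanSpace ℝ (Fin (N + 1)), x 0 ≠ 0 := by
  have h : ∀ᵐ p : ℝ × EuclideanSpace ℝ (Fin N), p.1 ≠ 0 :=
    Measure.quasiMeasurePreserving_fst.ae (Measure.ae_ne volume 0)
  exact (measurePreserving_splitFirst N).quasiMeasurePreserving.ae h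

theorem ae_planeMap_fst_ne_zero : ∀ᵐ x : EuclideanSpace ℝ (Fin (N + 1)), (planeMap N x).1 ≠ 0 := by
  have h0 : ∀ᵐ w : EuclideanSpace ℝ (Fin N), ‖w‖ ≠ 1 := by
    have := Measure.addHaar_sphere_of_ne_zero (volume : Measure (EuclideanSpace ℝ (Fin N))) 0
      one_ne_zero
    rw [ae_iff]
    convert! this using 2
    ext w
    simp
  have h : ∀ᵐ p : ℝ × EuclideanSpace ℝ (Fin N), ‖p.2‖ ≠ 1 :=
    Measure.quasiMeasurePreserving_snd.ae h0
  filter_upwards [(measurePreserving_splitFirst N).quasiMeasurePreserving.ae h] with x hx h1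
  refine hx ?_
  rw [planeMap, norm_sq_eq_splitFirst] at h1
  have : ‖(splitFirst N x).2‖ ^ 2 = 1 := by linarith
  exact (pow_eq_one_iff_of_nonneg (norm_nonneg _) two_ne_zero).1 this

theorem integrableOn_competitorGrad {ε : ℝ} (hε : 0 < ε) (hε1 : ε < 1) (hN : 1 ≤ N) (hk : 1 ≤ k)
    (hke : Even k) {c : ℝ} (hc : c ∈ Icc (0 : ℝ) 1) :
    IntegrableOn (competitorGrad N k (transitionWidth k ε) c) (Metric.ball 0 (5 / 4)) := by
  obtain ⟨C, hC⟩ := exists_norm_competitorGrad_le (N := N) hε hε1 hk hke hc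
  have hkr : (1 : ℝ) ≤ k := by exact_mod_cast hk
  have hp : 1 - 1 / (2 * (k : ℝ)) < 1 := by
    have : 0 < 1 / (2 * (k : ℝ)) := by positivity
    linarith
  refine ((integrableOn_singular hN hp (q := 1 / 2) (by norm_num) (by norm_num)
    (5 / 4)).const_mul C).mono' (measurable_competitorGrad k _ c).aestronglyMeasurable ?_
  filter_upwards [ae_restrict_of_ae ae_coord_zero_ne_zero,
    ae_restrict_mem Metric.isOpen_ball.measurableSet] with x hx0 hx
  exact hC x (mem_ball_zero_iff.1 hx).le hx0

/-- Cutoff functions that vanish near the sphere `s = y = 0`. -/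
noncomputable def tubeCutoff (N m : ℕ) (x : EuclideanSpace ℝ (Fin (N + 1))) : ℝ :=
  Real.smoothTransition ((m + 1) ^ 2 * ((planeMap N x).1 ^ 2 + (planeMap N x).2 ^ 2) - 1)

theorem contDiff_tubeArg (N m : ℕ) : ContDiff ℝ ∞ fun x : EuclideanSpace ℝ (Fin (N + 1)) =>
    ((m : ℝ) + 1) ^ 2 * ((planeMap N x).1 ^ 2 + (planeMap N x).2 ^ 2) - 1 :=
  (contDiff_const.mul ((contDiff_planeMap.fst.pow 2).add (contDiff_planeMap.snd.pow 2))).sub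
    contDiff_const

theorem contDiff_tubeCutoff (N m : ℕ) : ContDiff ℝ ∞ (tubeCutoff N m) :=
  Real.smoothTransition.contDiff.comp (contDiff_tubeArg N m)

theorem tsupport_tubeCutoff_disjoint (N m : ℕ) :
    Disjoint (tsupport (tubeCutoff N m)) {x | planeMap N x = 0} := by
  have hsub : tsupport (tubeCutoff N m) ⊆
      {x | 0 ≤ ((m : ℝ) + 1) ^ 2 * ((planeMap N x).1 ^ 2 + (planeMap N x).2 ^ 2) - 1} := by
    refine closure_minimal (fun x hx => ?_)
      (isClosed_le continuous_const (contDiff_tubeArg N m).continuous)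
    by_contra h
    exact hx (Real.smoothTransition.zero_of_nonpos (le_of_not_ge h))
  refine Set.disjoint_left.2 fun x hx hx0 => ?_
  have h1 := hsub hx
  have hx0 : planeMap N x = 0 := hx0
  rw [mem_ofPred_eq, hx0] at h1
  norm_num at h1

theorem eventually_tubeCutoff_eq {x : EuclideanSpace ℝ (Fin (N + 1))} (hx : x 0 ≠ 0) :
    ∀ᶠ m in atTop, tubeCutoff N m =ᶠ[𝓝 x] fun _ => 1 := by
  filter_upwards [eventually_two_lt hx] with m hm
  have h1 : (1 : ℝ) < ((m : ℝ) + 1) ^ 2 * ((planeMap N x).1 ^ 2 + (planeMap N x).2 ^ 2) - 1 := by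
    have : 0 ≤ ((m : ℝ) + 1) ^ 2 * (planeMap N x).1 ^ 2 := by positivity
    have h2 : (planeMap N x).2 = x 0 := rfl
    rw [h2]
    linarith
  filter_upwards [(isOpen_lt continuous_const (contDiff_tubeArg N m).continuous).mem_nhds h1]
    with w hw
  exact Real.smoothTransition.one_of_one_le (le_of_lt hw)

/-- The slope is of order (m + 1)²(|s| + |y|), but only where (m + 1)²(s² + y²) ≤ 2. It is thus at
most of order 1/(|s| + |y|), hence of 1/√(|s||y|): integrable in codimension two and independent of
m. -/
theorem norm_fderiv_tubeCutoff_le {C : ℝ} (hC : ∀ t, |deriv Real.smoothTransition t| ≤ C) (m : ℕ)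
    {x : EuclideanSpace ℝ (Fin (N + 1))} (hx : ‖x‖ ≤ 5 / 4) (h1 : (planeMap N x).1 ≠ 0)
    (h2 : x 0 ≠ 0) :
    ‖fderiv ℝ (tubeCutoff N m) x‖ ≤
      C * 10 * (|x 0| ^ (-(1 / 2) : ℝ) * |‖x‖ ^ 2 - (x 0) ^ 2 - 1| ^ (-(1 / 2) : ℝ)) := by
  have hC0 : 0 ≤ C := (abs_nonneg _).trans (hC 0)
  set s := (planeMap N x).1 with hs
  set y := x 0 with hy
  set T : ℝ := ((m : ℝ) + 1) ^ 2 * (s ^ 2 + y ^ 2) - 1 with hT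
  have hd : HasFDerivAt (tubeCutoff N m) (deriv Real.smoothTransition T •
      ((((m : ℝ) + 1) ^ 2) • ((2 * s) • innerSL ℝ ((2 : ℝ) • transverse N x) +
        (2 * y) • innerSL ℝ (axis N)))) x := by
    have e := (((hasFDerivAt_planeMap_fst x).pow 2).add ((hasFDerivAt_coord_zero x).pow 2))
    refine ((hasDerivAt_smoothTransition T).comp_hasFDerivAt x
      ((e.const_mul (((m : ℝ) + 1) ^ 2)).sub_const 1)).congr_fderiv ?_
    ext w
    simp [hs, hy]
  rw [hd.fderiv]
  have hs0 : 0 < |s| := abs_pos.2 h1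
  have hy0 : 0 < |y| := abs_pos.2 h2
  have hrp : |y| ^ (-(1 / 2) : ℝ) * |‖x‖ ^ 2 - y ^ 2 - 1| ^ (-(1 / 2) : ℝ) =
      (√|y| * √|s|)⁻¹ := by
    change |y| ^ (-(1 / 2) : ℝ) * |s| ^ (-(1 / 2) : ℝ) = _
    rw [Real.rpow_neg hy0.le, Real.rpow_neg hs0.le, ← Real.sqrt_eq_rpow, ← Real.sqrt_eq_rpow,
      mul_inv]
  rw [hrp]
  have hsy : 0 < √|y| * √|s| := mul_pos (Real.sqrt_pos.2 hy0) (Real.sqrt_pos.2 hs0)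
  by_cases hT1 : 1 < T
  · rw [deriv_smoothTransition_eq_zero (Or.inr hT1), zero_smul, norm_zero]
    positivity
  push Not at hT1
  have hn : ‖(2 * s) • innerSL ℝ ((2 : ℝ) • transverse N x) + (2 * y) • innerSL ℝ (axis N)‖ ≤
      5 * (|s| + |y|) := by
    refine (norm_add_le _ _).trans ?_
    simp only [norm_smul, innerSL_apply_norm, norm_axis, norm_mul,
      Real.norm_eq_abs, abs_two]
    have := (norm_transverse_le x).trans hx
    nlinarith
  have hsq : √|y| * √|s| ≤ (|s| + |y|) / 2 := by
    nlinarith [sq_nonneg (√|y| - √|s|), Real.sq_sqrt hy0.le, Real.sq_sqrt hs0.le]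
  have hkey : ((m : ℝ) + 1) ^ 2 * (5 * (|s| + |y|)) ≤ 10 * (√|y| * √|s|)⁻¹ := by
    rw [← div_eq_mul_inv, le_div_iff₀ hsy]
    calc ((m : ℝ) + 1) ^ 2 * (5 * (|s| + |y|)) * (√|y| * √|s|)
        ≤ ((m : ℝ) + 1) ^ 2 * (5 * (|s| + |y|)) * ((|s| + |y|) / 2) := by gcongr
      _ = ((m : ℝ) + 1) ^ 2 * (5 / 2 * (|s| + |y|) ^ 2) := by ring
      _ ≤ ((m : ℝ) + 1) ^ 2 * (5 * (s ^ 2 + y ^ 2)) := by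
        refine mul_le_mul_of_nonneg_left ?_ (by positivity)
        nlinarith [sq_nonneg (|s| - |y|), sq_abs s, sq_abs y]
      _ = 5 * (T + 1) := by
        rw [hT]
        ring
      _ ≤ 10 := by linarith
  rw [norm_smul, norm_smul, Real.norm_eq_abs, Real.norm_of_nonneg (by positivity)]
  calc _ ≤ C * (((m : ℝ) + 1) ^ 2 * (5 * (|s| + |y|))) := by
        gcongr
        exact hC _
    _ ≤ C * (10 * (√|y| * √|s|)⁻¹) := by gcongr
    _ = _ := by ring

theorem integrableOn_competitor {c : ℝ} (hc : c ∈ Icc (0 : ℝ) 1) (k : ℕ) (δ R : ℝ) :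
    IntegrableOn (competitor N k δ c) (Metric.ball 0 R) := by
  refine Measure.integrableOn_of_bounded (M := 1) measure_ball_lt_top.ne
    (measurable_competitor k δ c).aestronglyMeasurable ?_
  exact Eventually.of_forall fun x => abs_competitor_le hc k δ x

/-- The distributional gradient of the competitors. -/
theorem isGradientMeasure_competitor {ε : ℝ} (hε : 0 < ε) (hε1 : ε < 1) (hN : 1 ≤ N) (hk : 1 ≤ k)
    (hke : Even k) {c : ℝ} (hc : c ∈ Icc (0 : ℝ) 1) :
    IsGradientMeasure (Metric.ball 0 (5 / 4)) (competitor N k (transitionWidth k ε) c)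
      ((volume.restrict (Metric.ball 0 (5 / 4))).withDensityᵥ
        (competitorGrad N k (transitionWidth k ε) c)) := by
  obtain ⟨C, hC0, hC⟩ := exists_bound_deriv_smoothTransition
  refine isGradientMeasure_of_hasFDerivAt (S := {x | planeMap N x = 0}) Metric.isOpen_ball
    (integrableOn_competitor hc k _ _) (integrableOn_competitorGrad hε hε1 hN hk hke hc)
    (abs_competitor_le hc k _)
    (fun x hx => hasFDerivAt_competitor hke (by omega) (transitionWidth_pos k hε) c hx.2)
    (contDiff_tubeCutoff N) (tsupport_tubeCutoff_disjoint N) (fun m x => ?_)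
    (ae_restrict_of_ae ?_)
    ((integrableOn_singular hN (p := 1 / 2) (q := 1 / 2) (by norm_num) (by norm_num) (by norm_num)
      (5 / 4)).const_mul (C * 10)) fun m => ?_
  · rw [tubeCutoff, abs_of_nonneg (Real.smoothTransition.nonneg _)]
    exact Real.smoothTransition.le_one _
  · filter_upwards [ae_coord_zero_ne_zero] with x hx
    exact eventually_tubeCutoff_eq hx
  · filter_upwards [ae_restrict_of_ae ae_coord_zero_ne_zero,
      ae_restrict_of_ae ae_planeMap_fst_ne_zero,
      ae_restrict_mem Metric.isOpen_ball.measurableSet] with x h1 h2 hx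
    exact norm_fderiv_tubeCutoff_le hC m (mem_ball_zero_iff.1 hx).le h2 h1

end LeastGradient

/-! ### Boundary values, distinctness and conclusion -/

namespace LeastGradient

/-- Balls are bounded smooth domains. -/
theorem isBoundedSmoothDomain_ball {n : ℕ} {R : ℝ} (hR : 0 < R) :
    IsBoundedSmoothDomain (Metric.ball (0 : EuclideanSpace ℝ (Fin n)) R) where
  isOpen := Metric.isOpen_ball
  isConnected := Metric.isConnected_ball hR
  isBounded := Metric.isBounded_ball
  smooth_boundary x hx := by
    rw [frontier_ball _ hR.ne', mem_sphere_zero_iff_norm] at hx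
    refine ⟨univ, fun y => ‖y‖ ^ 2 - R ^ 2, isOpen_univ, mem_univ x,
      ((contDiff_norm_sq ℝ).sub contDiff_const).contDiffOn, ?_, ?_⟩
    · rw [((hasStrictFDerivAt_norm_sq x).hasFDerivAt.sub_const (R ^ 2)).fderiv]
      intro h
      have h1 := congrArg (fun L : EuclideanSpace ℝ (Fin n) →L[ℝ] ℝ => L x) h
      simp at h1
      rw [h1, norm_zero] at hx
      exact hR.ne hx
    · ext y
      simp only [inter_univ, mem_ball_zero_iff, mem_univ, true_and, mem_ofPred_eq, sub_neg]
      exact (sq_lt_sq₀ (norm_nonneg y) hR.le).symm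

theorem isConnected_frontier_ball {N : ℕ} (hN : 1 ≤ N) {R : ℝ} (hR : 0 < R) :
    IsConnected (frontier (Metric.ball (0 : EuclideanSpace ℝ (Fin (N + 1))) R)) := by
  rw [frontier_ball _ hR.ne']
  refine isConnected_sphere ?_ 0 hR.le
  rw [← Module.finrank_eq_rank, finrank_euclideanSpace_fin]
  exact_mod_cast Nat.lt_add_of_pos_left hN

theorem eq_of_ae_eq_of_continuousAt {E : Type*} [TopologicalSpace E] [MeasurableSpace E]
    {μ : Measure E} [μ.IsOpenPosMeasure] {Ω : Set E} (hΩ : IsOpen Ω) {u v : E → ℝ}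
    (h : u =ᵐ[μ.restrict Ω] v) {x : E} (hx : x ∈ Ω) (hu : ContinuousAt u x)
    (hv : ContinuousAt v x) : u x = v x := by
  by_contra hne
  have h1 : {y | u y ≠ v y} ∩ Ω ∈ 𝓝 x := inter_mem
    (((hu.sub hv).eventually_ne (sub_ne_zero.2 hne)).mono fun _ => sub_ne_zero.1) (hΩ.mem_nhds hx)
  have h2 : μ ({y | u y ≠ v y} ∩ Ω) = 0 :=
    le_antisymm ((Measure.le_restrict_apply _ _).trans (ae_iff.1 h).le) zero_le
  exact (Measure.measure_pos_of_mem_nhds μ h1).ne' h2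

variable {N k : ℕ}

theorem continuousAt_competitor (hke : Even k) (hk : k ≠ 0) {δ : ℝ} (hδ : 0 < δ) (c : ℝ)
    {x : EuclideanSpace ℝ (Fin (N + 1))} (hx : planeMap N x ≠ 0) :
    ContinuousAt (competitor N k δ c) x :=
  (hasFDerivAt_competitor hke hk hδ c hx).continuousAt

theorem planeMap_ne_zero_of_norm_eq {x : EuclideanSpace ℝ (Fin (N + 1))} (hx : ‖x‖ = 5 / 4) :
    planeMap N x ≠ 0 := by
  intro h
  have h1 : ‖x‖ ^ 2 - x 0 ^ 2 - 1 = 0 := congrArg Prod.fst h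
  have h2 : x 0 = 0 := congrArg Prod.snd h
  rw [hx, h2] at h1
  norm_num at h1

theorem norm_eq_of_mem_frontier {x : EuclideanSpace ℝ (Fin (N + 1))}
    (hx : x ∈ frontier (Metric.ball (0 : EuclideanSpace ℝ (Fin (N + 1))) (5 / 4))) :
    ‖x‖ = 5 / 4 := by
  rwa [frontier_ball _ (by norm_num), mem_sphere_zero_iff_norm] at hx

/-- The competitors agree on the sphere of radius `5 / 4`. -/
theorem competitor_eq_of_norm_eq {ε : ℝ} (hε : 0 < ε) (hε1 : ε < 1) (hke : Even k) (c : ℝ)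
    {x : EuclideanSpace ℝ (Fin (N + 1))} (hx : ‖x‖ = 5 / 4) :
    competitor N k (transitionWidth k ε) c x = competitor N k (transitionWidth k ε) 0 x := by
  rw [competitor, competitor, planeCompetitor, planeCompetitor]
  split_ifs with h0 h1 h2
  · rfl
  · rfl
  · have hδ := transitionWidth_pos k hε
    have hz := abs_planeMap_fst_le hx.le
    have hy : |(planeMap N x).2| ≤ 5 / 4 := (abs_coord_zero_le x).trans hx.le
    have hsk : 0 < (planeMap N x).1 ^ k := hke.pow_pos h0
    have hs : ‖x‖ ^ 2 - (planeMap N x).2 ^ 2 - 1 < 0 := h2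
    rw [hx] at hs
    -- On the sphere of radius 5/4 the region s < 0 lies at |y| > 3/4, well outside the wedge, where
    -- the transition has already reached 0 or 1 whatever c is.
    have hy2 : 1 / 2 ≤ |(planeMap N x).2| := by
      by_contra! h
      nlinarith [abs_nonneg (planeMap N x).2, sq_abs (planeMap N x).2]
    have h3 : 1 / 2 ≤ |(planeMap N x).2 / (planeMap N x).1 ^ k| := by
      rw [abs_div, abs_of_pos hsk, le_div_iff₀ hsk]
      have : (planeMap N x).1 ^ k ≤ 1 := by
        rw [← hke.pow_abs]
        exact pow_le_one₀ (abs_nonneg _) hz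
      linarith
    have h4 : transitionWidth k ε ≤ |wedge k (planeMap N x)| := by
      refine le_trans ?_ (abs_ratio_le k hz hy)
      rw [transitionWidth]
      gcongr
      linarith
    rcases le_abs.1 h4 with h | h
    · rw [transition_eq_one hδ h, transition_eq_one hδ h]
    · rw [transition_eq_zero hδ (by linarith), transition_eq_zero hδ (by linarith)]
  · rfl

/-- A continuous trace yields boundary values in the sense of `BVf`. -/
theorem tendsto_essSup_of_continuousAt {n : ℕ} {Ω : Set (EuclideanSpace ℝ (Fin n))}
    {u v : EuclideanSpace ℝ (Fin n) → ℝ} (huv : v =ᵐ[volume.restrict Ω] u)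
    {x : EuclideanSpace ℝ (Fin n)} (hu : ContinuousAt u x) :
    Tendsto (fun r : ℝ => essSup (fun y => ENNReal.ofReal |u x - v y|)
      (volume.restrict (Ω ∩ Metric.ball x r))) (𝓝[>] 0) (𝓝 0) := by
  refine ENNReal.tendsto_nhds_zero.2 fun η hη => ?_
  have h0 : Tendsto (fun y => ENNReal.ofReal |u x - u y|) (𝓝 x) (𝓝 0) := by
    have h1 : Tendsto (fun y => |u x - u y|) (𝓝 x) (𝓝 0) := by
      simpa using ((tendsto_const_nhds (x := u x)).sub hu).abs
    simpa using ENNReal.tendsto_ofReal h1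
  obtain ⟨r0, hr0, hball⟩ := Metric.eventually_nhds_iff_ball.1
    (ENNReal.tendsto_nhds_zero.1 h0 η hη)
  filter_upwards [Ioo_mem_nhdsGT hr0] with r hr
  refine essSup_le_of_ae_le _ ?_
  have h2 : ∀ᵐ y ∂volume.restrict (Ω ∩ Metric.ball x r), v y = u y :=
    ae_mono (Measure.restrict_mono inter_subset_left le_rfl) huv
  have h3 : ∀ᵐ y ∂volume.restrict (Ω ∩ Metric.ball x r), y ∈ Metric.ball x r :=
    ae_mono (Measure.restrict_mono inter_subset_right le_rfl)
      (ae_restrict_mem Metric.isOpen_ball.measurableSet)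
  filter_upwards [h2, h3] with y hy1 hy2
  rw [hy1]
  exact hball y (Metric.ball_subset_ball hr.2.le hy2)

theorem exists_continuousMap_competitor {ε : ℝ} (hε : 0 < ε) (hke : Even k) (hk : k ≠ 0) :
    ∃ f : C(frontier (Metric.ball (0 : EuclideanSpace ℝ (Fin (N + 1))) (5 / 4)), ℝ),
      ∀ x, f x = competitor N k (transitionWidth k ε) 0 x := by
  refine ⟨⟨fun x => competitor N k (transitionWidth k ε) 0 x,
    continuous_iff_continuousAt.2 fun x => ?_⟩, fun x => rfl⟩
  have hx := norm_eq_of_mem_frontier x.2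
  exact (continuousAt_competitor hke hk (transitionWidth_pos k hε) 0
    (planeMap_ne_zero_of_norm_eq hx)).comp continuousAt_subtype_val

/-- The condition reads k ≥ 2/(1 - α). -/
theorem exists_even_exponent {α : ℝ} (hα : α < 1) :
    ∃ k : ℕ, 4 ≤ k ∧ Even k ∧ α ≤ ((k : ℝ) - 2) / k := by
  obtain ⟨m, hm⟩ := exists_nat_gt (2 / (1 - α))
  refine ⟨2 * (m + 2), by omega, even_two_mul _, ?_⟩
  have h1 : 0 < 1 - α := by linarith
  rw [div_lt_iff₀ h1] at hm
  rw [le_div_iff₀ (by positivity)]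
  push_cast
  nlinarith

theorem exists_infinite_minimizers (n : ℕ) (hn : 2 ≤ n) (α : ℝ≥0) (hα : α < 1) :
    ∃ (Ω : Set (EuclideanSpace ℝ (Fin n))) (f : C(frontier Ω, ℝ))
      (a : EuclideanSpace ℝ (Fin n) → ℝ),
      IsBoundedSmoothDomain Ω ∧
      IsConnected (frontier Ω) ∧
      IsC1Holder α Ω a ∧
      (∃ c : ℝ, 0 < c ∧ ∀ x ∈ Ω, c ≤ a x) ∧
      (minimizers Ω a f).Infinite := by
  obtain ⟨N, rfl⟩ := Nat.exists_eq_add_of_le' (show 1 ≤ n by omega)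
  have hN : 1 ≤ N := by omega
  obtain ⟨k, hk, hke, hαk⟩ := exists_even_exponent (α := α) (by exact_mod_cast hα)
  obtain ⟨ε, M, hM⟩ := exists_isBump (k := k) (by omega)
  have hε := hM.pos
  have hδ := transitionWidth_pos k hε
  have hkr : (4 : ℝ) ≤ k := by exact_mod_cast hk
  obtain ⟨f, hf⟩ := exists_continuousMap_competitor (N := N) hε hke (by omega)
  have hΩ : ∀ x ∈ Metric.ball (0 : EuclideanSpace ℝ (Fin (N + 1))) (5 / 4), ‖x‖ ≤ 5 / 4 :=
    fun x hx => (mem_ball_zero_iff.1 hx).le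
  refine ⟨Metric.ball 0 (5 / 4), f, fun x => planeWeight N k M (planeMap N x),
    isBoundedSmoothDomain_ball (by norm_num), isConnected_frontier_ball hN (by norm_num), ?_, ?_, ?_⟩
  · have hβ : 0 < ((k : ℝ) - 2) / k := div_pos (by linarith) (by linarith)
    have hβ1 : ((k : ℝ) - 2) / k ≤ 1 := (div_le_one (by linarith)).2 (by linarith)
    -- The regularity is established with the full exponent (k-2)/k > 0 and lowered to α only at the
    -- end.
    have h1 := hM.holderC1_planeWeight (by omega) N hβ.le hβ1 (by field_simp; rfl)
    have h2 : HolderC1 (((k : ℝ) - 2) / k)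
        (Metric.closedBall (0 : EuclideanSpace ℝ (Fin (N + 1))) (5 / 4)) (planeMap N) :=
      HolderC1.of_contDiffOn hβ1 (convex_closedBall _ _) (isCompact_closedBall _ _) isOpen_univ
        (subset_univ _) contDiff_planeMap.contDiffOn
    exact (h1.comp hβ.le (convex_ball _ _) (h2.mono Metric.ball_subset_closedBall)
      fun x hx => abs_planeMap_fst_le (hΩ x hx)).isC1Holder Metric.isOpen_ball hβ hαk
  · obtain ⟨c, hc, hcle⟩ := hM.exists_planeWeight_ge (by omega) hN
    exact ⟨c, hc, fun x hx => hcle _ (abs_planeMap_fst_le (hΩ x hx))⟩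
  · have hint : ∀ c : Icc (0 : ℝ) 1, Integrable (competitor N k (transitionWidth k ε) c)
        (volume.restrict (Metric.ball 0 (5 / 4))) := fun c => integrableOn_competitor c.2 k _ _
    obtain ⟨C, hC⟩ := hM.exists_bound_smoothCalibration (N := N) (by omega)
    have hmem : ∀ c : Icc (0 : ℝ) 1, (hint c).toL1 _ ∈ minimizers (Metric.ball 0 (5 / 4))
        (fun x => planeWeight N k M (planeMap N x)) f := by
      intro c
      have hgrad := (isGradientMeasure_competitor hε hM.lt_one hN (by omega) hke c.2).congr
        (hint c).coeFn_toL1.symm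
      refine mem_minimizers_of_calibration (by norm_num) rfl ⟨⟨_, hgrad⟩, fun x => ?_⟩
        (integrableOn_competitorGrad hε hM.lt_one hN (by omega) hke c.2) hgrad
        (fun x hx => (hM.norm_calibration (by omega) (hΩ x hx)).symm) ?_
        (fun j => contDiffOn_rotationField Metric.isOpen_ball
          (hM.contDiffOn_potential (by omega) j))
        (fun j x hx => divergence_rotationField Metric.isOpen_ball
          (hM.contDiffOn_potential (by omega) j) hx)
        (fun j x hx => hC j x (hΩ x hx))
        (fun x hx => hM.tendsto_smoothCalibration (by omega) (hΩ x hx))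
      · have hx := norm_eq_of_mem_frontier x.2
        rw [hf, ← competitor_eq_of_norm_eq hε hM.lt_one hke c hx]
        exact tendsto_essSup_of_continuousAt (hint c).coeFn_toL1
          (continuousAt_competitor hke (by omega) hδ c (planeMap_ne_zero_of_norm_eq hx))
      · filter_upwards [ae_restrict_mem Metric.isOpen_ball.measurableSet] with x hx
        exact hM.inner_calibration (by omega) hke c.2 (hΩ x hx)
    have hinj : Function.Injective fun c : Icc (0 : ℝ) 1 => (hint c).toL1 _ := by
      intro c d hcd
      have hae := (Integrable.toL1_eq_toL1_iff _ _ (hint c) (hint d)).1 hcd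
      -- A point of the disc with y = 0 and s = -3/4, where the competitor is continuous with value
      -- equal to its parameter; N ≥ 1 makes the last coordinate different from the first.
      set x : EuclideanSpace ℝ (Fin (N + 1)) := EuclideanSpace.single (Fin.last N) (1 / 2) with hx
      have hx0 : x 0 = 0 := by
        have : (0 : Fin (N + 1)) ≠ Fin.last N := by
          rw [Ne, Fin.ext_iff, Fin.val_last]
          simp
          omega
        simp [hx, this]
      have hxn : ‖x‖ = 1 / 2 := by simp [hx]
      have hp : planeMap N x = (-(3 / 4), 0) := by
        rw [planeMap, hx0, hxn]
        norm_num
      have hval : ∀ b : ℝ, competitor N k (transitionWidth k ε) b x = b := by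
        intro b
        rw [competitor, hp, planeCompetitor, if_neg (by norm_num), if_pos (by norm_num), wedge,
          zero_div, zero_mul, transition_zero]
      have hne : planeMap N x ≠ 0 := by
        rw [hp]
        intro h
        have := congrArg Prod.fst h
        norm_num at this
      have h := eq_of_ae_eq_of_continuousAt Metric.isOpen_ball hae
        (x := x) (mem_ball_zero_iff.2 (by rw [hxn]; norm_num))
        (continuousAt_competitor hke (by omega) hδ c hne)
        (continuousAt_competitor hke (by omega) hδ d hne)
      rw [hval, hval] at h
      exact Subtype.ext h
    have : Infinite (Icc (0 : ℝ) 1) := (Icc_infinite zero_lt_one).to_subtype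
    exact Set.infinite_of_injective_forall_mem hinj hmem

end LeastGradient

theorem proposition1p5 (n : ℕ) (hn : 2 ≤ n) (α : ℝ≥0) (hα : α < 1) :
    ∃ (Ω : Set (EuclideanSpace ℝ (Fin n))) (f : C(frontier Ω, ℝ))
      (a : EuclideanSpace ℝ (Fin n) → ℝ),
      LeastGradient.IsBoundedSmoothDomain Ω ∧
      IsConnected (frontier Ω) ∧
      LeastGradient.IsC1Holder α Ω a ∧
      (∃ c : ℝ, 0 < c ∧ ∀ x ∈ Ω, c ≤ a x) ∧
      (LeastGradient.minimizers Ω a f).Infinite :=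
  LeastGradient.exists_infinite_minimizers n hn α hα
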